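/- **Setting.** For $a=(a_1,a_2,a_3)$ with $a_i>0$ let $\mathbb T^3=\prod_{i=1}^3[0,2\pi a_i]$ with periodic boundary conditions, $x=(x_h,x_3)$, and for $n\in\mathbb Z^3$ let $\check n=(n_1/a_1,n_2/a_2,n_3/a_3)$, $\check n_h=(\check n_1,\check n_2)$. Let $\nu,\nu'>0$. Fields $V=(v,V^4)$ on $\mathbb T^3$ are $\mathbb R^4$-valued, with mean zero and $\operatorname{div}v=0$ (which is what $\operatorname{div}V=0$ means); $\hat V(n)$ are the Fourier coefficients with respect to $e^{i\check n\cdot x}$. Let $\mathbb P$ be the Leray projection on the first three components (the identity on the fourth) and $\mathcal A V=(0,0,V^4,-V^3)$. For $n_h\neq0$ the operator $\mathbb P\mathcal A$ acts on the divergence-free vectors at frequency $n$ with eigenvalues $i\omega^0=0$, $i\omega^\pm(n)=\pm i|\check n_h|/|\check n|$ and orthonormal eigenvectors $$e^0(n)=\frac1{|\check n_h|}(-\check n_2,\check n_1,0,0),\qquad e^\pm(n)=\frac1{\sqrt2}\Big(\pm i\frac{\check n_1\check n_3}{|\check n_h||\check n|},\ \pm i\frac{\check n_2\check n_3}{|\check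 n_h||\check n|},\ \mp i\frac{|\check n_h|}{|\check n|},\ 1\Big).$$ For $c\in\{0,+,-\}$ let $\Pi^c_n$ be the orthogonal projection of $\mathbb C^4$ onto $\mathbb Ce^c(n)$. If $n_h=0$, $n\ne0$, then $\mathbb P\mathcal A$ vanishes on all divergence-free vectors $(v_1,v_2,0,v_4)$, and one sets $\Pi^0_n v=(v_1,v_2,0,v_4)$, $\Pi^\pm_n=0$, $\omega^\pm(n)=0$; also $\Pi^c_0=0$. Write $U^c(n)=\Pi_n^c\hat U(n)$ and let $\bar U$ and $U_{\rm osc}$, with Fourier coefficients $U^0(n)$ and $U^+(n)+U^-(n)$, be the projections of $U$ onto $\ker\mathbb P\mathcal A$ and $(\ker\mathbb P\mathcal A)^\perp$. Put $$\widehat{\mathcal T(A,B)}(n)=\sum_{\alpha,\beta,\gamma\in\{0,+,-\}}\ \sum_{\substack{k+m=n\\ \omega^\alpha(k)+\omega^\beta(m)=\omega^\gamma(n)}}\Pi^\gamma_n\Big[\Big(\sum_{j=1}^3A^{\alpha,j}(k)\,i\check m_j\Big)B^\beta(m)\Big],\qquad \mathcal Q(A,B)=\tfrac12\big(\mathcal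 T(A,B)+\mathcal T(B,A)\big),$$ $$\widehat{\mathbb DU}(n)=\sum_{\omega^\alpha(n)=\omega^\beta(n)}\Pi^\beta_n\,\mathbb D(n)\,U^\alpha(n),\qquad \mathbb D(n)=-|\check n|^2\operatorname{diag}(\nu,\nu,\nu,\nu').$$ The limit system is $$(\mathcal S_0)\qquad \partial_tU+\mathcal Q(U,U)-\mathbb DU=0,\qquad U|_{t=0}=V_0 .$$ **Theorem.** Let $V_0\in L^2(\mathbb T^3;\mathbb R^4)$ be divergence free with zero horizontal average ($\int V_0(x_h,x_3)\,dx_h=0$ for a.e. $x_3$). Put $\omega_0^h=-\partial_2V_0^1+\partial_1V_0^2$, $\bar u_0^h=\nabla_h^\perp\Delta_h^{-1}\omega_0^h$, $\bar U_0=(\bar u_0^h,0,0)$ and $U_{{\rm osc},0}=V_0-\bar U_0$. Let $U\in L^2_{\rm loc}([0,\infty);L^2(\mathbb T^3;\mathbb R^4))$, with mean zero and divergence free, be a solution of $(\mathcal S_0)$ in the sense of distributions. 1. For every $a$ (with $a_i>0$), the projection $\bar U$ of $U$ onto $\ker\mathbb P\mathcal A$ has the form $\bar U=(\bar u^h,0,0)$,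 and $\bar u^h$ solves in the sense of distributions, for some pressure $\bar p$, the two-dimensional stratified Navier–Stokes system with full diffusion $$\partial_t\bar u^h+\bar u^h\cdot\nabla_h\bar u^h-\nu\Delta\bar u^h=-\nabla_h\bar p,\qquad \operatorname{div}_h\bar u^h=0,\qquad \bar u^h|_{t=0}=\bar u^h_0,$$ where $\Delta=\partial_1^2+\partial_2^2+\partial_3^2$ and all functions depend on $(t,x_h,x_3)$. 2. There is a Lebesgue-null set of $a\in\mathbb R^3$, independent of $\nu,\nu',V_0,U$, such that for every other $a$ (with $a_i>0$) one has $U=\bar U+U_{\rm osc}$ and $U_{\rm osc}$ solves in the sense of distributions the linear system $$\partial_tU_{\rm osc}+2\mathcal Q(\bar U,U_{\rm osc})-\frac{\nu+\nu'}2\,\Delta U_{\rm osc}=0,\qquad \operatorname{div}U_{\rm osc}=0,\qquad U_{\rm osc}|_{t=0}=U_{{\rm osc},0}.$$ -/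

import Mathlib

open scoped ContDiff

noncomputable section

namespace StratifiedLimit

/-! ### The torus, Fourier coefficients, test functions

Points of space are `x : Fin 3 → ℝ`; the coordinates `x 0, x 1` are horizontal, `x 2` is vertical.
A field on the torus is given by its values on one period cell; test functions are periodic. -/

/-- The torus `∏ [0, 2π aᵢ]` with parameters `a`. -/
def torus (a : Fin 3 → ℝ) : Set (Fin 3 → ℝ) :=
  Set.Icc 0 (fun i => 2 * Real.pi * a i)

/-- The volume of the torus. -/
def torusVol (a : Fin 3 → ℝ) : ℝ := ∏ i, 2 * Real.pi * a i

/-- The wave vector `(n₁ / a₁, n₂ / a₂, n₃ / a₃)`. -/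
def wave (a : Fin 3 → ℝ) (n : Fin 3 → ℤ) : Fin 3 → ℝ := fun i => (n i : ℝ) / a i

/-- Length of the horizontal part of a wave vector. -/
def hLen (ξ : Fin 3 → ℝ) : ℝ := Real.sqrt (ξ 0 ^ 2 + ξ 1 ^ 2)

/-- Euclidean length of a wave vector. -/
def len (ξ : Fin 3 → ℝ) : ℝ := Real.sqrt (ξ 0 ^ 2 + ξ 1 ^ 2 + ξ 2 ^ 2)

/-- Fourier coefficient of a scalar function on the torus. -/
def coeff (a : Fin 3 → ℝ) (f : (Fin 3 → ℝ) → ℝ) (n : Fin 3 → ℤ) : ℂ :=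
  (torusVol a : ℂ)⁻¹ *
    ∫ x in torus a, (f x : ℂ) * Complex.exp (-(Complex.I * ((∑ i, wave a n i * x i : ℝ) : ℂ)))

/-- Fourier coefficients of a vector field on the torus, component by component. -/
def vcoeff {d : ℕ} (a : Fin 3 → ℝ) (f : (Fin 3 → ℝ) → (Fin d → ℝ)) (n : Fin 3 → ℤ) :
    Fin d → ℂ :=
  fun j => coeff a (fun x => f x j) n

/-- Periodicity with periods `2π aᵢ`. -/
def IsPeriodic {E : Type*} (a : Fin 3 → ℝ) (f : (Fin 3 → ℝ) → E) : Prop :=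
  ∀ x i, f (x + Pi.single i (2 * Real.pi * a i)) = f x

/-- Test functions on `[0, ∞) × 𝕋³`: smooth, periodic in space, vanishing for large times
(not necessarily at time `0`). -/
structure IsTest {E : Type*} [NormedAddCommGroup E] [NormedSpace ℝ E] (a : Fin 3 → ℝ)
    (φ : ℝ → (Fin 3 → ℝ) → E) : Prop where
  smooth : ContDiff ℝ ∞ (fun q : ℝ × (Fin 3 → ℝ) => φ q.1 q.2)
  periodic : ∀ t, IsPeriodic a (φ t)
  support : ∃ T : ℝ, ∀ t x, T ≤ t → φ t x = 0

/-- The partial derivative `∂ᵢ f`. -/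
def pd {E : Type*} [NormedAddCommGroup E] [NormedSpace ℝ E] (i : Fin 3)
    (f : (Fin 3 → ℝ) → E) (x : Fin 3 → ℝ) : E :=
  fderiv ℝ f x (Pi.single i 1)

/-- The Laplacian in all three variables. -/
def lap {E : Type*} [NormedAddCommGroup E] [NormedSpace ℝ E]
    (f : (Fin 3 → ℝ) → E) (x : Fin 3 → ℝ) : E :=
  ∑ i, pd i (pd i f) x

/-- The pairing of the periodic distribution with Fourier coefficients `F n` with a smooth
periodic function `ψ`. -/
def pairing (a : Fin 3 → ℝ) (F : (Fin 3 → ℤ) → ℂ) (ψ : (Fin 3 → ℝ) → ℝ) : ℂ :=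
  (torusVol a : ℂ) * ∑' n, F n * (starRingEnd ℂ) (coeff a ψ n)

/-- The pairing of vector valued distributions with vector valued test functions. -/
def vpairing {d : ℕ} (a : Fin 3 → ℝ) (F : (Fin 3 → ℤ) → (Fin d → ℂ))
    (φ : (Fin 3 → ℝ) → (Fin d → ℝ)) : ℂ :=
  ∑ j, pairing a (fun n => F n j) (fun x => φ x j)

/-- Membership in `L²(𝕋³)`. -/
def IsL2 {d : ℕ} (a : Fin 3 → ℝ) (f : (Fin 3 → ℝ) → (Fin d → ℝ)) : Prop :=
  MeasureTheory.MemLp f 2 (MeasureTheory.volume.restrict (torus a))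

/-- Membership in `L²_loc([0, ∞); L²(𝕋³))`. -/
def IsL2Loc {d : ℕ} (a : Fin 3 → ℝ) (u : ℝ → (Fin 3 → ℝ) → (Fin d → ℝ)) : Prop :=
  ∀ T : ℝ, MeasureTheory.MemLp (fun q : ℝ × (Fin 3 → ℝ) => u q.1 q.2) 2
    (MeasureTheory.volume.restrict (Set.Icc 0 T ×ˢ torus a))

/-- `div v = 0` in the sense of distributions, for `V = (v, V⁴)`. -/
def IsDivFree (a : Fin 3 → ℝ) (V : (Fin 3 → ℝ) → (Fin 4 → ℝ)) : Prop :=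
  ∀ ψ : (Fin 3 → ℝ) → ℝ, ContDiff ℝ ∞ ψ → IsPeriodic a ψ →
    ∫ x in torus a, ∑ i : Fin 3, V x i.castSucc * pd i ψ x = 0

/-- `div_h u = 0` in the sense of distributions, for a horizontal field `u`. -/
def IsHDivFree (a : Fin 3 → ℝ) (u : (Fin 3 → ℝ) → (Fin 2 → ℝ)) : Prop :=
  ∀ ψ : (Fin 3 → ℝ) → ℝ, ContDiff ℝ ∞ ψ → IsPeriodic a ψ →
    ∫ x in torus a, ∑ i : Fin 2, u x i * pd i.castSucc ψ x = 0

/-- Zero horizontal average at almost every height `s`. -/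
def HasZeroHAverage (a : Fin 3 → ℝ) (V : (Fin 3 → ℝ) → (Fin 4 → ℝ)) : Prop :=
  ∀ᵐ s ∂(MeasureTheory.volume.restrict (Set.Icc 0 (2 * Real.pi * a 2))),
    ∫ y in Set.Icc (0 : Fin 2 → ℝ) (fun i => 2 * Real.pi * a i.castSucc),
      V ![y 0, y 1, s] = 0

/-! ### Spectral decomposition of the penalized operator

The three values of `SignType` are the labels `0, +, -` of the modes. -/

/-- The frequency `ω^σ(n) = σ |n_h| / |n|`; the eigenvalue of the symbol is `i ω^σ(n)`. -/
def omega (a : Fin 3 → ℝ) (n : Fin 3 → ℤ) (σ : SignType) : ℝ :=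
  (σ : ℝ) * (hLen (wave a n) / len (wave a n))

/-- The unit eigenvectors `e⁰(n)`, `e^±(n)`, for `n_h ≠ 0`. -/
def eigvec (a : Fin 3 → ℝ) (n : Fin 3 → ℤ) (σ : SignType) : Fin 4 → ℂ :=
  let ξ := wave a n
  if σ = 0 then
    fun j => ((![-ξ 1 / hLen ξ, ξ 0 / hLen ξ, 0, 0] j : ℝ) : ℂ)
  else
    (1 / (Real.sqrt 2 : ℂ)) •
      ![((σ : ℝ) : ℂ) * Complex.I * ((ξ 0 * ξ 2 / (hLen ξ * len ξ) : ℝ) : ℂ),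
        ((σ : ℝ) : ℂ) * Complex.I * ((ξ 1 * ξ 2 / (hLen ξ * len ξ) : ℝ) : ℂ),
        -(((σ : ℝ) : ℂ) * Complex.I * ((hLen ξ / len ξ : ℝ) : ℂ)),
        1]

/-- The orthogonal projection of `ℂ⁴` onto the mode `σ` at frequency `n`: onto the line spanned by
`e^σ(n)` if `n_h ≠ 0`. If `n_h = 0` and `n ≠ 0`, the operator vanishes on the divergence-free
vectors `(v₁, v₂, 0, v₄)`; all of them then belong to the mode `0`, and there is nothing in the
modes `±`. Fields have mean zero, so there is no mode at `n = 0`. -/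
def modeProj (a : Fin 3 → ℝ) (n : Fin 3 → ℤ) (σ : SignType) (v : Fin 4 → ℂ) : Fin 4 → ℂ :=
  if n 0 = 0 ∧ n 1 = 0 then
    if σ = 0 ∧ n 2 ≠ 0 then ![v 0, v 1, 0, v 3] else 0
  else
    (∑ j, v j * (starRingEnd ℂ) (eigvec a n σ j)) • eigvec a n σ

/-- Projection of a field (through its Fourier coefficients) onto the divergence-free part of the
kernel, i.e. the non-oscillating part. -/
def kerPart (a : Fin 3 → ℝ) (A : (Fin 3 → ℤ) → (Fin 4 → ℂ)) : (Fin 3 → ℤ) → (Fin 4 → ℂ) :=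
  fun n => modeProj a n 0 (A n)

/-- Projection of a field (through its Fourier coefficients) onto the oscillating part. -/
def oscPart (a : Fin 3 → ℝ) (A : (Fin 3 → ℤ) → (Fin 4 → ℂ)) : (Fin 3 → ℤ) → (Fin 4 → ℂ) :=
  fun n => modeProj a n 1 (A n) + modeProj a n (-1) (A n)

/-! ### The limit system -/

open Classical in
/-- The resonant part of `ℙ (A · ∇ B)`, in Fourier variables: only the triads with `k + m = n` and
`ω^α(k) + ω^β(m) = ω^γ(n)` are kept, with `m = n - k`. -/
def resonantTransport (a : Fin 3 → ℝ) (A B : (Fin 3 → ℤ) → (Fin 4 → ℂ)) (n : Fin 3 → ℤ) :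
    Fin 4 → ℂ :=
  ∑ α : SignType, ∑ β : SignType, ∑ γ : SignType, ∑' k : Fin 3 → ℤ,
    if omega a k α + omega a (n - k) β = omega a n γ then
      modeProj a n γ
        ((∑ j : Fin 3,
            modeProj a k α (A k) j.castSucc * (Complex.I * (wave a (n - k) j : ℂ))) •
          modeProj a (n - k) β (B (n - k)))
    else 0

/-- The symmetric bilinear form `𝒬` of the limit system, in Fourier variables. -/
def limitQ (a : Fin 3 → ℝ) (A B : (Fin 3 → ℤ) → (Fin 4 → ℂ)) (n : Fin 3 → ℤ) : Fin 4 → ℂ :=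
  (1 / 2 : ℂ) • (resonantTransport a A B n + resonantTransport a B A n)

/-- The symbol of `diag(νΔ, νΔ, νΔ, ν'Δ)`. -/
def diffSymbol (a : Fin 3 → ℝ) (ν ν' : ℝ) (n : Fin 3 → ℤ) (v : Fin 4 → ℂ) : Fin 4 → ℂ :=
  fun j => -(((![ν, ν, ν, ν'] j * len (wave a n) ^ 2 : ℝ)) : ℂ) * v j

open Classical in
/-- The second order operator `𝔻` of the limit system, in Fourier variables. -/
def limitD (a : Fin 3 → ℝ) (ν ν' : ℝ) (A : (Fin 3 → ℤ) → (Fin 4 → ℂ)) (n : Fin 3 → ℤ) :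
    Fin 4 → ℂ :=
  ∑ α : SignType, ∑ β : SignType,
    if omega a n α = omega a n β then
      modeProj a n β (diffSymbol a ν ν' n (modeProj a n α (A n)))
    else 0

/-- Admissible initial data: square integrable, divergence free, zero horizontal average. -/
structure IsInitialDatum (a : Fin 3 → ℝ) (V₀ : (Fin 3 → ℝ) → (Fin 4 → ℝ)) : Prop where
  isL2 : IsL2 a V₀
  divFree : IsDivFree a V₀
  zeroHAverage : HasZeroHAverage a V₀

/-- `U` is a (mean zero, divergence free) solution, in the sense of distributions, of
`∂ₜ U + 𝒬(U, U) - 𝔻 U = 0`, `U(0) = V₀`. -/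
structure IsLimitSolution (a : Fin 3 → ℝ) (ν ν' : ℝ) (V₀ : (Fin 3 → ℝ) → (Fin 4 → ℝ))
    (U : ℝ → (Fin 3 → ℝ) → (Fin 4 → ℝ)) : Prop where
  isL2Loc : IsL2Loc a U
  meanZero : ∀ᵐ t ∂(MeasureTheory.volume.restrict (Set.Ioi (0 : ℝ))),
    ∫ x in torus a, U t x = 0
  divFree : ∀ᵐ t ∂(MeasureTheory.volume.restrict (Set.Ioi (0 : ℝ))), IsDivFree a (U t)
  equation : ∀ φ : ℝ → (Fin 3 → ℝ) → (Fin 4 → ℝ), IsTest a φ →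
    (((∫ t in Set.Ioi (0 : ℝ), ∫ x in torus a, ∑ j, U t x j * deriv (fun s => φ s x) t j)
        + ∫ x in torus a, ∑ j, V₀ x j * φ 0 x j : ℝ) : ℂ)
      = ∫ t in Set.Ioi (0 : ℝ),
          vpairing a
            (fun n => limitQ a (vcoeff a (U t)) (vcoeff a (U t)) n
              - limitD a ν ν' (vcoeff a (U t)) n) (φ t)

/-! ### The two simplified systems -/

/-- `ū₀ = ∇_h^⊥ Δ_h⁻¹ ω₀` with `ω₀ = -∂₂ V₀¹ + ∂₁ V₀²`. The inverse of `Δ_h` acts on functions with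
zero horizontal average: where `n_h = 0`, the division by `0` below returns `0`. -/
structure IsHorizontalPart (a : Fin 3 → ℝ) (V₀ : (Fin 3 → ℝ) → (Fin 4 → ℝ))
    (u₀ : (Fin 3 → ℝ) → (Fin 2 → ℝ)) : Prop where
  isL2 : IsL2 a u₀
  biotSavart : ∀ n : Fin 3 → ℤ,
    let d : Fin 3 → ℂ := fun i => Complex.I * (wave a n i : ℂ)
    let ω₀ : ℂ := -(d 1 * vcoeff a V₀ n 0) + d 0 * vcoeff a V₀ n 1
    let ψ₀ : ℂ := ω₀ / (-(hLen (wave a n) : ℂ) ^ 2)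
    vcoeff a u₀ n = ![-(d 1 * ψ₀), d 0 * ψ₀]

/-- A horizontal field seen as a field with four components. -/
def lift (u : (Fin 3 → ℝ) → (Fin 2 → ℝ)) : (Fin 3 → ℝ) → (Fin 4 → ℝ) :=
  fun x => ![u x 0, u x 1, 0, 0]

/-- `p` is a real distribution on `(0, ∞) × 𝕋³`, given by the Fourier coefficients `p t n`, which
are bounded by a locally integrable function of time. -/
structure IsPressure (p : ℝ → (Fin 3 → ℤ) → ℂ) : Prop where
  measurable : ∀ n, MeasureTheory.AEStronglyMeasurable (fun t => p t n)
    (MeasureTheory.volume.restrict (Set.Ioi (0 : ℝ)))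
  real : ∀ t n, p t (-n) = (starRingEnd ℂ) (p t n)
  bounded : ∃ g : ℝ → ℝ,
    (∀ T : ℝ, MeasureTheory.IntegrableOn g (Set.Icc 0 T)) ∧
    ∀ᵐ t ∂(MeasureTheory.volume.restrict (Set.Ioi (0 : ℝ))), ∀ n, ‖p t n‖ ≤ g t

/-- `u` solves, in the sense of distributions,
`∂ₜ u + u · ∇_h u - ν Δ u = -∇_h p`, `div_h u = 0`, `u(0) = u₀`,
with the horizontal transport and the full Laplacian in `x ∈ 𝕋³`. -/
structure IsStratifiedNS (a : Fin 3 → ℝ) (ν : ℝ) (u₀ : (Fin 3 → ℝ) → (Fin 2 → ℝ))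
    (u : ℝ → (Fin 3 → ℝ) → (Fin 2 → ℝ)) : Prop where
  isL2Loc : IsL2Loc a u
  divFree : ∀ᵐ t ∂(MeasureTheory.volume.restrict (Set.Ioi (0 : ℝ))), IsHDivFree a (u t)
  equation : ∃ p : ℝ → (Fin 3 → ℤ) → ℂ, IsPressure p ∧
    ∀ φ : ℝ → (Fin 3 → ℝ) → (Fin 2 → ℝ), IsTest a φ →
      (((∫ t in Set.Ioi (0 : ℝ), ∫ x in torus a,
            ((∑ i, u t x i * deriv (fun s => φ s x) t i)
              + (∑ i, ∑ j : Fin 2, u t x i * u t x j * pd j.castSucc (φ t) x i)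
              + ν * ∑ i, u t x i * lap (φ t) x i))
          + ∫ x in torus a, ∑ i, u₀ x i * φ 0 x i : ℝ) : ℂ)
        = -∫ t in Set.Ioi (0 : ℝ),
            pairing a (p t) (fun x => ∑ i : Fin 2, pd i.castSucc (φ t) x i)

/-- `W` solves, in the sense of distributions, the linear system
`∂ₜ W + 2 𝒬(B, W) - κ Δ W = 0`, `div W = 0`, `W(0) = W₀`, where the coefficient field `B` is given
by its Fourier coefficients. -/
structure IsLinearSolution (a : Fin 3 → ℝ) (κ : ℝ) (B : ℝ → (Fin 3 → ℤ) → (Fin 4 → ℂ))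
    (W₀ : (Fin 3 → ℝ) → (Fin 4 → ℝ)) (W : ℝ → (Fin 3 → ℝ) → (Fin 4 → ℝ)) : Prop where
  isL2Loc : IsL2Loc a W
  divFree : ∀ᵐ t ∂(MeasureTheory.volume.restrict (Set.Ioi (0 : ℝ))), IsDivFree a (W t)
  equation : ∀ φ : ℝ → (Fin 3 → ℝ) → (Fin 4 → ℝ), IsTest a φ →
    (((∫ t in Set.Ioi (0 : ℝ), ∫ x in torus a,
          ((∑ j, W t x j * deriv (fun s => φ s x) t j) + κ * ∑ j, W t x j * lap (φ t) x j))
        + ∫ x in torus a, ∑ j, W₀ x j * φ 0 x j : ℝ) : ℂ)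
      = ∫ t in Set.Ioi (0 : ℝ),
          vpairing a (fun n => (2 : ℂ) • limitQ a (B t) (vcoeff a (W t)) n) (φ t)

end StratifiedLimit

end

open scoped ContDiff

noncomputable section

namespace StratifiedLimit

open MeasureTheory

/-! ### Characters and complex Fourier coefficients -/

/-! The argument is carried out frequency by frequency. A field in `L²_loc([0,∞); L²)` solves one of
the systems in the sense of distributions exactly when each Fourier coefficient solves a scalar
equation `y' + h = 0`, `y(0) = y₀` in the weak sense (`ModeEq`). The passage from the system to the
modes is `modeEq_of_equation`: test functions are real, and two of them are combined to isolate one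
frequency. The way back is `equation_of_modeEq`: it exchanges sum and integral, which is legitimate
because the coefficients of test functions decay faster than any power of `wt`, while the nonlinear
and diffusive terms grow at most like `wt` times a locally integrable function of time (`IsSource`).
Linear projections can then be applied to the mode equations, and what remains is algebra of triads.

Kernel part. Apply `Π⁰` to `𝒬(U, U)`. A triad with a kernel input, an oscillating input and a kernel
output is resonant only if the oscillating input has frequency zero, hence `n_h = 0` there, where
`Π^±` is zero. Two oscillating inputs resonate with a kernel output only for opposite signs and
equal ratios `|ξ_h|/|ξ|`. Each single triad of this kind may be nonzero, but the sum over the two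
orders of the inputs has no kernel component (`polar_cancel`, `modeProj_cancel`,
`tsum_triad_cancel`). Only kernel–kernel interactions survive (`modeProj_limitQ`). For `n_h ≠ 0`
these are the two-dimensional Leray projection of `div_h (ū ⊗ ū)`, and the complementary projection
is the pressure gradient (`kerTransport_eq_add_pressure`). At `n_h = 0` they vanish, so the
corresponding kernel modes solve a linear heat equation with zero data and stay zero (`ae_hzero`);
this is why `Ū` has neither a third nor a fourth component.

Oscillating part. Subtracting the kernel equation leaves `2𝒬(Ū, U_osc)` and triads of three
oscillating modes. The latter are absent for almost every torus: for fixed frequencies and signs,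
the resonance defect is real-analytic in `a₃` and tends to a sum of three signs, hence to an odd
number, as `a₃ → ∞`. Its zeros form a null set, Fubini removes the horizontal periods, and there are
countably many triads (`ae_nonresonant`). The diffusion acts as `ν` on `e⁰`, which has no fourth
component, and as `(ν + ν')/2` on `e^±`, whose squared length is divided equally between velocity
and fourth component (`limitD_eq`).

The projected coefficients are turned back into genuine fields by a Riesz–Fischer theorem with time
as a parameter (`exists_field`). -/

/-- The character `e^{i ň · x}`. -/
def chr (a : Fin 3 → ℝ) (n : Fin 3 → ℤ) (x : Fin 3 → ℝ) : ℂ :=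
  Complex.exp (Complex.I * ((∑ i, wave a n i * x i : ℝ) : ℂ))

/-- Fourier coefficient of a complex valued function on the torus. -/
def ccoeff (a : Fin 3 → ℝ) (f : (Fin 3 → ℝ) → ℂ) (n : Fin 3 → ℤ) : ℂ :=
  (torusVol a : ℂ)⁻¹ * ∫ x in torus a, f x * chr a (-n) x

variable {a : Fin 3 → ℝ}

lemma wave_neg (n : Fin 3 → ℤ) (i : Fin 3) : wave a (-n) i = -wave a n i := by
  simp [wave, neg_div]

lemma wave_add (n m : Fin 3 → ℤ) (i : Fin 3) : wave a (n + m) i = wave a n i + wave a m i := by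
  simp [wave, add_div]

lemma wave_sub (n m : Fin 3 → ℤ) (i : Fin 3) : wave a (n - m) i = wave a n i - wave a m i := by
  simp [wave, sub_div]

lemma chr_neg (n : Fin 3 → ℤ) (x : Fin 3 → ℝ) :
    chr a (-n) x = Complex.exp (-(Complex.I * ((∑ i, wave a n i * x i : ℝ) : ℂ))) := by
  simp only [chr, wave_neg, neg_mul, Finset.sum_neg_distrib, Complex.ofReal_neg, mul_neg]

lemma chr_add (n m : Fin 3 → ℤ) (x : Fin 3 → ℝ) : chr a (n + m) x = chr a n x * chr a m x := by
  simp only [chr, wave_add, add_mul, Finset.sum_add_distrib, Complex.ofReal_add, mul_add,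
    Complex.exp_add]

lemma conj_chr (n : Fin 3 → ℤ) (x : Fin 3 → ℝ) : (starRingEnd ℂ) (chr a n x) = chr a (-n) x := by
  rw [chr_neg, chr, ← Complex.exp_conj]
  simp

lemma norm_chr (n : Fin 3 → ℤ) (x : Fin 3 → ℝ) : ‖chr a n x‖ = 1 := by
  rw [chr, mul_comm, Complex.norm_exp_ofReal_mul_I]

lemma contDiff_chr (n : Fin 3 → ℤ) : ContDiff ℝ ∞ (chr a n) := by
  have h : ContDiff ℝ ∞ (fun x : Fin 3 → ℝ => ∑ i, wave a n i * x i) :=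
    ContDiff.sum fun i _ => by fun_prop
  exact ContDiff.cexp (contDiff_const.mul (Complex.ofRealCLM.contDiff.comp h))

lemma continuous_chr (n : Fin 3 → ℤ) : Continuous (chr a n) := (contDiff_chr n).continuous

lemma coeff_eq_ccoeff (f : (Fin 3 → ℝ) → ℝ) (n : Fin 3 → ℤ) :
    coeff a f n = ccoeff a (fun x => (f x : ℂ)) n := by
  simp only [coeff, ccoeff, chr_neg]

lemma torusVol_pos (ha : ∀ i, 0 < a i) : 0 < torusVol a :=
  Finset.prod_pos fun i _ => by have := ha i; positivity

lemma isPeriodic_chr (ha : ∀ i, 0 < a i) (n : Fin 3 → ℤ) : IsPeriodic a (chr a n) := by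
  intro x i
  have h : ∑ j, wave a n j * (x + Pi.single i (2 * Real.pi * a i) : Fin 3 → ℝ) j
      = ∑ j, wave a n j * x j + n i * (2 * Real.pi) := by
    simp only [Pi.add_apply, mul_add, Finset.sum_add_distrib]
    congr 1
    rw [Finset.sum_eq_single i]
    · simp only [Pi.single_eq_same, wave]
      have := (ha i).ne'
      field_simp
    · intro b _ hb
      simp [hb]
    · simp
  unfold chr
  rw [h]
  push_cast
  rw [mul_add, Complex.exp_add]
  have : Complex.I * (n i * (2 * Real.pi)) = n i * (2 * Real.pi * Complex.I) := by ring
  rw [this, Complex.exp_int_mul_two_pi_mul_I, mul_one]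

/-! ### Transport from the unit torus -/

section Transport

local instance : MeasureSpace UnitAddCircle := ⟨AddCircle.haarAddCircle⟩

/-- The coordinates in the period cell of a point of the unit torus. -/
def cell (a : Fin 3 → ℝ) (z : UnitAddTorus (Fin 3)) : Fin 3 → ℝ :=
  fun i => 2 * Real.pi * a i * (AddCircle.equivIoc (1 : ℝ) 0 (z i) : ℝ)

/-- Haar measure on the unit circle is Lebesgue measure on `(0, 1]`, so dilation by `c` yields
normalised Lebesgue measure on `(0, c]`. This is one factor of the transport from the unit torus. -/
lemma map_haar_equivIoc {c : ℝ} (hc : 0 < c) :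
    MeasurePreserving (fun z : UnitAddCircle => c * (AddCircle.equivIoc (1 : ℝ) 0 z : ℝ))
      AddCircle.haarAddCircle (ENNReal.ofReal c⁻¹ • volume.restrict (Set.Ioc 0 c)) := by
  have hvol : (AddCircle.haarAddCircle : Measure UnitAddCircle)
      = @volume _ (AddCircle.measureSpace 1) := by
    rw [AddCircle.volume_eq_smul_haarAddCircle]; simp
  have h1 := AddCircle.measurePreserving_equivIoc (1 : ℝ) (a := 0)
  have h2 : MeasurePreserving (Subtype.val : Set.Ioc (0 : ℝ) (0 + 1) → ℝ)
      (Measure.comap Subtype.val volume) (volume.restrict (Set.Ioc 0 1)) := by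
    refine ⟨measurable_subtype_coe, ?_⟩
    rw [map_comap_subtype_coe measurableSet_Ioc]; simp
  have h3 : MeasurePreserving (fun x : ℝ => c * x) (volume.restrict (Set.Ioc 0 1))
      (ENNReal.ofReal c⁻¹ • volume.restrict (Set.Ioc 0 c)) := by
    refine ⟨by fun_prop, ?_⟩
    have hpre : Set.Ioc (0 : ℝ) 1 = (fun x : ℝ => c * x) ⁻¹' Set.Ioc 0 c := by
      ext x
      simp only [Set.mem_Ioc, Set.mem_preimage]
      constructor
      · rintro ⟨h, h'⟩; exact ⟨by positivity, by nlinarith⟩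
      · rintro ⟨h, h'⟩; exact ⟨pos_of_mul_pos_right h hc.le, by nlinarith⟩
    rw [hpre, ← Measure.restrict_map (by fun_prop) measurableSet_Ioc,
      Real.map_volume_mul_left hc.ne', Measure.restrict_smul, abs_of_pos (inv_pos.2 hc)]
  rw [hvol]
  exact h3.comp (h2.comp h1)

/-- Product of the one-dimensional dilations; the half-open cell and the closed box `torus a` differ
by a null set. -/
lemma measurePreserving_cell (ha : ∀ i, 0 < a i) :
    MeasurePreserving (cell a) volume
      (ENNReal.ofReal (torusVol a)⁻¹ • volume.restrict (torus a)) := by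
  have hc : ∀ i, 0 < 2 * Real.pi * a i := fun i => by have := ha i; positivity
  have : ∀ i, IsFiniteMeasure (ENNReal.ofReal (2 * Real.pi * a i)⁻¹ •
      (volume : Measure ℝ).restrict (Set.Ioc 0 (2 * Real.pi * a i))) :=
    fun i => Measure.smul_finite _ ENNReal.ofReal_ne_top
  have h := measurePreserving_pi (fun _ : Fin 3 => (AddCircle.haarAddCircle : Measure UnitAddCircle))
    (fun i => ENNReal.ofReal (2 * Real.pi * a i)⁻¹ • volume.restrict (Set.Ioc 0 (2 * Real.pi * a i)))
    (fun i => map_haar_equivIoc (hc i))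
  have hm : Measure.pi (fun i : Fin 3 => ENNReal.ofReal (2 * Real.pi * a i)⁻¹ •
      (volume : Measure ℝ).restrict (Set.Ioc 0 (2 * Real.pi * a i)))
      = ENNReal.ofReal (torusVol a)⁻¹ • volume.restrict (torus a) := by
    refine Measure.pi_eq fun s hs => ?_
    have hae : (volume : Measure (Fin 3 → ℝ)).restrict (torus a)
        = Measure.pi fun i => (volume : Measure ℝ).restrict (Set.Ioc 0 (2 * Real.pi * a i)) := by
      rw [← Measure.restrict_pi_pi]
      exact Measure.restrict_congr_set Measure.univ_pi_Ioc_ae_eq_Icc.symm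
    rw [hae, Measure.smul_apply, Measure.pi_pi]
    simp only [Measure.smul_apply, smul_eq_mul]
    rw [Finset.prod_mul_distrib, torusVol, ← Finset.prod_inv_distrib,
      ENNReal.ofReal_prod_of_nonneg fun i _ => (inv_pos.2 (hc i)).le]
  rw [hm] at h
  exact h

/-- The factors `a i` in `wave` and in `cell` cancel, so the orthonormal characters of the unit
torus become the family `chr`. -/
lemma mFourier_eq_chr_cell (ha : ∀ i, 0 < a i) (n : Fin 3 → ℤ) (z : UnitAddTorus (Fin 3)) :
    UnitAddTorus.mFourier n z = chr a n (cell a z) := by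
  have hz : ∀ i, fourier (n i) (z i)
      = Complex.exp (Complex.I * ((wave a n i * cell a z i : ℝ) : ℂ)) := by
    intro i
    conv_lhs => rw [← AddCircle.coe_equivIoc (p := (1 : ℝ)) (a := 0) (y := z i)]
    rw [fourier_coe_apply]
    congr 1
    have := (ha i).ne'
    have h : wave a n i * cell a z i
        = 2 * Real.pi * n i * (AddCircle.equivIoc (1 : ℝ) 0 (z i) : ℝ) := by
      simp only [wave, cell]; field_simp
    rw [h]
    push_cast
    ring
  simp only [UnitAddTorus.mFourier, ContinuousMap.coe_mk, hz, chr, ← Complex.exp_sum]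
  rw [← Finset.mul_sum]
  push_cast
  rfl

lemma integral_cell (ha : ∀ i, 0 < a i) {f : (Fin 3 → ℝ) → ℂ}
    (hf : AEStronglyMeasurable f (volume.restrict (torus a))) :
    ∫ z, f (cell a z) = (torusVol a : ℂ)⁻¹ * ∫ x in torus a, f x := by
  have h := measurePreserving_cell ha
  rw [← integral_map h.measurable.aemeasurable, h.map_eq, integral_smul_measure]
  · rw [ENNReal.toReal_ofReal (inv_pos.2 (torusVol_pos ha)).le, Complex.real_smul]
    push_cast; rfl
  · rw [h.map_eq]; exact hf.smul_measure _

lemma memLp_cell (ha : ∀ i, 0 < a i) {f : (Fin 3 → ℝ) → ℂ}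
    (hf : MemLp f 2 (volume.restrict (torus a))) : MemLp (fun z => f (cell a z)) 2 volume :=
  (hf.smul_measure ENNReal.ofReal_ne_top).comp_measurePreserving (measurePreserving_cell ha)

/-- The bridge that turns Parseval's identity on the unit torus into the one for arbitrary periods.
-/
lemma ccoeff_eq_mFourierCoeff (ha : ∀ i, 0 < a i) {f : (Fin 3 → ℝ) → ℂ}
    (hf : MemLp f 2 (volume.restrict (torus a))) (n : Fin 3 → ℤ) :
    UnitAddTorus.mFourierCoeff ((memLp_cell ha hf).toLp _ : UnitAddTorus (Fin 3) → ℂ) n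
      = ccoeff a f n := by
  rw [ccoeff, ← integral_cell ha (f := fun x => f x * chr a (-n) x)
    (hf.1.mul (continuous_chr _).aestronglyMeasurable)]
  refine integral_congr_ae ?_
  filter_upwards [(memLp_cell ha hf).coeFn_toLp] with z hz
  rw [hz, mFourier_eq_chr_cell ha, smul_eq_mul, mul_comm]

/-- Parseval's identity on the torus. -/
lemma hasSum_conj_ccoeff_mul (ha : ∀ i, 0 < a i) {f g : (Fin 3 → ℝ) → ℂ}
    (hf : MemLp f 2 (volume.restrict (torus a))) (hg : MemLp g 2 (volume.restrict (torus a))) :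
    HasSum (fun n => (starRingEnd ℂ) (ccoeff a f n) * ccoeff a g n)
      ((torusVol a : ℂ)⁻¹ * ∫ x in torus a, (starRingEnd ℂ) (f x) * g x) := by
  have h := UnitAddTorus.hasSum_prod_mFourierCoeff ((memLp_cell ha hf).toLp _)
    ((memLp_cell ha hg).toLp _)
  simp only [ccoeff_eq_mFourierCoeff ha hf, ccoeff_eq_mFourierCoeff ha hg] at h
  rw [← integral_cell ha (f := fun x => (starRingEnd ℂ) (f x) * g x)
    ((Complex.continuous_conj.comp_aestronglyMeasurable hf.1).mul hg.1)]
  convert! h using 1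
  refine integral_congr_ae ?_
  filter_upwards [(memLp_cell ha hf).coeFn_toLp, (memLp_cell ha hg).coeFn_toLp] with z h1 h2
  rw [h1, h2]

/-- Orthonormality of the characters. -/
lemma ccoeff_chr (ha : ∀ i, 0 < a i) (n m : Fin 3 → ℤ) :
    ccoeff a (chr a m) n = if m = n then 1 else 0 := by
  have h := orthonormal_iff_ite.1 (UnitAddTorus.orthonormal_mFourier (d := Fin 3)) n m
  rw [ccoeff, ← integral_cell ha (f := fun x => chr a m x * chr a (-n) x)
    ((continuous_chr m).mul (continuous_chr (-n))).aestronglyMeasurable]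
  simp only [ContinuousMap.inner_toLp, ← UnitAddTorus.mFourier_neg] at h
  simp only [← mFourier_eq_chr_cell ha]
  simp only [eq_comm (a := m)]
  rw [← h]

end Transport

end StratifiedLimit
end

open scoped ContDiff

noncomputable section

namespace StratifiedLimit

open MeasureTheory

variable {a : Fin 3 → ℝ}

/-! ### Elementary properties of Fourier coefficients -/

lemma isCompact_torus : IsCompact (torus a) := isCompact_Icc

lemma measurableSet_torus : MeasurableSet (torus a) := measurableSet_Icc

instance : IsFiniteMeasure ((volume : Measure (Fin 3 → ℝ)).restrict (torus a)) :=
  isFiniteMeasure_restrict.2 isCompact_torus.measure_lt_top.ne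

lemma memLp_ofReal {α : Type*} [MeasurableSpace α] {μ : Measure α} {p : ENNReal} {f : α → ℝ}
    (hf : MemLp f p μ) : MemLp (fun x => (f x : ℂ)) p μ := hf.ofReal

lemma integrable_ofReal {α : Type*} [MeasurableSpace α] {μ : Measure α} {f : α → ℝ}
    (hf : Integrable f μ) : Integrable (fun x => (f x : ℂ)) μ := hf.ofReal

lemma integrable_mul_chr {f : (Fin 3 → ℝ) → ℂ} (hf : IntegrableOn f (torus a)) (n : Fin 3 → ℤ) :
    IntegrableOn (fun x => f x * chr a n x) (torus a) :=
  Integrable.mul_bdd (c := 1) hf (continuous_chr n).aestronglyMeasurable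
    (Filter.Eventually.of_forall fun x => (norm_chr n x).le)

lemma ccoeff_add {f g : (Fin 3 → ℝ) → ℂ} (hf : IntegrableOn f (torus a))
    (hg : IntegrableOn g (torus a)) (n : Fin 3 → ℤ) :
    ccoeff a (fun x => f x + g x) n = ccoeff a f n + ccoeff a g n := by
  simp only [ccoeff, add_mul]
  rw [integral_add (integrable_mul_chr hf _) (integrable_mul_chr hg _), mul_add]

lemma ccoeff_const_mul (c : ℂ) (f : (Fin 3 → ℝ) → ℂ) (n : Fin 3 → ℤ) :
    ccoeff a (fun x => c * f x) n = c * ccoeff a f n := by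
  simp only [ccoeff, mul_assoc]
  rw [integral_const_mul]
  ring

lemma coeff_add {f g : (Fin 3 → ℝ) → ℝ} (hf : IntegrableOn f (torus a))
    (hg : IntegrableOn g (torus a)) (n : Fin 3 → ℤ) :
    coeff a (fun x => f x + g x) n = coeff a f n + coeff a g n := by
  simp only [coeff_eq_ccoeff, Complex.ofReal_add]
  exact ccoeff_add (integrable_ofReal hf) (integrable_ofReal hg) n

lemma coeff_const_mul (c : ℝ) (f : (Fin 3 → ℝ) → ℝ) (n : Fin 3 → ℤ) :
    coeff a (fun x => c * f x) n = c * coeff a f n := by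
  simp only [coeff_eq_ccoeff, Complex.ofReal_mul]
  exact ccoeff_const_mul _ _ n

lemma coeff_sub {f g : (Fin 3 → ℝ) → ℝ} (hf : IntegrableOn f (torus a))
    (hg : IntegrableOn g (torus a)) (n : Fin 3 → ℤ) :
    coeff a (fun x => f x - g x) n = coeff a f n - coeff a g n := by
  have h := coeff_add hf (hg.const_mul (-1)) n
  rw [coeff_const_mul] at h
  simpa [sub_eq_add_neg] using h

lemma coeff_sum {ι : Type*} (s : Finset ι) {f : ι → (Fin 3 → ℝ) → ℝ}
    (hf : ∀ i ∈ s, IntegrableOn (f i) (torus a)) (n : Fin 3 → ℤ) :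
    coeff a (fun x => ∑ i ∈ s, f i x) n = ∑ i ∈ s, coeff a (f i) n := by
  classical
  induction s using Finset.induction_on with
  | empty => simp [coeff]
  | insert i s hi ih =>
    simp only [Finset.sum_insert hi]
    rw [coeff_add (hf i (Finset.mem_insert_self _ _))
      (integrable_finsetSum _ fun j hj => hf j (Finset.mem_insert_of_mem hj)),
      ih fun j hj => hf j (Finset.mem_insert_of_mem hj)]

lemma coeff_zero (n : Fin 3 → ℤ) : coeff a (fun _ => 0) n = 0 := by simp [coeff]

lemma conj_coeff (f : (Fin 3 → ℝ) → ℝ) (n : Fin 3 → ℤ) :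
    (starRingEnd ℂ) (coeff a f n) = coeff a f (-n) := by
  simp only [coeff_eq_ccoeff, ccoeff, map_mul, map_inv₀, Complex.conj_ofReal, ← integral_conj,
    conj_chr]

lemma norm_ccoeff_le (ha : ∀ i, 0 < a i) (f : (Fin 3 → ℝ) → ℂ) (n : Fin 3 → ℤ) :
    ‖ccoeff a f n‖ ≤ (torusVol a)⁻¹ * ∫ x in torus a, ‖f x‖ := by
  rw [ccoeff, norm_mul, norm_inv, Complex.norm_real, Real.norm_of_nonneg (torusVol_pos ha).le]
  refine mul_le_mul_of_nonneg_left ?_ (inv_pos.2 (torusVol_pos ha)).le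
  refine (norm_integral_le_integral_norm _).trans_eq ?_
  simp [norm_chr]

lemma norm_coeff_le (ha : ∀ i, 0 < a i) (f : (Fin 3 → ℝ) → ℝ) (n : Fin 3 → ℤ) :
    ‖coeff a f n‖ ≤ (torusVol a)⁻¹ * ∫ x in torus a, |f x| := by
  rw [coeff_eq_ccoeff]
  simpa using norm_ccoeff_le ha (fun x => (f x : ℂ)) n

lemma volume_real_torus (ha : ∀ i, 0 < a i) : volume.real (torus a) = torusVol a := by
  rw [Measure.real, torus, Real.volume_Icc_pi_toReal]
  · simp [torusVol]
  · intro i; have := ha i; simp only [Pi.zero_apply]; positivity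

/-- Bessel-Parseval for one real function. -/
lemma hasSum_norm_sq_coeff (ha : ∀ i, 0 < a i) {f : (Fin 3 → ℝ) → ℝ}
    (hf : MemLp f 2 (volume.restrict (torus a))) :
    HasSum (fun n => ‖coeff a f n‖ ^ 2) ((torusVol a)⁻¹ * ∫ x in torus a, f x ^ 2) := by
  have h := hasSum_conj_ccoeff_mul ha (memLp_ofReal hf) (memLp_ofReal hf)
  simp only [← coeff_eq_ccoeff] at h
  have h2 : (∫ x in torus a, (starRingEnd ℂ) (f x : ℂ) * (f x : ℂ))
      = ((∫ x in torus a, f x ^ 2 : ℝ) : ℂ) := by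
    rw [← integral_complex_ofReal]
    congr 1; funext x; simp [sq]
  rw [h2] at h
  rw [← Complex.hasSum_ofReal]
  convert! h using 1
  · funext n
    rw [Complex.conj_mul']; push_cast; rfl
  · push_cast; rfl

/-- The Fourier coefficients of a product of two square integrable functions. -/
lemma hasSum_coeff_mul (ha : ∀ i, 0 < a i) {f g : (Fin 3 → ℝ) → ℝ}
    (hf : MemLp f 2 (volume.restrict (torus a))) (hg : MemLp g 2 (volume.restrict (torus a)))
    (n : Fin 3 → ℤ) :
    HasSum (fun k => coeff a f k * coeff a g (n - k)) (coeff a (fun x => f x * g x) n) := by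
  have hg' : MemLp (fun x => (g x : ℂ) * chr a (-n) x) 2 (volume.restrict (torus a)) := by
    have hc : MemLp (chr a (-n)) ⊤ (volume.restrict (torus a)) :=
      memLp_top_of_bound (continuous_chr _).aestronglyMeasurable 1
        (Filter.Eventually.of_forall fun x => (norm_chr _ x).le)
    exact hc.mul' (memLp_ofReal hg)
  -- Parseval for `f` against `g e^{-iň·x}`. Since `f` is real, the conjugate of its coefficient at
  -- `k` is the one at `-k`, whence the reindexing by `k ↦ -k` below.
  have h := hasSum_conj_ccoeff_mul ha (memLp_ofReal hf) hg'
  have h1 : ∀ k, ccoeff a (fun x => (g x : ℂ) * chr a (-n) x) k = coeff a g (n + k) := by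
    intro k
    rw [coeff_eq_ccoeff]
    simp only [ccoeff, mul_assoc, ← chr_add, neg_add]
  have h2 : ∀ k, (starRingEnd ℂ) (ccoeff a (fun x => (f x : ℂ)) k) = coeff a f (-k) := by
    intro k
    rw [← coeff_eq_ccoeff, conj_coeff]
  rw [← (Equiv.neg (Fin 3 → ℤ)).hasSum_iff]
  convert! h using 1
  · funext k
    rw [h1, h2]
    simp
  · rw [coeff_eq_ccoeff, ccoeff]
    congr 1
    refine integral_congr_ae (Filter.Eventually.of_forall fun x => ?_)
    simp [mul_assoc]

/-! ### Derivatives -/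

lemma IsPeriodic.mul {E : Type*} [Mul E] {f g : (Fin 3 → ℝ) → E} (hf : IsPeriodic a f)
    (hg : IsPeriodic a g) : IsPeriodic a (fun x => f x * g x) := fun x i => by
  simp only [hf x i, hg x i]

lemma IsPeriodic.pd {E : Type*} [NormedAddCommGroup E] [NormedSpace ℝ E]
    {f : (Fin 3 → ℝ) → E} (hf : IsPeriodic a f) (i : Fin 3) : IsPeriodic a (pd i f) := by
  intro x j
  have h : (fun y => f (y + Pi.single j (2 * Real.pi * a j))) = f := funext fun y => hf y j
  simp only [StratifiedLimit.pd]
  rw [← fderiv_comp_add_right, h]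

/-- Divergence theorem on the period box for the field whose only nonzero component is `f`, in
direction `i`: the two opposite faces carry equal integrals by periodicity. -/
lemma integral_pd_eq_zero (ha : ∀ i, 0 < a i) {f : (Fin 3 → ℝ) → ℂ} (hf : ContDiff ℝ ∞ f)
    (hp : IsPeriodic a f) (i : Fin 3) : ∫ x in torus a, pd i f x = 0 := by
  have hd : Differentiable ℝ f := hf.differentiable (by simp)
  have hle : (0 : Fin 3 → ℝ) ≤ fun i => 2 * Real.pi * a i := fun i => by
    have := ha i; simp only [Pi.zero_apply]; positivity
  have hcont : Continuous (pd i f) :=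
    (hf.continuous_fderiv (by simp)).clm_apply continuous_const
  have key := integral_divergence_of_hasFDerivAt_off_countable' (n := 2) 0
    (fun i => 2 * Real.pi * a i) hle (fun j x => if j = i then f x else 0)
    (fun j x => if j = i then fderiv ℝ f x else 0) ∅ Set.countable_empty
    (fun j => by
      by_cases hj : j = i
      · simpa [hj] using hf.continuous.continuousOn
      · simpa [hj] using continuousOn_const)
    (fun x _ j => by
      by_cases hj : j = i
      · simpa [hj] using (hd x).hasFDerivAt
      · simpa [hj] using hasFDerivAt_const (0 : ℂ) x)
  have hsum : ∀ x, (∑ j : Fin 3, (if j = i then fderiv ℝ f x else 0) (Pi.single j 1)) = pd i f x := by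
    intro x
    rw [Finset.sum_eq_single i]
    · simp [pd]
    · intro j _ hj; simp [hj]
    · simp
  simp only [hsum] at key
  rw [torus, key (hcont.continuousOn.integrableOn_compact isCompact_Icc)]
  refine Finset.sum_eq_zero fun j _ => ?_
  by_cases hj : j = i
  · subst hj
    simp only [if_true]
    rw [sub_eq_zero]
    congr 1
    funext y
    rw [Pi.zero_apply, ← hp (Fin.insertNth j (0 : ℝ) y) j]
    congr 1
    funext l
    rcases Fin.eq_self_or_eq_succAbove j l with h | ⟨m, h⟩
    · subst h; simp
    · subst h; simp
  · simp [hj]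

lemma fderiv_chr (n : Fin 3 → ℤ) (x : Fin 3 → ℝ) (i : Fin 3) :
    pd i (chr a n) x = Complex.I * (wave a n i : ℂ) * chr a n x := by
  have h0 : HasFDerivAt (fun x : Fin 3 → ℝ => ∑ j, wave a n j * x j)
      (∑ j, wave a n j • (ContinuousLinearMap.proj j : (Fin 3 → ℝ) →L[ℝ] ℝ)) x :=
    HasFDerivAt.fun_sum fun j _ => (hasFDerivAt_apply j x).const_mul _
  have h1 := (((Complex.ofRealCLM.hasFDerivAt.comp x h0)).const_mul Complex.I).cexp
  have h2 : pd i (chr a n) x = _ := congrArg (fun L => L (Pi.single i 1)) h1.fderiv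
  rw [h2]
  simp [chr, Pi.single_apply, mul_comm]

/-- Integration by parts. -/
lemma ccoeff_pd (ha : ∀ i, 0 < a i) {f : (Fin 3 → ℝ) → ℂ} (hf : ContDiff ℝ ∞ f)
    (hp : IsPeriodic a f) (i : Fin 3) (n : Fin 3 → ℤ) :
    ccoeff a (pd i f) n = Complex.I * (wave a n i : ℂ) * ccoeff a f n := by
  have h := integral_pd_eq_zero ha (hf.mul (contDiff_chr (a := a) (-n)))
    (hp.mul (isPeriodic_chr ha (-n))) i
  have hd : ∀ x, pd i (fun x => f x * chr a (-n) x) x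
      = pd i f x * chr a (-n) x - Complex.I * (wave a n i : ℂ) * (f x * chr a (-n) x) := by
    intro x
    have h1 : DifferentiableAt ℝ f x := hf.differentiable (by simp) x
    have h2 : DifferentiableAt ℝ (chr a (-n)) x := (contDiff_chr _).differentiable (by simp) x
    have h3 := fderiv_chr (a := a) (-n) x i
    simp only [pd] at h3 ⊢
    rw [fderiv_fun_mul h1 h2]
    simp only [add_apply, smul_apply, smul_eq_mul, h3,
      wave_neg]
    push_cast
    ring
  have hc : Continuous (pd i f) :=
    (hf.continuous_fderiv (by simp)).clm_apply continuous_const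
  simp only [hd] at h
  rw [integral_sub, integral_const_mul, sub_eq_zero] at h
  · rw [ccoeff, h, ccoeff]; ring
  · exact integrable_mul_chr (hc.continuousOn.integrableOn_compact isCompact_torus) _
  · exact (integrable_mul_chr (hf.continuous.continuousOn.integrableOn_compact isCompact_torus)
      _).const_mul _

lemma ofReal_pd {f : (Fin 3 → ℝ) → ℝ} (hf : Differentiable ℝ f) (i : Fin 3) (x : Fin 3 → ℝ) :
    ((pd i f x : ℝ) : ℂ) = pd i (fun x => (f x : ℂ)) x := by
  have h := (Complex.ofRealCLM.hasFDerivAt (x := f x)).comp x (hf x).hasFDerivAt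
  have h2 : pd i (fun x => (f x : ℂ)) x = _ := congrArg (fun L => L (Pi.single i 1)) h.fderiv
  rw [h2]; simp [pd]

lemma coeff_pd (ha : ∀ i, 0 < a i) {f : (Fin 3 → ℝ) → ℝ} (hf : ContDiff ℝ ∞ f)
    (hp : IsPeriodic a f) (i : Fin 3) (n : Fin 3 → ℤ) :
    coeff a (pd i f) n = Complex.I * (wave a n i : ℂ) * coeff a f n := by
  simp only [coeff_eq_ccoeff, ofReal_pd (hf.differentiable (by simp))]
  exact ccoeff_pd ha (Complex.ofRealCLM.contDiff.comp hf) (fun x j => by simp [hp x j]) i n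

lemma ContDiff.pd {E : Type*} [NormedAddCommGroup E] [NormedSpace ℝ E]
    {f : (Fin 3 → ℝ) → E} (hf : ContDiff ℝ ∞ f) (i : Fin 3) :
    ContDiff ℝ ∞ (StratifiedLimit.pd i f) :=
  (hf.fderiv_right (m := ∞) (by simp)).clm_apply contDiff_const

lemma ContDiff.lap {E : Type*} [NormedAddCommGroup E] [NormedSpace ℝ E]
    {f : (Fin 3 → ℝ) → E} (hf : ContDiff ℝ ∞ f) : ContDiff ℝ ∞ (StratifiedLimit.lap f) :=
  ContDiff.sum fun i _ => ContDiff.pd (ContDiff.pd hf i) i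

lemma len_sq (ξ : Fin 3 → ℝ) : len ξ ^ 2 = ξ 0 ^ 2 + ξ 1 ^ 2 + ξ 2 ^ 2 :=
  Real.sq_sqrt (by positivity)

lemma hLen_sq (ξ : Fin 3 → ℝ) : hLen ξ ^ 2 = ξ 0 ^ 2 + ξ 1 ^ 2 :=
  Real.sq_sqrt (by positivity)

lemma integrableOn_of_contDiff {E : Type*} [NormedAddCommGroup E] [NormedSpace ℝ E]
    {f : (Fin 3 → ℝ) → E} (hf : ContDiff ℝ ∞ f) : IntegrableOn f (torus a) :=
  hf.continuous.continuousOn.integrableOn_compact isCompact_torus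

lemma coeff_lap (ha : ∀ i, 0 < a i) {f : (Fin 3 → ℝ) → ℝ} (hf : ContDiff ℝ ∞ f)
    (hp : IsPeriodic a f) (n : Fin 3 → ℤ) :
    coeff a (lap f) n = -((len (wave a n) ^ 2 : ℝ) : ℂ) * coeff a f n := by
  have h : coeff a (lap f) n = ∑ i, coeff a (pd i (pd i f)) n :=
    coeff_sum _ (fun i _ => integrableOn_of_contDiff (ContDiff.pd (ContDiff.pd hf i) i)) n
  rw [h, len_sq, Fin.sum_univ_three]
  simp only [coeff_pd ha (ContDiff.pd hf _) (hp.pd _), coeff_pd ha hf hp]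
  push_cast
  linear_combination (wave a n 0 ^ 2 + wave a n 1 ^ 2 + wave a n 2 ^ 2) * coeff a f n * Complex.I_sq

/-! ### Fourier series with summable coefficients -/

lemma continuous_tsum_chr {c : (Fin 3 → ℤ) → ℂ} (hc : Summable fun n => ‖c n‖) :
    Continuous fun x => ∑' n, c n * chr a n x :=
  continuous_tsum (fun n => continuous_const.mul (continuous_chr n)) hc
    (fun n x => by simp [norm_chr])

/-- Integration of a summable Fourier series against an integrable function. -/
lemma hasSum_integral_mul_tsum {f : (Fin 3 → ℝ) → ℂ} (hf : IntegrableOn f (torus a))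
    {c : (Fin 3 → ℤ) → ℂ} (hc : Summable fun n => ‖c n‖) :
    HasSum (fun n => c n * ∫ x in torus a, f x * chr a n x)
      (∫ x in torus a, f x * ∑' n, c n * chr a n x) := by
  have h := hasSum_integral_of_summable_integral_norm (μ := volume.restrict (torus a))
    (F := fun (n : Fin 3 → ℤ) x => c n * (f x * chr a n x))
    (fun n => (integrable_mul_chr hf n).const_mul _) (by
      simp only [norm_mul, norm_chr, mul_one, integral_const_mul]
      exact hc.mul_right _)
  simp only [integral_const_mul] at h
  convert! h using 1
  refine integral_congr_ae (Filter.Eventually.of_forall fun x => ?_)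
  simp only
  rw [← tsum_mul_left]
  congr 1; funext n; ring

/-- A square integrable function with summable Fourier coefficients is the sum of its Fourier
series. -/
lemma ae_eq_tsum_of_summable (ha : ∀ i, 0 < a i) {ψ : (Fin 3 → ℝ) → ℂ}
    (hψ : MemLp ψ 2 (volume.restrict (torus a))) (hs : Summable fun n => ‖ccoeff a ψ n‖) :
    ψ =ᵐ[volume.restrict (torus a)] fun x => ∑' n, ccoeff a ψ n * chr a n x := by
  -- The sum `S` of the Fourier series is continuous and has the coefficients of `ψ`; Parseval
  -- applied to `ψ - S` then shows that its `L²` norm is zero.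
  set S : (Fin 3 → ℝ) → ℂ := fun x => ∑' n, ccoeff a ψ n * chr a n x with hS
  have hScont : Continuous S := continuous_tsum_chr hs
  have hSmem : MemLp S 2 (volume.restrict (torus a)) := by
    obtain ⟨C, hC⟩ := isCompact_torus.exists_bound_of_continuousOn (s := torus a) hScont.continuousOn
    exact MemLp.of_bound hScont.aestronglyMeasurable C
      ((ae_restrict_iff' measurableSet_torus).2 (Filter.Eventually.of_forall hC))
  have hcoef : ∀ n, ccoeff a S n = ccoeff a ψ n := by
    intro n
    have h := hasSum_integral_mul_tsum (a := a) (f := chr a (-n))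
      ((continuous_chr (-n)).continuousOn.integrableOn_compact isCompact_torus) hs
    have h2 := h.mul_left (torusVol a : ℂ)⁻¹
    have h3 : ∀ m, (torusVol a : ℂ)⁻¹ * (ccoeff a ψ m * ∫ x in torus a, chr a (-n) x * chr a m x)
        = if m = n then ccoeff a ψ n else 0 := by
      intro m
      have := ccoeff_chr ha n m
      rw [ccoeff] at this
      simp only [mul_comm (chr a (-n) _)]
      rw [mul_left_comm, this]
      split_ifs with hh
      · rw [hh, mul_one]
      · rw [mul_zero]
    simp only [h3] at h2
    rw [← h2.unique (hasSum_ite_eq n _), ccoeff]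
    simp only [mul_comm (chr a (-n) _), hS]
  have hD : MemLp (fun x => ψ x - S x) 2 (volume.restrict (torus a)) := hψ.sub hSmem
  have hD0 : ∀ n, ccoeff a (fun x => ψ x - S x) n = 0 := by
    intro n
    have h1 := ccoeff_add (a := a) (hψ.integrable (by norm_num))
      ((hSmem.integrable (by norm_num)).const_mul (-1)) n
    rw [ccoeff_const_mul, hcoef] at h1
    simpa [sub_eq_add_neg] using h1
  have h := hasSum_conj_ccoeff_mul ha hD hD
  simp only [hD0, mul_zero] at h
  have h0 := h.unique hasSum_zero
  have hvol : (torusVol a : ℂ)⁻¹ ≠ 0 :=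
    inv_ne_zero (Complex.ofReal_ne_zero.2 (torusVol_pos ha).ne')
  have h1 := (mul_eq_zero.1 h0).resolve_left hvol
  have h2 : ∫ x in torus a, ‖ψ x - S x‖ ^ 2 = 0 := by
    rw [← Complex.ofReal_eq_zero, ← integral_complex_ofReal, ← h1]
    congr 1; funext x
    rw [Complex.conj_mul']; push_cast; rfl
  rw [integral_eq_zero_iff_of_nonneg (fun x => by positivity) hD.integrable_norm_pow'] at h2
  filter_upwards [h2] with x hx
  simpa [sub_eq_zero] using hx

/-- The pairing with the Fourier coefficients of an integrable function is integration. -/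
lemma hasSum_coeff_mul_conj (ha : ∀ i, 0 < a i) {f ψ : (Fin 3 → ℝ) → ℝ}
    (hf : IntegrableOn f (torus a)) (hψ : MemLp ψ 2 (volume.restrict (torus a)))
    (hs : Summable fun n => ‖coeff a ψ n‖) :
    HasSum (fun n => coeff a f n * (starRingEnd ℂ) (coeff a ψ n))
      ((torusVol a : ℂ)⁻¹ * ((∫ x in torus a, f x * ψ x : ℝ) : ℂ)) := by
  have hae := ae_eq_tsum_of_summable ha (memLp_ofReal hψ) (by simpa only [coeff_eq_ccoeff] using hs)
  have h := (hasSum_integral_mul_tsum (integrable_ofReal hf) hs).mul_left (torusVol a : ℂ)⁻¹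
  rw [← (Equiv.neg (Fin 3 → ℤ)).hasSum_iff]
  convert! h using 1
  · funext n
    simp only [Function.comp_apply, Equiv.neg_apply, conj_coeff, neg_neg]
    rw [coeff_eq_ccoeff f, ccoeff, neg_neg]
    exact (mul_comm _ _).trans (mul_left_comm _ _ _)
  · congr 1
    rw [← integral_complex_ofReal]
    refine integral_congr_ae ?_
    filter_upwards [hae] with x hx
    simp only [← coeff_eq_ccoeff] at hx
    rw [← hx]
    push_cast
    rfl

lemma pairing_coeff (ha : ∀ i, 0 < a i) {f ψ : (Fin 3 → ℝ) → ℝ}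
    (hf : IntegrableOn f (torus a)) (hψ : MemLp ψ 2 (volume.restrict (torus a)))
    (hs : Summable fun n => ‖coeff a ψ n‖) :
    pairing a (coeff a f) ψ = ((∫ x in torus a, f x * ψ x : ℝ) : ℂ) := by
  rw [pairing, (hasSum_coeff_mul_conj ha hf hψ hs).tsum_eq, mul_inv_cancel_left₀]
  exact Complex.ofReal_ne_zero.2 (torusVol_pos ha).ne'

end StratifiedLimit
end

open scoped ContDiff

noncomputable section

namespace StratifiedLimit

open MeasureTheory

variable {a : Fin 3 → ℝ}

/-! ### Test functions -/

/-- The time derivative. -/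
def dt {E : Type*} [NormedAddCommGroup E] [NormedSpace ℝ E] (φ : ℝ → (Fin 3 → ℝ) → E) :
    ℝ → (Fin 3 → ℝ) → E :=
  fun t x => deriv (fun s => φ s x) t

section Test

variable {E : Type*} [NormedAddCommGroup E] [NormedSpace ℝ E] {φ : ℝ → (Fin 3 → ℝ) → E}

lemma IsTest.contDiff_slice (hφ : IsTest a φ) (t : ℝ) : ContDiff ℝ ∞ (φ t) :=
  hφ.smooth.comp (contDiff_const.prodMk contDiff_id)

lemma IsTest.contDiff_time (hφ : IsTest a φ) (x : Fin 3 → ℝ) : ContDiff ℝ ∞ (fun t => φ t x) :=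
  hφ.smooth.comp (contDiff_id.prodMk contDiff_const)

/-- Smoothness of a test function is joint in `(t, x)`, so slice derivatives are expressed through
the joint derivative; this is what makes `pd i` map test functions to test functions. `IsTest.dt_eq`
plays the same role in time. -/
lemma IsTest.pd_eq (hφ : IsTest a φ) (i : Fin 3) (t : ℝ) (x : Fin 3 → ℝ) :
    StratifiedLimit.pd i (φ t) x
      = fderiv ℝ (fun q : ℝ × (Fin 3 → ℝ) => φ q.1 q.2) (t, x) (0, Pi.single i 1) := by
  have h1 := (hφ.smooth.differentiable (by simp) (t, x)).hasFDerivAt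
  have h2 : HasFDerivAt (fun y : Fin 3 → ℝ => (t, y))
      ((0 : (Fin 3 → ℝ) →L[ℝ] ℝ).prod (ContinuousLinearMap.id ℝ _)) x :=
    (hasFDerivAt_const t x).prodMk (hasFDerivAt_id x)
  have h3 := h1.comp x h2
  have h4 : StratifiedLimit.pd i (φ t) x = _ := congrArg (fun L => L (Pi.single i 1)) h3.fderiv
  rw [h4]; simp

lemma IsTest.dt_eq (hφ : IsTest a φ) (t : ℝ) (x : Fin 3 → ℝ) :
    dt φ t x = fderiv ℝ (fun q : ℝ × (Fin 3 → ℝ) => φ q.1 q.2) (t, x) (1, 0) := by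
  have h1 := (hφ.smooth.differentiable (by simp) (t, x)).hasFDerivAt
  have h2 : HasDerivAt (fun s : ℝ => (s, x)) _ t := (hasDerivAt_id t).prodMk (hasDerivAt_const t x)
  exact (h1.comp_hasDerivAt t h2).deriv

lemma IsTest.pd (hφ : IsTest a φ) (i : Fin 3) :
    IsTest a (fun t => StratifiedLimit.pd i (φ t)) where
  smooth := by
    have : (fun q : ℝ × (Fin 3 → ℝ) => StratifiedLimit.pd i (φ q.1) q.2) = fun q =>
        fderiv ℝ (fun q : ℝ × (Fin 3 → ℝ) => φ q.1 q.2) q (0, Pi.single i 1) :=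
      funext fun q => hφ.pd_eq i q.1 q.2
    rw [this]
    exact (hφ.smooth.fderiv_right (m := ∞) (by simp)).clm_apply contDiff_const
  periodic t := (hφ.periodic t).pd i
  support := by
    obtain ⟨T, hT⟩ := hφ.support
    refine ⟨T, fun t x ht => ?_⟩
    have : φ t = fun _ => 0 := funext fun x => hT t x ht
    simp [StratifiedLimit.pd, this]

lemma IsTest.dt (hφ : IsTest a φ) : IsTest a (dt φ) where
  smooth := by
    have : (fun q : ℝ × (Fin 3 → ℝ) => StratifiedLimit.dt φ q.1 q.2) = fun q =>
        fderiv ℝ (fun q : ℝ × (Fin 3 → ℝ) => φ q.1 q.2) q (1, 0) :=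
      funext fun q => hφ.dt_eq q.1 q.2
    rw [this]
    exact (hφ.smooth.fderiv_right (m := ∞) (by simp)).clm_apply contDiff_const
  periodic t x i := by
    simp only [StratifiedLimit.dt]
    congr 1
    funext s
    exact hφ.periodic s x i
  support := by
    obtain ⟨T, hT⟩ := hφ.support
    -- A derivative at `t` vanishes once the function vanishes near `t`, hence the margin beyond
    -- `T`.
    refine ⟨T + 1, fun t x ht => ?_⟩
    have : (fun s => φ s x) =ᶠ[nhds t] fun _ => 0 := by
      filter_upwards [lt_mem_nhds (show T < t by linarith)] with s hs
      exact hT s x hs.le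
    simp [StratifiedLimit.dt, this.deriv_eq]

lemma IsTest.add {ψ : ℝ → (Fin 3 → ℝ) → E} (hφ : IsTest a φ) (hψ : IsTest a ψ) :
    IsTest a (fun t x => φ t x + ψ t x) where
  smooth := hφ.smooth.add hψ.smooth
  periodic t x i := by simp only [hφ.periodic t x i, hψ.periodic t x i]
  support := by
    obtain ⟨T, hT⟩ := hφ.support
    obtain ⟨S, hS⟩ := hψ.support
    refine ⟨max T S, fun t x ht => ?_⟩
    rw [hT t x (le_of_max_le_left ht), hS t x (le_of_max_le_right ht), add_zero]

lemma IsTest.neg (hφ : IsTest a φ) : IsTest a (fun t x => -φ t x) where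
  smooth := hφ.smooth.neg
  periodic t x i := by simp only [hφ.periodic t x i]
  support := by
    obtain ⟨T, hT⟩ := hφ.support
    exact ⟨T, fun t x ht => by rw [hT t x ht, neg_zero]⟩

lemma isTest_zero : IsTest a (fun _ _ => (0 : E)) where
  smooth := contDiff_const
  periodic _ _ _ := rfl
  support := ⟨0, fun _ _ _ => rfl⟩

lemma IsTest.sum {ι : Type*} {φ : ι → ℝ → (Fin 3 → ℝ) → E} (s : Finset ι)
    (hφ : ∀ i ∈ s, IsTest a (φ i)) : IsTest a (fun t x => ∑ i ∈ s, φ i t x) := by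
  classical
  induction s using Finset.induction_on with
  | empty => simpa using isTest_zero
  | insert i s hi ih =>
    simp only [Finset.sum_insert hi]
    exact (hφ i (Finset.mem_insert_self _ _)).add
      (ih fun j hj => hφ j (Finset.mem_insert_of_mem hj))

lemma IsTest.lap (hφ : IsTest a φ) : IsTest a (fun t => StratifiedLimit.lap (φ t)) :=
  IsTest.sum _ fun i _ => (hφ.pd i).pd i

lemma IsTest.exists_bound (hφ : IsTest a φ) : ∃ C, 0 ≤ C ∧ ∀ t, 0 ≤ t → ∀ x ∈ torus a,
    ‖φ t x‖ ≤ C := by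
  obtain ⟨T, hT⟩ := hφ.support
  have hc : IsCompact (Set.Icc (0 : ℝ) T ×ˢ torus a) := isCompact_Icc.prod isCompact_torus
  obtain ⟨C, hC⟩ := hc.exists_bound_of_continuousOn hφ.smooth.continuous.continuousOn
  refine ⟨max C 0, le_max_right _ _, fun t ht x hx => ?_⟩
  rcases le_total t T with h | h
  · exact (hC (t, x) ⟨⟨ht, h⟩, hx⟩).trans (le_max_left _ _)
  · rw [hT t x h, norm_zero]; exact le_max_right _ _

end Test

lemma IsTest.comp {d : ℕ} {φ : ℝ → (Fin 3 → ℝ) → (Fin d → ℝ)} (hφ : IsTest a φ) (j : Fin d) :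
    IsTest a (fun t x => φ t x j) where
  smooth := (contDiff_apply ℝ ℝ j).comp hφ.smooth
  periodic t x i := by simp only [hφ.periodic t x i]
  support := by
    obtain ⟨T, hT⟩ := hφ.support
    exact ⟨T, fun t x ht => by rw [hT t x ht, Pi.zero_apply]⟩

lemma pd_apply {d : ℕ} {f : (Fin 3 → ℝ) → (Fin d → ℝ)} (hf : Differentiable ℝ f) (i : Fin 3)
    (j : Fin d) (x : Fin 3 → ℝ) : pd i f x j = pd i (fun x => f x j) x := by
  have h := hasFDerivAt_pi'.1 (hf x).hasFDerivAt j
  have h2 : pd i (fun x => f x j) x = _ := congrArg (fun L => L (Pi.single i 1)) h.fderiv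
  rw [h2]; simp [pd]

lemma lap_apply {d : ℕ} {f : (Fin 3 → ℝ) → (Fin d → ℝ)} (hf : ContDiff ℝ ∞ f)
    (j : Fin d) (x : Fin 3 → ℝ) : lap f x j = lap (fun x => f x j) x := by
  simp only [lap, Finset.sum_apply]
  refine Finset.sum_congr rfl fun i _ => ?_
  rw [pd_apply ((ContDiff.pd hf i).differentiable (by simp))]
  congr 1
  funext y
  exact pd_apply (hf.differentiable (by simp)) i j y

lemma dt_apply {d : ℕ} {φ : ℝ → (Fin 3 → ℝ) → (Fin d → ℝ)} (hφ : IsTest a φ) (j : Fin d)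
    (t : ℝ) (x : Fin 3 → ℝ) :
    deriv (fun s => φ s x) t j = dt (fun t x => φ t x j) t x := by
  have h := hasDerivAt_pi.1 ((hφ.contDiff_time x).differentiable (by simp) t).hasDerivAt j
  exact h.deriv.symm

/-! ### Decay of the coefficients of test functions -/

/-- The weight `1 + |ň|²`. -/
def wt (a : Fin 3 → ℝ) (n : Fin 3 → ℤ) : ℝ := 1 + len (wave a n) ^ 2

lemma one_le_wt (n : Fin 3 → ℤ) : 1 ≤ wt a n := by unfold wt; nlinarith [sq_nonneg (len (wave a n))]

lemma wt_pos (n : Fin 3 → ℤ) : 0 < wt a n := zero_lt_one.trans_le (one_le_wt n)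

lemma summable_inv_one_add_sq {c : ℝ} (hc : 0 < c) :
    Summable fun n : ℤ => (1 + ((n : ℝ) / c) ^ 2)⁻¹ := by
  have h : Summable fun n : ℤ => c ^ 2 * (1 / (n : ℝ) ^ 2) :=
    ((Real.summable_one_div_int_pow (p := 2)).2 one_lt_two).mul_left _
  refine Summable.of_norm_bounded_eventually h ?_
  have h0 : ∀ᶠ n : ℤ in Filter.cofinite, n ≠ 0 := by
    rw [Filter.eventually_cofinite]; simp
  filter_upwards [h0] with n hn
  have hn' : (n : ℝ) ≠ 0 := by exact_mod_cast hn
  rw [Real.norm_of_nonneg (by positivity)]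
  have : c ^ 2 * (1 / (n : ℝ) ^ 2) = (((n : ℝ) / c) ^ 2)⁻¹ := by field_simp
  rw [this]
  refine inv_anti₀ (by positivity) (by linarith)

/-- The cube matches the dimension: `wt` dominates each of the three weights `1 + (n i / a i)²`, so
its cube dominates their product, and the inverse of that product is summable factor by factor. -/
lemma summable_inv_wt (ha : ∀ i, 0 < a i) : Summable fun n => (wt a n ^ 3)⁻¹ := by
  have h0 := summable_inv_one_add_sq (ha 0)
  have h1 := summable_inv_one_add_sq (ha 1)
  have h2 := summable_inv_one_add_sq (ha 2)
  have h12 := h1.mul_of_nonneg h2 (fun n => by positivity) (fun n => by positivity)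
  have h012 := h0.mul_of_nonneg h12 (fun n => by positivity) (fun n => by positivity)
  let e : (Fin 3 → ℤ) → ℤ × ℤ × ℤ := fun n => (n 0, n 1, n 2)
  have he : Function.Injective e := by
    intro n m h
    simp only [e, Prod.mk.injEq] at h
    funext i; fin_cases i
    exacts [h.1, h.2.1, h.2.2]
  refine Summable.of_nonneg_of_le (fun n => inv_nonneg.2 (pow_nonneg (wt_pos n).le 3)) (fun n => ?_)
    (h012.comp_injective he)
  simp only [Function.comp_apply, e]
  rw [← mul_inv, ← mul_inv]
  refine inv_anti₀ (by positivity) ?_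
  have hb : ∀ i : Fin 3, 1 + ((n i : ℝ) / a i) ^ 2 ≤ wt a n := by
    intro i
    rw [wt, len_sq]
    simp only [wave]
    fin_cases i <;> simp only [Fin.zero_eta, Fin.mk_one, Fin.reduceFinMk] <;> nlinarith [sq_nonneg ((n 0 : ℝ) / a 0), sq_nonneg ((n 1 : ℝ) / a 1), sq_nonneg ((n 2 : ℝ) / a 2)]
  calc _ ≤ wt a n * (wt a n * wt a n) := by
        gcongr
        exacts [(wt_pos n).le, hb 0, (wt_pos n).le, hb 1, hb 2]
    _ = wt a n ^ 3 := by ring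

/-- Each power is gained by passing from `φ` to `φ - Δφ`, again a test function, whose coefficients
are those of `φ` multiplied by `wt`. The constant is uniform in `t ≥ 0` because test functions are
bounded there. -/
lemma IsTest.exists_decay (ha : ∀ i, 0 < a i) {φ : ℝ → (Fin 3 → ℝ) → ℝ} (hφ : IsTest a φ) (k : ℕ) :
    ∃ C, 0 ≤ C ∧ ∀ t, 0 ≤ t → ∀ n, ‖coeff a (φ t) n‖ ≤ C * (wt a n ^ k)⁻¹ := by
  induction k generalizing φ with
  | zero =>
    obtain ⟨C, hC0, hC⟩ := hφ.exists_bound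
    refine ⟨C, hC0, fun t ht n => (norm_coeff_le ha _ _).trans ?_⟩
    have h : ∫ x in torus a, |φ t x| ≤ ∫ _ in torus a, C := by
      refine setIntegral_mono_on ?_ ?_ measurableSet_torus fun x hx => hC t ht x hx
      · exact (integrableOn_of_contDiff (hφ.contDiff_slice t)).abs
      · exact integrable_const C
    rw [setIntegral_const, volume_real_torus ha, smul_eq_mul] at h
    have hv := torusVol_pos ha
    calc _ ≤ (torusVol a)⁻¹ * (torusVol a * C) := by gcongr
      _ = C * (wt a n ^ 0)⁻¹ := by field_simp
  | succ k ih =>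
    have hψ : IsTest a (fun t x => φ t x + -StratifiedLimit.lap (φ t) x) := hφ.add hφ.lap.neg
    obtain ⟨C, hC0, hC⟩ := ih hψ
    refine ⟨C, hC0, fun t ht n => ?_⟩
    have h := hC t ht n
    have h1 : coeff a (fun x => φ t x + -StratifiedLimit.lap (φ t) x) n
        = (wt a n : ℂ) * coeff a (φ t) n := by
      have h2 := coeff_add (a := a) (integrableOn_of_contDiff (hφ.contDiff_slice t))
        ((integrableOn_of_contDiff (a := a) (ContDiff.lap (hφ.contDiff_slice t))).const_mul (-1)) n
      rw [coeff_const_mul, coeff_lap ha (hφ.contDiff_slice t) (hφ.periodic t)] at h2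
      simp only [neg_one_mul] at h2
      rw [h2, wt]
      push_cast
      ring
    rw [h1, norm_mul, Complex.norm_real, Real.norm_of_nonneg (wt_pos n).le] at h
    have hw := wt_pos (a := a) n
    rw [pow_succ, mul_inv, ← mul_assoc, ← div_eq_mul_inv, le_div_iff₀ hw, mul_comm]
    exact h

lemma IsTest.summable_coeff (ha : ∀ i, 0 < a i) {φ : ℝ → (Fin 3 → ℝ) → ℝ} (hφ : IsTest a φ)
    {t : ℝ} (ht : 0 ≤ t) : Summable fun n => ‖coeff a (φ t) n‖ := by
  obtain ⟨C, -, hC⟩ := hφ.exists_decay ha 3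
  exact Summable.of_nonneg_of_le (fun n => norm_nonneg _) (hC t ht)
    ((summable_inv_wt ha).mul_left C)

/-- With a time cutoff for `θ`, the decay estimates for test functions also serve smooth periodic
functions of `x` alone. -/
lemma isTest_of_static {E : Type*} [NormedAddCommGroup E] [NormedSpace ℝ E]
    {ψ : (Fin 3 → ℝ) → E} (hψ : ContDiff ℝ ∞ ψ) (hp : IsPeriodic a ψ) {θ : ℝ → ℝ}
    (hθ : ContDiff ℝ ∞ θ) (hs : ∃ T, ∀ t, T ≤ t → θ t = 0) :
    IsTest a (fun t x => θ t • ψ x) where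
  smooth := (hθ.comp contDiff_fst).smul (hψ.comp contDiff_snd)
  periodic t x i := by simp only [hp x i]
  support := by
    obtain ⟨T, hT⟩ := hs
    exact ⟨T, fun t x ht => by rw [hT t ht, zero_smul]⟩

/-- A smooth cutoff equal to `1` for `t ≤ 0` and vanishing for `t ≥ 1`. -/
lemma exists_cutoff : ∃ θ : ℝ → ℝ, ContDiff ℝ ∞ θ ∧ (∃ T, ∀ t, T ≤ t → θ t = 0) ∧ θ 0 = 1 :=
  ⟨fun t => Real.smoothTransition (1 - t),
    Real.smoothTransition.contDiff.comp (contDiff_const.sub contDiff_id),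
    ⟨1, fun t ht => Real.smoothTransition.zero_of_nonpos (by linarith)⟩,
    by simp⟩

lemma summable_coeff_of_contDiff (ha : ∀ i, 0 < a i) {ψ : (Fin 3 → ℝ) → ℝ} (hψ : ContDiff ℝ ∞ ψ)
    (hp : IsPeriodic a ψ) : Summable fun n => ‖coeff a ψ n‖ := by
  obtain ⟨θ, hθ, hs, h1⟩ := exists_cutoff
  have h := (isTest_of_static hψ hp hθ hs).summable_coeff ha le_rfl
  simpa [h1] using h

/-- The pairing of the Fourier coefficients of an integrable function with a smooth function. -/
lemma pairing_coeff_of_contDiff (ha : ∀ i, 0 < a i) {f ψ : (Fin 3 → ℝ) → ℝ}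
    (hf : IntegrableOn f (torus a)) (hψ : ContDiff ℝ ∞ ψ) (hp : IsPeriodic a ψ) :
    pairing a (coeff a f) ψ = ((∫ x in torus a, f x * ψ x : ℝ) : ℂ) := by
  refine pairing_coeff ha hf ?_ (summable_coeff_of_contDiff ha hψ hp)
  obtain ⟨C, hC⟩ := isCompact_torus.exists_bound_of_continuousOn (s := torus a)
    hψ.continuous.continuousOn
  exact MemLp.of_bound hψ.continuous.aestronglyMeasurable C
    ((ae_restrict_iff' measurableSet_torus).2 (Filter.Eventually.of_forall hC))

/-! ### Smooth dependence of the coefficients on time -/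

lemma IsTest.hasDerivAt_coeff {φ : ℝ → (Fin 3 → ℝ) → ℝ} (hφ : IsTest a φ) (n : Fin 3 → ℤ) (t : ℝ) :
    HasDerivAt (fun s => coeff a (φ s) n) (coeff a (StratifiedLimit.dt φ t) n) t := by
  simp only [coeff_eq_ccoeff, ccoeff]
  refine HasDerivAt.const_mul (𝔸 := ℂ) _ ?_
  have hc : IsCompact (Set.Icc (t - 1) (t + 1) ×ˢ torus a) := isCompact_Icc.prod isCompact_torus
  obtain ⟨C, hC⟩ := hc.exists_bound_of_continuousOn hφ.dt.smooth.continuous.continuousOn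
  refine (hasDerivAt_integral_of_dominated_loc_of_deriv_le (μ := volume.restrict (torus a))
    (𝕜 := ℝ) (s := Set.Icc (t - 1) (t + 1)) (bound := fun _ => C)
    (F := fun s x => (φ s x : ℂ) * chr a (-n) x)
    (F' := fun s x => ((StratifiedLimit.dt φ s x : ℝ) : ℂ) * chr a (-n) x)
    (Icc_mem_nhds (by linarith) (by linarith)) ?_ ?_ ?_ ?_ (integrable_const C) ?_).2
  · refine Filter.Eventually.of_forall fun s => ?_
    exact ((Complex.continuous_ofReal.comp (hφ.contDiff_slice s).continuous).mul
      (continuous_chr _)).aestronglyMeasurable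
  · exact integrable_mul_chr (integrable_ofReal (integrableOn_of_contDiff (hφ.contDiff_slice t))) _
  · exact ((Complex.continuous_ofReal.comp (hφ.dt.contDiff_slice t).continuous).mul
      (continuous_chr _)).aestronglyMeasurable
  · refine (ae_restrict_iff' measurableSet_torus).2 (Filter.Eventually.of_forall fun x hx s hs => ?_)
    rw [norm_mul, norm_chr, mul_one, Complex.norm_real]
    exact hC (s, x) ⟨hs, hx⟩
  · refine Filter.Eventually.of_forall fun x s _ => ?_
    have h : HasDerivAt (fun s => φ s x) (StratifiedLimit.dt φ s x) s :=
      ((hφ.contDiff_time x).differentiable (by simp) s).hasDerivAt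
    exact h.ofReal_comp.mul_const _

/-- Each time derivative is the coefficient of another test function, so induction applies.
Consequently the coefficient and its conjugate are admissible functions `θ` in `ModeEq`. -/
lemma IsTest.contDiff_coeff {φ : ℝ → (Fin 3 → ℝ) → ℝ} (hφ : IsTest a φ) (n : Fin 3 → ℤ) :
    ContDiff ℝ ∞ (fun s => coeff a (φ s) n) := by
  rw [contDiff_infty]
  intro k
  induction k generalizing φ with
  | zero =>
    exact contDiff_zero.2 (continuous_iff_continuousAt.2 fun t => (hφ.hasDerivAt_coeff n t).continuousAt)
  | succ k ih =>
    push_cast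
    refine contDiff_succ_iff_deriv.2 ⟨fun t => (hφ.hasDerivAt_coeff n t).differentiableAt, by simp, ?_⟩
    rw [show deriv (fun s => coeff a (φ s) n) = fun t => coeff a (StratifiedLimit.dt φ t) n from
      funext fun t => (hφ.hasDerivAt_coeff n t).deriv]
    exact ih hφ.dt

end StratifiedLimit
end

open scoped ContDiff

noncomputable section

namespace StratifiedLimit

open MeasureTheory

variable {a : Fin 3 → ℝ}

/-! ### Locally integrable functions of space and time -/

/-- Local integrability in time with values in `L¹(𝕋³)`. -/
def LocL1 (a : Fin 3 → ℝ) (f : ℝ → (Fin 3 → ℝ) → ℝ) : Prop :=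
  ∀ T : ℝ, Integrable (fun q : ℝ × (Fin 3 → ℝ) => f q.1 q.2)
    (volume.restrict (Set.Icc 0 T ×ˢ torus a))

/-- Local square integrability in time with values in `L²(𝕋³)`. -/
def LocL2 (a : Fin 3 → ℝ) (f : ℝ → (Fin 3 → ℝ) → ℝ) : Prop :=
  ∀ T : ℝ, MemLp (fun q : ℝ × (Fin 3 → ℝ) => f q.1 q.2) 2
    (volume.restrict (Set.Icc 0 T ×ˢ torus a))

lemma restrict_prod_torus (s : Set ℝ) :
    (volume : Measure (ℝ × (Fin 3 → ℝ))).restrict (s ×ˢ torus a)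
      = (volume.restrict s).prod (volume.restrict (torus a)) := by
  rw [Measure.volume_eq_prod, Measure.prod_restrict]

lemma Ioi_subset_iUnion : Set.Ioi (0 : ℝ) ⊆ ⋃ N : ℕ, Set.Icc (0 : ℝ) N := fun t ht => by
  obtain ⟨N, hN⟩ := exists_nat_ge t
  exact Set.mem_iUnion.2 ⟨N, le_of_lt ht, hN⟩

lemma ae_Ioi_of_ae_Icc {p : ℝ → Prop}
    (h : ∀ T : ℝ, ∀ᵐ t ∂(volume.restrict (Set.Icc 0 T)), p t) :
    ∀ᵐ t ∂(volume.restrict (Set.Ioi (0 : ℝ))), p t :=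
  ae_restrict_of_ae_restrict_of_subset Ioi_subset_iUnion
    ((ae_restrict_iUnion_iff (fun N : ℕ => Set.Icc (0 : ℝ) N) p).2 fun N => h N)

lemma aestronglyMeasurable_Ioi_of_Icc {E : Type*} [TopologicalSpace E]
    [TopologicalSpace.PseudoMetrizableSpace E] {f : ℝ → E}
    (h : ∀ T : ℝ, AEStronglyMeasurable f (volume.restrict (Set.Icc 0 T))) :
    AEStronglyMeasurable f (volume.restrict (Set.Ioi (0 : ℝ))) :=
  (aestronglyMeasurable_iUnion_iff.2 fun N : ℕ => h N).mono_set Ioi_subset_iUnion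

lemma Icc_ae_of_Ioi {p : ℝ → Prop} (h : ∀ᵐ t ∂(volume.restrict (Set.Ioi (0 : ℝ))), p t) (T : ℝ) :
    ∀ᵐ t ∂(volume.restrict (Set.Icc 0 T)), p t := by
  rw [restrict_Ioi_eq_restrict_Ici] at h
  exact ae_restrict_of_ae_restrict_of_subset Set.Icc_subset_Ici_self h

lemma aestronglyMeasurable_Icc_of_Ioi {E : Type*} [TopologicalSpace E]
    [TopologicalSpace.PseudoMetrizableSpace E] {f : ℝ → E}
    (h : AEStronglyMeasurable f (volume.restrict (Set.Ioi (0 : ℝ)))) (T : ℝ) :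
    AEStronglyMeasurable f (volume.restrict (Set.Icc 0 T)) := by
  rw [restrict_Ioi_eq_restrict_Ici] at h
  exact h.mono_set Set.Icc_subset_Ici_self

lemma integrableOn_Ioi_of_Icc {E : Type*} [NormedAddCommGroup E] {f : ℝ → E}
    {T : ℝ} (h : IntegrableOn f (Set.Icc 0 T)) (h0 : ∀ t, T ≤ t → f t = 0) :
    IntegrableOn f (Set.Ioi 0) :=
  h.of_forall_sdiff_eq_zero measurableSet_Ioi fun t ht => h0 t (by
    rcases le_total T t with h | h
    · exact h
    · exact absurd ⟨le_of_lt ht.1, h⟩ ht.2)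

lemma LocL2.locL1 {f : ℝ → (Fin 3 → ℝ) → ℝ} (hf : LocL2 a f) : LocL1 a f := fun T => by
  have : IsFiniteMeasure ((volume : Measure (ℝ × (Fin 3 → ℝ))).restrict
      (Set.Icc 0 T ×ˢ torus a)) :=
    isFiniteMeasure_restrict.2 (isCompact_Icc.prod isCompact_torus).measure_lt_top.ne
  exact (hf T).integrable (by norm_num)

lemma LocL2.mul {f g : ℝ → (Fin 3 → ℝ) → ℝ} (hf : LocL2 a f) (hg : LocL2 a g) :
    LocL1 a (fun t x => f t x * g t x) := fun T => (hf T).integrable_mul (hg T)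

lemma IsL2Loc.comp {d : ℕ} {u : ℝ → (Fin 3 → ℝ) → (Fin d → ℝ)} (hu : IsL2Loc a u) (j : Fin d) :
    LocL2 a (fun t x => u t x j) := fun T => (memLp_pi_iff.1 (hu T)) j

lemma isL2Loc_of_comp {d : ℕ} {u : ℝ → (Fin 3 → ℝ) → (Fin d → ℝ)}
    (hu : ∀ j, LocL2 a (fun t x => u t x j)) : IsL2Loc a u := fun T =>
  memLp_pi_iff.2 fun j => hu j T

lemma LocL1.slice {f : ℝ → (Fin 3 → ℝ) → ℝ} (hf : LocL1 a f) :
    ∀ᵐ t ∂(volume.restrict (Set.Ioi (0 : ℝ))), IntegrableOn (f t) (torus a) := by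
  refine ae_Ioi_of_ae_Icc fun T => ?_
  have h := hf T
  rw [restrict_prod_torus] at h
  exact h.prod_right_ae

/-- Fubini is applied to `f²`, which is integrable on bounded time intervals. -/
lemma LocL2.slice {f : ℝ → (Fin 3 → ℝ) → ℝ} (hf : LocL2 a f) :
    ∀ᵐ t ∂(volume.restrict (Set.Ioi (0 : ℝ))), MemLp (f t) 2 (volume.restrict (torus a)) := by
  filter_upwards [hf.locL1.slice, (hf.mul hf).slice] with t h1 h2
  refine (memLp_two_iff_integrable_sq h1.1).2 ?_
  simp only [sq]
  exact h2

lemma LocL1.integrableOn_norm {f : ℝ → (Fin 3 → ℝ) → ℝ} (hf : LocL1 a f) (T : ℝ) :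
    IntegrableOn (fun t => ∫ x in torus a, |f t x|) (Set.Icc 0 T) := by
  have h := hf T
  rw [restrict_prod_torus] at h
  exact h.integral_norm_prod_left

lemma LocL1.aestronglyMeasurable_coeff {f : ℝ → (Fin 3 → ℝ) → ℝ} (hf : LocL1 a f)
    (n : Fin 3 → ℤ) :
    AEStronglyMeasurable (fun t => coeff a (f t) n) (volume.restrict (Set.Ioi (0 : ℝ))) := by
  refine aestronglyMeasurable_Ioi_of_Icc fun T => ?_
  have h := hf T
  rw [restrict_prod_torus] at h
  simp only [coeff_eq_ccoeff, ccoeff]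
  refine AEStronglyMeasurable.const_mul ?_ _
  have h2 : AEStronglyMeasurable (fun q : ℝ × (Fin 3 → ℝ) => (f q.1 q.2 : ℂ) * chr a (-n) q.2)
      ((volume.restrict (Set.Icc 0 T)).prod (volume.restrict (torus a))) :=
    (integrable_ofReal h).1.mul ((continuous_chr _).comp continuous_snd).aestronglyMeasurable
  exact h2.integral_prod_right'

lemma LocL1.mul_test {f φ : ℝ → (Fin 3 → ℝ) → ℝ} (hf : LocL1 a f) (hφ : IsTest a φ) :
    LocL1 a (fun t x => f t x * φ t x) := fun T => by
  obtain ⟨C, -, hC⟩ := hφ.exists_bound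
  refine Integrable.mul_bdd (c := C) (hf T) hφ.smooth.continuous.aestronglyMeasurable ?_
  refine (ae_restrict_iff' (measurableSet_Icc.prod measurableSet_torus)).2
    (Filter.Eventually.of_forall fun q hq => hC q.1 hq.1.1 q.2 hq.2)

lemma LocL1.integrableOn_integral {f : ℝ → (Fin 3 → ℝ) → ℝ} (hf : LocL1 a f) (T : ℝ) :
    IntegrableOn (fun t => ∫ x in torus a, f t x) (Set.Icc 0 T) := by
  have h := hf T
  rw [restrict_prod_torus] at h
  exact h.integral_prod_left

lemma LocL1.integrable_mul_test {f φ : ℝ → (Fin 3 → ℝ) → ℝ} (hf : LocL1 a f) (hφ : IsTest a φ) :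
    IntegrableOn (fun t => ∫ x in torus a, f t x * φ t x) (Set.Ioi 0) := by
  obtain ⟨T, hT⟩ := hφ.support
  refine integrableOn_Ioi_of_Icc ((hf.mul_test hφ).integrableOn_integral T) fun t ht => ?_
  simp [hT t _ ht]

/-! ### Sources: time dependent Fourier coefficients with a locally integrable bound -/

/-- Time dependent Fourier coefficients which grow at most like `(1 + |ň|²) g(t)` with `g` locally
integrable. -/
structure IsSource (a : Fin 3 → ℝ) (H : ℝ → (Fin 3 → ℤ) → ℂ) : Prop where
  measurable : ∀ n, AEStronglyMeasurable (fun t => H t n) (volume.restrict (Set.Ioi (0 : ℝ)))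
  bounded : ∃ g : ℝ → ℝ, (∀ T : ℝ, IntegrableOn g (Set.Icc 0 T)) ∧
    ∀ᵐ t ∂(volume.restrict (Set.Ioi (0 : ℝ))), ∀ n, ‖H t n‖ ≤ wt a n * g t

lemma IsSource.add {H K : ℝ → (Fin 3 → ℤ) → ℂ} (hH : IsSource a H) (hK : IsSource a K) :
    IsSource a (fun t n => H t n + K t n) where
  measurable n := (hH.measurable n).add (hK.measurable n)
  bounded := by
    obtain ⟨g, hg, h1⟩ := hH.bounded
    obtain ⟨g', hg', h2⟩ := hK.bounded
    refine ⟨fun t => g t + g' t, fun T => (hg T).add (hg' T), ?_⟩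
    filter_upwards [h1, h2] with t h1 h2 n
    rw [mul_add]
    exact (norm_add_le _ _).trans (add_le_add (h1 n) (h2 n))

lemma IsSource.congr {H K : ℝ → (Fin 3 → ℤ) → ℂ} (hH : IsSource a H)
    (h : ∀ᵐ t ∂(volume.restrict (Set.Ioi (0 : ℝ))), ∀ n, H t n = K t n) : IsSource a K where
  measurable n := (hH.measurable n).congr (by filter_upwards [h] with t ht using ht n)
  bounded := by
    obtain ⟨g, hg, h1⟩ := hH.bounded
    refine ⟨g, hg, ?_⟩
    filter_upwards [h, h1] with t h h1 n
    rw [← h n]; exact h1 n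

lemma IsSource.const_mul {H : ℝ → (Fin 3 → ℤ) → ℂ} (hH : IsSource a H) {c : (Fin 3 → ℤ) → ℂ}
    {C : ℝ} (hc : ∀ n, ‖c n‖ ≤ C) : IsSource a (fun t n => c n * H t n) where
  measurable n := (hH.measurable n).const_mul _
  bounded := by
    obtain ⟨g, hg, h1⟩ := hH.bounded
    refine ⟨fun t => C * g t, fun T => (hg T).const_mul _, ?_⟩
    filter_upwards [h1] with t h1 n
    rw [norm_mul, mul_left_comm]
    exact mul_le_mul (hc n) (h1 n) (norm_nonneg _) ((norm_nonneg _).trans (hc n))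

lemma IsSource.sum {ι : Type*} (s : Finset ι) {H : ι → ℝ → (Fin 3 → ℤ) → ℂ}
    (hH : ∀ i ∈ s, IsSource a (H i)) : IsSource a (fun t n => ∑ i ∈ s, H i t n) := by
  classical
  induction s using Finset.induction_on with
  | empty =>
    simp only [Finset.sum_empty]
    exact ⟨fun n => aestronglyMeasurable_const, fun _ => 0, fun T => integrableOn_zero, by simp⟩
  | insert i s hi ih =>
    simp only [Finset.sum_insert hi]
    exact (hH i (Finset.mem_insert_self _ _)).add
      (ih fun j hj => hH j (Finset.mem_insert_of_mem hj))

lemma IsSource.locallyIntegrable {H : ℝ → (Fin 3 → ℤ) → ℂ} (hH : IsSource a H) (n : Fin 3 → ℤ)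
    (T : ℝ) : IntegrableOn (fun t => H t n) (Set.Icc 0 T) := by
  obtain ⟨g, hg, h1⟩ := hH.bounded
  refine Integrable.mono' ((hg T).const_mul (wt a n))
    (aestronglyMeasurable_Icc_of_Ioi (hH.measurable n) T) ?_
  filter_upwards [Icc_ae_of_Ioi h1 T] with t ht using ht n

lemma isSource_of_bounded {H : ℝ → (Fin 3 → ℤ) → ℂ}
    (hm : ∀ n, AEStronglyMeasurable (fun t => H t n) (volume.restrict (Set.Ioi (0 : ℝ))))
    {g : ℝ → ℝ} (hg : ∀ T : ℝ, IntegrableOn g (Set.Icc 0 T))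
    (h : ∀ᵐ t ∂(volume.restrict (Set.Ioi (0 : ℝ))), ∀ n, ‖H t n‖ ≤ g t) : IsSource a H where
  measurable := hm
  bounded := by
    refine ⟨g, hg, ?_⟩
    filter_upwards [h] with t ht n
    exact (ht n).trans (le_mul_of_one_le_left ((norm_nonneg _).trans (ht n)) (one_le_wt n))

lemma LocL1.isSource (ha : ∀ i, 0 < a i) {f : ℝ → (Fin 3 → ℝ) → ℝ} (hf : LocL1 a f) :
    IsSource a (fun t => coeff a (f t)) :=
  isSource_of_bounded hf.aestronglyMeasurable_coeff
    (fun T => (hf.integrableOn_norm T).const_mul (torusVol a)⁻¹)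
    (Filter.Eventually.of_forall fun _ n => norm_coeff_le ha _ n)

/-- Decay of order `4` absorbs the growth `wt` of `F` and leaves the summable `wt⁻³`. -/
lemma summable_mul_conj_coeff (ha : ∀ i, 0 < a i) {φ : ℝ → (Fin 3 → ℝ) → ℝ} (hφ : IsTest a φ)
    {t : ℝ} (ht : 0 ≤ t) {F : (Fin 3 → ℤ) → ℂ} {g : ℝ} (hF : ∀ n, ‖F n‖ ≤ wt a n * g) :
    Summable fun n => F n * (starRingEnd ℂ) (coeff a (φ t) n) := by
  obtain ⟨C, hC0, hC⟩ := hφ.exists_decay ha 4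
  refine Summable.of_norm_bounded ((summable_inv_wt ha).mul_left (g * C)) fun n => ?_
  rw [norm_mul, RCLike.norm_conj]
  have hw := wt_pos (a := a) n
  calc _ ≤ (wt a n * g) * (C * (wt a n ^ 4)⁻¹) :=
        mul_le_mul (hF n) (hC t ht n) (norm_nonneg _) ((norm_nonneg _).trans (hF n))
    _ = g * C * (wt a n ^ 3)⁻¹ := by field_simp

/-- The pairing of a source with a test function can be computed mode by mode. -/
lemma IsSource.hasSum_integral (ha : ∀ i, 0 < a i) {H : ℝ → (Fin 3 → ℤ) → ℂ} (hH : IsSource a H)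
    {φ : ℝ → (Fin 3 → ℝ) → ℝ} (hφ : IsTest a φ) :
    IntegrableOn (fun t => pairing a (H t) (φ t)) (Set.Ioi 0) ∧
    HasSum (fun n => (torusVol a : ℂ) *
        ∫ t in Set.Ioi (0 : ℝ), H t n * (starRingEnd ℂ) (coeff a (φ t) n))
      (∫ t in Set.Ioi (0 : ℝ), pairing a (H t) (φ t)) := by
  obtain ⟨g, hg, hb⟩ := hH.bounded
  obtain ⟨C, hC0, hC⟩ := hφ.exists_decay ha 4
  obtain ⟨T, hT⟩ := hφ.support
  have hz : ∀ t, T ≤ t → φ t = fun _ => 0 := fun t ht => funext fun x => hT t x ht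
  have hmeas : ∀ n, AEStronglyMeasurable (fun t => H t n * (starRingEnd ℂ) (coeff a (φ t) n))
      (volume.restrict (Set.Ioi (0 : ℝ))) := fun n =>
    (hH.measurable n).mul
      (Complex.continuous_conj.comp (hφ.contDiff_coeff n).continuous).aestronglyMeasurable
  -- `g` is only locally integrable. Cutting it off where the test function has already vanished
  -- gives a bound integrable on `(0, ∞)`, which permits exchanging sum and integral.
  let G : ℝ → ℝ := (Set.Iio T).indicator g
  have hG : IntegrableOn G (Set.Ioi 0) := by
    refine integrableOn_Ioi_of_Icc (T := T) ((hg T).indicator measurableSet_Iio) fun t ht => ?_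
    exact Set.indicator_of_notMem (by simpa using ht) _
  have hbound : ∀ᵐ t ∂(volume.restrict (Set.Ioi (0 : ℝ))), ∀ n,
      ‖H t n * (starRingEnd ℂ) (coeff a (φ t) n)‖ ≤ G t * (C * (wt a n ^ 3)⁻¹) := by
    filter_upwards [hb, ae_restrict_mem measurableSet_Ioi] with t ht ht0 n
    have hw := wt_pos (a := a) n
    rcases lt_or_ge t T with h | h
    · have hGt : G t = g t := Set.indicator_of_mem (show t ∈ Set.Iio T from h) _
      rw [hGt, norm_mul, RCLike.norm_conj]
      calc _ ≤ (wt a n * g t) * (C * (wt a n ^ 4)⁻¹) :=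
            mul_le_mul (ht n) (hC t (le_of_lt ht0) n) (norm_nonneg _) ((norm_nonneg _).trans (ht n))
        _ = _ := by field_simp
    · have hGt : G t = 0 := Set.indicator_of_notMem (by simpa using h) _
      simp [hz t h, hGt, coeff_zero]
  have hint : ∀ n, Integrable (fun t => H t n * (starRingEnd ℂ) (coeff a (φ t) n))
      (volume.restrict (Set.Ioi (0 : ℝ))) := fun n =>
    Integrable.mono' (hG.mul_const _) (hmeas n) (by filter_upwards [hbound] with t ht using ht n)
  have hsum : Summable fun n => ∫ t in Set.Ioi (0 : ℝ),
      ‖H t n * (starRingEnd ℂ) (coeff a (φ t) n)‖ := by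
    refine Summable.of_nonneg_of_le (fun n => by positivity) (fun n => ?_)
      ((summable_inv_wt ha).mul_left ((∫ t in Set.Ioi (0 : ℝ), G t) * C))
    rw [mul_assoc, ← integral_mul_const]
    exact integral_mono_ae (hint n).norm (hG.mul_const _)
      (by filter_upwards [hbound] with t ht using ht n)
  have hsummable : ∀ᵐ t ∂(volume.restrict (Set.Ioi (0 : ℝ))),
      Summable fun n => H t n * (starRingEnd ℂ) (coeff a (φ t) n) := by
    filter_upwards [hbound] with t ht
    exact Summable.of_norm_bounded (((summable_inv_wt ha).mul_left C).mul_left (G t)) ht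
  have hmeasP : AEStronglyMeasurable
      (fun t => ∑' n, H t n * (starRingEnd ℂ) (coeff a (φ t) n))
      (volume.restrict (Set.Ioi (0 : ℝ))) := by
    refine aestronglyMeasurable_of_tendsto_ae (u := Filter.atTop)
      (f := fun (s : Finset (Fin 3 → ℤ)) t => ∑ n ∈ s, H t n * (starRingEnd ℂ) (coeff a (φ t) n))
      (fun s => ?_) (by filter_upwards [hsummable] with t ht using ht.hasSum)
    exact Finset.aestronglyMeasurable_fun_sum _ fun n _ => hmeas n
  constructor
  · refine Integrable.const_mul ?_ _
    refine Integrable.mono' (hG.mul_const (∑' n, C * (wt a n ^ 3)⁻¹)) hmeasP ?_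
    filter_upwards [hbound] with t ht
    rw [← tsum_mul_left]
    exact tsum_of_norm_bounded (((summable_inv_wt ha).mul_left C).mul_left (G t)).hasSum ht
  · have h := (hasSum_integral_of_summable_integral_norm hint hsum).mul_left (torusVol a : ℂ)
    simp only [pairing]
    rw [integral_const_mul]
    exact h

/-- Integration against a test function, mode by mode. -/
lemma LocL1.integral_pairing (ha : ∀ i, 0 < a i) {f φ : ℝ → (Fin 3 → ℝ) → ℝ} (hf : LocL1 a f)
    (hφ : IsTest a φ) :
    ∫ t in Set.Ioi (0 : ℝ), pairing a (coeff a (f t)) (φ t)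
      = ((∫ t in Set.Ioi (0 : ℝ), ∫ x in torus a, f t x * φ t x : ℝ) : ℂ) := by
  rw [← integral_complex_ofReal]
  refine integral_congr_ae ?_
  filter_upwards [hf.slice] with t ht
  exact pairing_coeff_of_contDiff ha ht (hφ.contDiff_slice t) (hφ.periodic t)

/-! ### Equations for the modes -/

/-- `y' + h = 0`, `y(0) = y₀` in the sense of distributions on `[0, ∞)`. -/
def ModeEq (y : ℝ → ℂ) (y₀ : ℂ) (h : ℝ → ℂ) : Prop :=
  ∀ θ : ℝ → ℂ, ContDiff ℝ ∞ θ → (∃ T : ℝ, ∀ t, T ≤ t → θ t = 0) →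
    (∫ t in Set.Ioi (0 : ℝ), y t * deriv θ t) + y₀ * θ 0 = ∫ t in Set.Ioi (0 : ℝ), h t * θ t

/-- A field all of whose modes satisfy their equations satisfies the equation in the sense of
distributions. -/
lemma equation_of_modeEq (ha : ∀ i, 0 < a i) {f : ℝ → (Fin 3 → ℝ) → ℝ} (hf : LocL1 a f)
    {f₀ : (Fin 3 → ℝ) → ℝ} (hf₀ : IntegrableOn f₀ (torus a)) {H : ℝ → (Fin 3 → ℤ) → ℂ}
    (hH : IsSource a H)
    (h : ∀ n, ModeEq (fun t => coeff a (f t) n) (coeff a f₀ n) (fun t => H t n))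
    {φ : ℝ → (Fin 3 → ℝ) → ℝ} (hφ : IsTest a φ) :
    (((∫ t in Set.Ioi (0 : ℝ), ∫ x in torus a, f t x * dt φ t x)
      + ∫ x in torus a, f₀ x * φ 0 x : ℝ) : ℂ)
      = ∫ t in Set.Ioi (0 : ℝ), pairing a (H t) (φ t) := by
  have h1 := ((hf.isSource ha).hasSum_integral ha hφ.dt).2
  rw [hf.integral_pairing ha hφ.dt] at h1
  have h2 : HasSum (fun n => (torusVol a : ℂ) *
      (coeff a f₀ n * (starRingEnd ℂ) (coeff a (φ 0) n)))
      ((∫ x in torus a, f₀ x * φ 0 x : ℝ) : ℂ) := by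
    obtain ⟨C, hC⟩ := isCompact_torus.exists_bound_of_continuousOn (s := torus a)
      (hφ.contDiff_slice 0).continuous.continuousOn
    have hm : MemLp (φ 0) 2 (volume.restrict (torus a)) :=
      MemLp.of_bound (hφ.contDiff_slice 0).continuous.aestronglyMeasurable C
        ((ae_restrict_iff' measurableSet_torus).2 (Filter.Eventually.of_forall hC))
    have := (hasSum_coeff_mul_conj ha hf₀ hm (hφ.summable_coeff ha le_rfl)).mul_left
      (torusVol a : ℂ)
    rwa [mul_inv_cancel_left₀ (Complex.ofReal_ne_zero.2 (torusVol_pos ha).ne')] at this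
  have h3 := (hH.hasSum_integral ha hφ).2
  push_cast
  refine (h1.add h2).unique ?_
  convert! h3 using 1
  funext n
  rw [← mul_add]
  congr 1
  have hs : ∃ T : ℝ, ∀ t, T ≤ t → (starRingEnd ℂ) (coeff a (φ t) n) = 0 := by
    obtain ⟨T, hT⟩ := hφ.support
    refine ⟨T, fun t ht => ?_⟩
    have hz : φ t = fun _ => 0 := funext fun x => hT t x ht
    simp [hz, coeff_zero]
  have hd : ∀ t, deriv (fun t => (starRingEnd ℂ) (coeff a (φ t) n)) t
      = (starRingEnd ℂ) (coeff a (dt φ t) n) := fun t =>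
    ((hφ.hasDerivAt_coeff n t).star).deriv
  -- The conjugate coefficient of `φ` serves as the test function of time for the mode `n`.
  have h4 := h n (fun t => (starRingEnd ℂ) (coeff a (φ t) n))
    (Complex.conjCLE.contDiff.comp (hφ.contDiff_coeff n)) hs
  simp only [hd] at h4
  exact h4

/-- The real part of `θ(t) e^{-i ň · x}`. -/
def modeTest (a : Fin 3 → ℝ) (n : Fin 3 → ℤ) (θ : ℝ → ℂ) (t : ℝ) (x : Fin 3 → ℝ) : ℝ :=
  (θ t * chr a (-n) x).re

lemma isTest_modeTest (ha : ∀ i, 0 < a i) (n : Fin 3 → ℤ) {θ : ℝ → ℂ} (hθ : ContDiff ℝ ∞ θ)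
    (hs : ∃ T : ℝ, ∀ t, T ≤ t → θ t = 0) : IsTest a (modeTest a n θ) where
  smooth := Complex.reCLM.contDiff.comp
    ((hθ.comp contDiff_fst).mul ((contDiff_chr (-n)).comp contDiff_snd))
  periodic t x i := by simp only [modeTest, isPeriodic_chr ha (-n) x i]
  support := by
    obtain ⟨T, hT⟩ := hs
    exact ⟨T, fun t x ht => by simp [modeTest, hT t ht]⟩

lemma dt_modeTest (n : Fin 3 → ℤ) {θ : ℝ → ℂ} (hθ : ContDiff ℝ ∞ θ) :
    dt (modeTest a n θ) = modeTest a n (deriv θ) := by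
  funext t x
  have h := ((hθ.differentiable (by simp) t).hasDerivAt.mul_const (chr a (-n) x))
  exact (Complex.reCLM.hasFDerivAt.comp_hasDerivAt t h).deriv

lemma coeff_modeTest (ha : ∀ i, 0 < a i) (n m : Fin 3 → ℤ) (θ : ℝ → ℂ) (t : ℝ) :
    coeff a (modeTest a n θ t) m
      = (if m = -n then θ t / 2 else 0) + (if m = n then (starRingEnd ℂ) (θ t) / 2 else 0) := by
  have hx : ∀ x, ((modeTest a n θ t x : ℝ) : ℂ)
      = θ t / 2 * chr a (-n) x + (starRingEnd ℂ) (θ t) / 2 * chr a n x := by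
    intro x
    rw [modeTest, Complex.re_eq_add_conj, map_mul, conj_chr, neg_neg]; ring
  have hi : ∀ m, IntegrableOn (chr a m) (torus a) := fun m => integrableOn_of_contDiff (contDiff_chr m)
  rw [coeff_eq_ccoeff]
  simp only [hx]
  rw [ccoeff_add ((hi _).const_mul _) ((hi _).const_mul _), ccoeff_const_mul, ccoeff_const_mul,
    ccoeff_chr ha, ccoeff_chr ha]
  simp only [mul_ite, mul_one, mul_zero, eq_comm (b := m)]

lemma pairing_modeTest (ha : ∀ i, 0 < a i) (F : (Fin 3 → ℤ) → ℂ) (n : Fin 3 → ℤ) (θ : ℝ → ℂ)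
    (t : ℝ) :
    pairing a F (modeTest a n θ t)
      = torusVol a * ((F (-n) * (starRingEnd ℂ) (θ t) + F n * θ t) / 2) := by
  rw [pairing]
  congr 1
  have h1 := hasSum_ite_eq (-n) (F (-n) * ((starRingEnd ℂ) (θ t) / 2))
  have h2 := hasSum_ite_eq n (F n * (θ t / 2))
  rw [add_div, ← mul_div_assoc', ← mul_div_assoc', ← (h1.add h2).tsum_eq]
  congr 1
  funext m
  rw [coeff_modeTest ha, map_add, mul_add]
  congr 1
  · split_ifs with h
    · rw [h]; simp [Complex.conj_ofNat]
    · simp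
  · split_ifs with h
    · rw [h]; simp [Complex.conj_ofNat]
    · simp

/-- A real test function sees the modes `n` and `-n` together. Combining `θ` with `-iθ` removes the
contribution of `-n`, without any symmetry assumption on `F`. -/
lemma pairing_modeTest_add (ha : ∀ i, 0 < a i) (F : (Fin 3 → ℤ) → ℂ) (n : Fin 3 → ℤ) (θ : ℝ → ℂ)
    (t : ℝ) :
    pairing a F (modeTest a n θ t) + Complex.I * pairing a F (modeTest a n (fun s => -Complex.I * θ s) t)
      = torusVol a * (F n * θ t) := by
  rw [pairing_modeTest ha, pairing_modeTest ha]
  simp only [map_mul, map_neg, Complex.conj_I]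
  linear_combination (torusVol a * (F (-n) * (starRingEnd ℂ) (θ t) - F n * θ t) / 2) * Complex.I_sq

/-- The modes of a solution in the sense of distributions. -/
lemma modeEq_of_equation (ha : ∀ i, 0 < a i) {f : ℝ → (Fin 3 → ℝ) → ℝ} (hf : LocL1 a f)
    {f₀ : (Fin 3 → ℝ) → ℝ} (hf₀ : IntegrableOn f₀ (torus a)) {H : ℝ → (Fin 3 → ℤ) → ℂ}
    (hH : IsSource a H)
    (h : ∀ φ : ℝ → (Fin 3 → ℝ) → ℝ, IsTest a φ →
      (((∫ t in Set.Ioi (0 : ℝ), ∫ x in torus a, f t x * dt φ t x)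
      + ∫ x in torus a, f₀ x * φ 0 x : ℝ) : ℂ)
      = ∫ t in Set.Ioi (0 : ℝ), pairing a (H t) (φ t)) (n : Fin 3 → ℤ) :
    ModeEq (fun t => coeff a (f t) n) (coeff a f₀ n) (fun t => H t n) := by
  intro θ hθ hs
  have hθ' : ContDiff ℝ ∞ (fun s => -Complex.I * θ s) := contDiff_const.mul hθ
  have hs' : ∃ T : ℝ, ∀ t, T ≤ t → -Complex.I * θ t = 0 := by
    obtain ⟨T, hT⟩ := hs
    exact ⟨T, fun t ht => by rw [hT t ht, mul_zero]⟩
  have t1 := isTest_modeTest ha n hθ hs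
  have t2 := isTest_modeTest ha n hθ' hs'
  have d2 : deriv (fun s => -Complex.I * θ s) = fun s => -Complex.I * deriv θ s := by
    funext s
    exact ((hθ.differentiable (by simp) s).hasDerivAt.const_mul _).deriv
  have e1 := h _ t1
  have e2 := h _ t2
  push_cast at e1 e2
  rw [← hf.integral_pairing ha t1.dt, ← pairing_coeff_of_contDiff ha hf₀ (t1.contDiff_slice 0)
    (t1.periodic 0), dt_modeTest n hθ] at e1
  rw [← hf.integral_pairing ha t2.dt, ← pairing_coeff_of_contDiff ha hf₀ (t2.contDiff_slice 0)
    (t2.periodic 0), dt_modeTest n hθ', d2] at e2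
  have i1 := ((hf.isSource ha).hasSum_integral ha t1.dt).1
  have i2 := ((hf.isSource ha).hasSum_integral ha t2.dt).1
  rw [dt_modeTest n hθ] at i1
  rw [dt_modeTest n hθ', d2] at i2
  have j1 := (hH.hasSum_integral ha t1).1
  have j2 := (hH.hasSum_integral ha t2).1
  have hv : (torusVol a : ℂ) ≠ 0 := Complex.ofReal_ne_zero.2 (torusVol_pos ha).ne'
  have k1 := integral_add i1 (i2.const_mul Complex.I)
  have k2 := integral_add j1 (j2.const_mul Complex.I)
  have k3 := pairing_modeTest_add ha (coeff a f₀) n θ 0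
  simp only [pairing_modeTest_add ha _ n] at k1 k2
  rw [integral_const_mul, integral_const_mul] at k1 k2
  refine mul_left_cancel₀ hv ?_
  rw [mul_add, k1, k2, ← k3]
  linear_combination e1 + Complex.I * e2

/-- Uniqueness for `y' + λ y = 0`, `y(0) = 0`. -/
lemma ModeEq.eq_zero {y : ℝ → ℂ} {l : ℝ} (hy : ∀ T : ℝ, IntegrableOn y (Set.Icc 0 T))
    (h : ModeEq y 0 (fun t => (l : ℂ) * y t)) : ∀ᵐ t ∂(volume.restrict (Set.Ioi (0 : ℝ))), y t = 0 := by
  have hloc : LocallyIntegrableOn (fun t : ℝ => Complex.exp (l * t) * y t) (Set.Ioi 0) := by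
    have hl : LocallyIntegrableOn y (Set.Ioi 0) := by
      intro t ht
      refine ⟨Set.Icc 0 (t + 1), mem_nhdsWithin_of_mem_nhds
        (Icc_mem_nhds ht (by linarith)), hy _⟩
    exact hl.continuousOn_mul (Continuous.continuousOn (by fun_prop)) isOpen_Ioi.isLocallyClosed
  have key := IsOpen.ae_eq_zero_of_integral_contDiff_smul_eq_zero isOpen_Ioi hloc (fun g hg hgc hgs => ?_)
  · rw [ae_restrict_iff' measurableSet_Ioi]
    filter_upwards [key] with t ht ht0
    exact (mul_eq_zero.1 (ht ht0)).resolve_left (Complex.exp_ne_zero _)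
  · obtain ⟨R, hR⟩ := hgc.isCompact.isBounded.subset_ball 0
    have hg0 : ∀ t, R ≤ t → g t = 0 := fun t ht => by
      by_contra hne
      have := hR (subset_tsupport g (Function.mem_support.2 hne))
      rw [Metric.mem_ball, dist_zero_right, Real.norm_eq_abs] at this
      linarith [le_abs_self t]
    -- Duality: with `η' = g` and `η = 0` beyond `R`, the function `θ = e^{lt} η` solves `θ' - lθ =
    -- e^{lt} g`. It need not vanish at `t = 0`, which is harmless because the initial value of `y`
    -- is zero.
    set η : ℝ → ℝ := fun t => ∫ s in R..t, g s with hη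
    have hηd : ∀ t, HasDerivAt η (g t) t := fun t =>
      intervalIntegral.integral_hasDerivAt_right (hg.continuous.intervalIntegrable _ _)
        (hg.continuous.stronglyMeasurableAtFilter _ _) hg.continuous.continuousAt
    have hηs : ContDiff ℝ ∞ η := by
      refine contDiff_infty_iff_deriv.2 ⟨fun t => (hηd t).differentiableAt, ?_⟩
      rwa [show deriv η = g from funext fun t => (hηd t).deriv]
    have hη0 : ∀ t, R ≤ t → η t = 0 := fun t ht => by
      simp only [hη]
      rw [intervalIntegral.integral_congr (g := fun _ => 0), intervalIntegral.integral_zero]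
      intro s hs
      rw [Set.uIcc_of_le ht] at hs
      exact hg0 s hs.1
    let θ : ℝ → ℂ := fun t => Complex.exp (l * t) * η t
    have hexp : ContDiff ℝ ∞ (fun t : ℝ => Complex.exp (l * t)) :=
      (contDiff_const.mul Complex.ofRealCLM.contDiff).cexp
    have hθ : ContDiff ℝ ∞ θ := hexp.mul (Complex.ofRealCLM.contDiff.comp hηs)
    have hθd : ∀ t, deriv θ t = l * θ t + Complex.exp (l * t) * g t := fun t => by
      have h1 : HasDerivAt (fun t : ℝ => (l : ℂ) * t) ((l : ℂ) * 1) t :=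
        Complex.ofRealCLM.hasDerivAt.const_mul (l : ℂ)
      have := (h1.cexp.mul (hηd t).ofReal_comp).deriv
      simp only [θ]
      refine this.trans ?_
      ring
    have h1 := h θ hθ ⟨R, fun t ht => by simp [θ, hη0 t ht]⟩
    rw [zero_mul, add_zero] at h1
    have hI : ∀ {ζ : ℝ → ℂ}, Continuous ζ → (∀ t, R ≤ t → ζ t = 0) →
        IntegrableOn (fun t => y t * ζ t) (Set.Ioi 0) := by
      intro ζ hζ hζ0
      refine integrableOn_Ioi_of_Icc (T := R) ?_ fun t ht => by rw [hζ0 t ht, mul_zero]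
      exact (hy R).mul_continuousOn hζ.continuousOn isCompact_Icc
    have h2 : ∫ t in Set.Ioi (0 : ℝ), y t * deriv θ t
        = (∫ t in Set.Ioi (0 : ℝ), y t * (l * θ t))
          + ∫ t in Set.Ioi (0 : ℝ), y t * (Complex.exp (l * t) * g t) := by
      rw [← integral_add (hI (ζ := fun t => l * θ t) (continuous_const.mul hθ.continuous)
        fun t ht => by simp [θ, hη0 t ht]) (hI (ζ := fun t => Complex.exp (l * t) * g t) (hexp.continuous.mul
          (Complex.continuous_ofReal.comp hg.continuous)) fun t ht => by simp [hg0 t ht])]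
      simp only [hθd, mul_add]
    have h3 : ∫ t in Set.Ioi (0 : ℝ), y t * (l * θ t) = ∫ t in Set.Ioi (0 : ℝ), l * y t * θ t := by
      congr 1; funext t; ring
    rw [h2, h3] at h1
    have h4 : ∫ t in Set.Ioi (0 : ℝ), y t * (Complex.exp (l * t) * g t) = 0 := by
      linear_combination h1
    rw [← h4, ← setIntegral_eq_integral_of_forall_compl_eq_zero (s := Set.Ioi (0 : ℝ))]
    · congr 1; funext t
      rw [Complex.real_smul]; ring
    · intro t ht
      have : g t = 0 := by
        by_contra hne
        exact ht (hgs (subset_tsupport g (Function.mem_support.2 hne)))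
      simp [this]

end StratifiedLimit
end

open scoped ContDiff

noncomputable section

namespace StratifiedLimit

open MeasureTheory

variable {a : Fin 3 → ℝ}

/-! ### Fields with prescribed time dependent Fourier coefficients -/

/-- The measure on `(0, ∞) × 𝕋³`. -/
def spaceTime (a : Fin 3 → ℝ) : Measure (ℝ × (Fin 3 → ℝ)) :=
  (volume.restrict (Set.Ioi (0 : ℝ))).prod (volume.restrict (torus a))

lemma integral_chr_mul_chr (ha : ∀ i, 0 < a i) (n m : Fin 3 → ℤ) :
    ∫ x in torus a, (starRingEnd ℂ) (chr a n x) * chr a m x = if n = m then (torusVol a : ℂ) else 0 := by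
  have h := ccoeff_chr ha n m
  have hv : (torusVol a : ℂ) ≠ 0 := Complex.ofReal_ne_zero.2 (torusVol_pos ha).ne'
  rw [ccoeff, inv_mul_eq_iff_eq_mul₀ hv] at h
  simp only [conj_chr, mul_comm (chr a (-n) _)]
  rw [h, mul_ite, mul_one, mul_zero]
  simp only [eq_comm]

lemma memLp_mul_chr {y : ℝ → ℂ} (hy : MemLp y 2 (volume.restrict (Set.Ioi (0 : ℝ))))
    (n : Fin 3 → ℤ) :
    MemLp (fun q : ℝ × (Fin 3 → ℝ) => y q.1 * chr a n q.2) 2 (spaceTime a) := by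
  have hc : MemLp (fun q : ℝ × (Fin 3 → ℝ) => chr a n q.2) ⊤ (spaceTime a) :=
    memLp_top_of_bound ((continuous_chr n).comp continuous_snd).aestronglyMeasurable 1
      (Filter.Eventually.of_forall fun q => (norm_chr _ _).le)
  exact hc.mul' (hy.comp_fst _)

lemma integral_mul_chr_mul (ha : ∀ i, 0 < a i) {y z : ℝ → ℂ} (n m : Fin 3 → ℤ)
    (hy : MemLp y 2 (volume.restrict (Set.Ioi (0 : ℝ))))
    (hz : MemLp z 2 (volume.restrict (Set.Ioi (0 : ℝ)))) :
    inner ℂ ((memLp_mul_chr (a := a) hy n).toLp _) ((memLp_mul_chr (a := a) hz m).toLp _)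
      = if n = m then torusVol a * ∫ t in Set.Ioi (0 : ℝ), (starRingEnd ℂ) (y t) * z t else 0 := by
  have h1 := L2.integrable_inner (𝕜 := ℂ) ((memLp_mul_chr (a := a) hy n).toLp _)
    ((memLp_mul_chr (a := a) hz m).toLp _)
  have h2 : (fun q => inner ℂ (((memLp_mul_chr (a := a) hy n).toLp _ :
        Lp ℂ 2 (spaceTime a)) q) (((memLp_mul_chr (a := a) hz m).toLp _ : Lp ℂ 2 (spaceTime a)) q))
      =ᵐ[spaceTime a] fun q : ℝ × (Fin 3 → ℝ) => ((starRingEnd ℂ) (y q.1) * z q.1) *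
        ((starRingEnd ℂ) (chr a n q.2) * chr a m q.2) := by
    filter_upwards [(memLp_mul_chr (a := a) hy n).coeFn_toLp, (memLp_mul_chr (a := a) hz m).coeFn_toLp]
      with q e1 e2
    rw [e1, e2, RCLike.inner_apply, map_mul]
    ring
  rw [L2.inner_def, integral_congr_ae h2, spaceTime,
    integral_prod_mul (fun t => (starRingEnd ℂ) (y t) * z t)
      (fun x => (starRingEnd ℂ) (chr a n x) * chr a m x), integral_chr_mul_chr ha, mul_ite, mul_zero,
    mul_comm]

/-- The sum of an `L²` Fourier series with time dependent coefficients. -/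
lemma exists_sum_of_summable (ha : ∀ i, 0 < a i) {c : (Fin 3 → ℤ) → ℝ → ℂ}
    (hc : ∀ n, MemLp (c n) 2 (volume.restrict (Set.Ioi (0 : ℝ))))
    (hs : Summable fun n => ∫ t in Set.Ioi (0 : ℝ), ‖c n t‖ ^ 2) :
    ∃ F : ℝ × (Fin 3 → ℝ) → ℂ, StronglyMeasurable F ∧ MemLp F 2 (spaceTime a) ∧
      ∀ᵐ t ∂(volume.restrict (Set.Ioi (0 : ℝ))), ∀ n, ccoeff a (fun x => F (t, x)) n = c n t := by
  -- The functions `c n (t) e^{iň·x}` are pairwise orthogonal in `L²` of space-time and their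
  -- squared norms are summable by `hs`, so the series converges there.
  let g : (Fin 3 → ℤ) → Lp ℂ 2 (spaceTime a) := fun n => (memLp_mul_chr (hc n) n).toLp _
  have hort : OrthogonalFamily ℂ (fun n => Submodule.span ℂ {g n})
      (fun n => (Submodule.span ℂ {g n}).subtypeₗᵢ) := by
    refine OrthogonalFamily.of_pairwise fun n m hnm => ?_
    change Submodule.span ℂ {g n} ⟂ Submodule.span ℂ {g m}
    rw [Submodule.isOrtho_span]
    rintro _ rfl _ rfl
    exact (integral_mul_chr_mul ha n m (hc n) (hc m)).trans (if_neg hnm)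
  have hnorm : ∀ n, ‖g n‖ ^ 2 = torusVol a * ∫ t in Set.Ioi (0 : ℝ), ‖c n t‖ ^ 2 := by
    intro n
    have h := integral_mul_chr_mul ha n n (hc n) (hc n)
    rw [if_pos rfl, inner_self_eq_norm_sq_to_K] at h
    have h2 : ∫ t in Set.Ioi (0 : ℝ), (starRingEnd ℂ) (c n t) * c n t
        = ((∫ t in Set.Ioi (0 : ℝ), ‖c n t‖ ^ 2 : ℝ) : ℂ) := by
      rw [← integral_complex_ofReal]
      congr 1; funext t; rw [Complex.conj_mul']; push_cast; rfl
    rw [h2] at h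
    have h3 : ‖(memLp_mul_chr (a := a) (hc n) n).toLp _‖ ^ 2
        = torusVol a * ∫ t in Set.Ioi (0 : ℝ), ‖c n t‖ ^ 2 := by
      refine Complex.ofReal_injective ?_
      rw [Complex.ofReal_pow, Complex.ofReal_mul]
      exact h
    exact h3
  have hsum : Summable g := by
    have h := (hort.summable_iff_norm_sq_summable
      (fun n => ⟨g n, Submodule.mem_span_singleton_self _⟩)).2 (by
        simp only [Submodule.coe_norm, hnorm]; exact hs.mul_left _)
    exact h
  set F : Lp ℂ 2 (spaceTime a) := ∑' n, g n with hF
  refine ⟨F, Lp.stronglyMeasurable F, Lp.memLp F, ae_all_iff.2 fun n => ?_⟩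
  have hfin : ∀ s : Set ℝ, volume.restrict (Set.Ioi (0 : ℝ)) s < ⊤ →
      Integrable F (((volume.restrict (Set.Ioi (0 : ℝ))).restrict s).prod
        (volume.restrict (torus a))) := by
    intro s hs
    have : IsFiniteMeasure ((volume.restrict (Set.Ioi (0 : ℝ))).restrict s) :=
      isFiniteMeasure_restrict.2 hs.ne
    refine MemLp.integrable (q := 2) (by norm_num) ?_
    refine (Lp.memLp F).mono_measure ?_
    exact Measure.prod_mono Measure.restrict_le_self le_rfl
  have hfin' : ∀ s : Set ℝ, volume.restrict (Set.Ioi (0 : ℝ)) s < ⊤ →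
      Integrable (fun q : ℝ × (Fin 3 → ℝ) => F q * chr a (-n) q.2)
        (((volume.restrict (Set.Ioi (0 : ℝ))).restrict s).prod (volume.restrict (torus a))) := by
    intro s hs
    exact (hfin s hs).mul_bdd (c := 1) ((continuous_chr _).comp continuous_snd).aestronglyMeasurable
      (Filter.Eventually.of_forall fun q => (norm_chr _ _).le)
  -- The coefficient as a function of time is identified through its integrals over sets `s` of
  -- finite measure, that is, by pairing the sum with `1_s(t) e^{iň·x}`.
  refine ae_eq_of_forall_setIntegral_eq_of_sigmaFinite (fun s hs hs' => ?_) (fun s hs hs' => ?_)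
    (fun s hs hs' => ?_)
  · exact ((hfin' s hs').integral_prod_left).const_mul _
  · have : IsFiniteMeasure ((volume.restrict (Set.Ioi (0 : ℝ))).restrict s) :=
      isFiniteMeasure_restrict.2 hs'.ne
    exact ((hc n).restrict s).integrable (by norm_num)
  · have h1s : MemLp (s.indicator fun _ => (1 : ℂ)) 2 (volume.restrict (Set.Ioi (0 : ℝ))) :=
      memLp_indicator_const 2 hs 1 (Or.inr hs'.ne)
    let k : Lp ℂ 2 (spaceTime a) := (memLp_mul_chr h1s n).toLp _
    have hk : inner ℂ k F = inner ℂ k (g n) := by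
      have h2 := (innerSL ℂ k).hasSum hsum.hasSum
      have h3 : ∀ m, m ≠ n → innerSL ℂ k (g m) = 0 := by
        intro m hm
        exact (integral_mul_chr_mul ha n m h1s (hc m)).trans (if_neg hm.symm)
      exact h2.unique (hasSum_single n h3)
    replace hk := hk.trans ((integral_mul_chr_mul ha n n h1s (hc n)).trans (if_pos rfl))
    have hv : (torusVol a : ℂ) ≠ 0 := Complex.ofReal_ne_zero.2 (torusVol_pos ha).ne'
    have h4 : inner ℂ k F = ∫ q, (Prod.fst ⁻¹' s).indicator
        (fun q : ℝ × (Fin 3 → ℝ) => F q * chr a (-n) q.2) q ∂(spaceTime a) := by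
      rw [L2.inner_def]
      refine integral_congr_ae ?_
      filter_upwards [(memLp_mul_chr (a := a) h1s n).coeFn_toLp] with q hq
      rw [hq, RCLike.inner_apply, map_mul, conj_chr]
      by_cases hqs : q.1 ∈ s
      · rw [Set.indicator_of_mem hqs, Set.indicator_of_mem (show q ∈ Prod.fst ⁻¹' s from hqs)]
        simp
      · rw [Set.indicator_of_notMem hqs, Set.indicator_of_notMem (show q ∉ Prod.fst ⁻¹' s from hqs)]
        simp
    have h5 : (spaceTime a).restrict (Prod.fst ⁻¹' s)
        = ((volume.restrict (Set.Ioi (0 : ℝ))).restrict s).prod (volume.restrict (torus a)) := by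
      rw [spaceTime, show (Prod.fst ⁻¹' s : Set (ℝ × (Fin 3 → ℝ))) = s ×ˢ Set.univ by
        ext; simp, ← Measure.prod_restrict, Measure.restrict_univ]
    rw [integral_indicator (measurable_fst hs), h5, integral_prod _ (hfin' s hs')] at h4
    have h6 : ∫ t in Set.Ioi (0 : ℝ), (starRingEnd ℂ) (s.indicator (fun _ => (1 : ℂ)) t) * c n t
        = ∫ t in s, c n t ∂(volume.restrict (Set.Ioi (0 : ℝ))) := by
      rw [← integral_indicator hs]
      congr 1; funext t
      by_cases ht : t ∈ s <;> simp [ht]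
    simp only [ccoeff]
    rw [integral_const_mul, ← h4, hk, h6, inv_mul_cancel_left₀ hv]

lemma integrableOn_inv_sq : IntegrableOn (fun t : ℝ => ((1 + t) ^ 2)⁻¹) (Set.Ioi 0) := by
  have h := integrable_inv_one_add_sq.integrableOn (s := Set.Ioi (0 : ℝ))
  refine Integrable.mono' h (Measurable.aestronglyMeasurable (by fun_prop)) ?_
  filter_upwards [ae_restrict_mem measurableSet_Ioi] with t ht
  have ht : 0 < t := ht
  rw [Real.norm_of_nonneg (by positivity)]
  exact inv_anti₀ (by positivity) (by nlinarith)

/-- Square summable coefficients with a locally integrable sum are the Fourier coefficients of a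
field. -/
theorem exists_field (ha : ∀ i, 0 < a i) {c : (Fin 3 → ℤ) → ℝ → ℂ} {G : ℝ → ℝ}
    (hc : ∀ n, AEStronglyMeasurable (c n) (volume.restrict (Set.Ioi (0 : ℝ))))
    (hreal : ∀ᵐ t ∂(volume.restrict (Set.Ioi (0 : ℝ))), ∀ n, c (-n) t = (starRingEnd ℂ) (c n t))
    (hG : ∀ T : ℝ, IntegrableOn G (Set.Icc 0 T))
    (hcG : ∀ᵐ t ∂(volume.restrict (Set.Ioi (0 : ℝ))), (Summable fun n => ‖c n t‖ ^ 2) ∧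
      ∑' n, ‖c n t‖ ^ 2 ≤ G t) :
    ∃ f : ℝ → (Fin 3 → ℝ) → ℝ, LocL2 a f ∧
      ∀ᵐ t ∂(volume.restrict (Set.Ioi (0 : ℝ))), ∀ n, coeff a (f t) n = c n t := by
  have hGm : AEStronglyMeasurable G (volume.restrict (Set.Ioi (0 : ℝ))) :=
    aestronglyMeasurable_Ioi_of_Icc fun T => (hG T).1
  -- `G` is only locally integrable. Dividing the coefficients by `r` brings the sum of their
  -- squares below `(1 + t)⁻²`, which is integrable on `(0, ∞)`; the resulting field is multiplied
  -- by `r` afterwards.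
  let r : ℝ → ℝ := fun t => (1 + |t|) * (1 + |G t|)
  have hr : ∀ t, 0 < r t := fun t => by positivity
  have hrm : AEStronglyMeasurable r (volume.restrict (Set.Ioi (0 : ℝ))) := by
    refine AEStronglyMeasurable.mul (Continuous.aestronglyMeasurable (by fun_prop)) ?_
    exact aestronglyMeasurable_const.add hGm.norm
  let b : (Fin 3 → ℤ) → ℝ → ℂ := fun n t => ((r t)⁻¹ : ℝ) * c n t
  have hbm : ∀ n, AEStronglyMeasurable (b n) (volume.restrict (Set.Ioi (0 : ℝ))) := fun n =>
    (Complex.continuous_ofReal.comp_aestronglyMeasurable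
      (hrm.aemeasurable.inv.aestronglyMeasurable)).mul (hc n)
  have hbs : ∀ᵐ t ∂(volume.restrict (Set.Ioi (0 : ℝ))), ∀ s : Finset (Fin 3 → ℤ),
      ∑ n ∈ s, ‖b n t‖ ^ 2 ≤ ((1 + t) ^ 2)⁻¹ := by
    filter_upwards [hcG, ae_restrict_mem measurableSet_Ioi] with t ht ht0 s
    have ht0 : 0 < t := ht0
    have h1 : ∑ n ∈ s, ‖c n t‖ ^ 2 ≤ G t :=
      (ht.1.sum_le_tsum s fun _ _ => by positivity).trans ht.2
    have h2 : ∀ n, ‖b n t‖ ^ 2 = ((r t)⁻¹) ^ 2 * ‖c n t‖ ^ 2 := fun n => by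
      simp only [b, norm_mul, Complex.norm_real, Real.norm_of_nonneg (inv_pos.2 (hr t)).le, mul_pow]
    simp only [h2, ← Finset.mul_sum]
    have h3 : G t ≤ (1 + |G t|) ^ 2 := by nlinarith [le_abs_self (G t), abs_nonneg (G t)]
    calc _ ≤ ((r t)⁻¹) ^ 2 * (1 + |G t|) ^ 2 := by gcongr; exact h1.trans h3
      _ = ((1 + t) ^ 2)⁻¹ := by
        simp only [r, abs_of_pos ht0]
        have : 0 < 1 + |G t| := by positivity
        field_simp
  have hbint : ∀ n, IntegrableOn (fun t => ‖b n t‖ ^ 2) (Set.Ioi 0) := fun n => by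
    refine Integrable.mono' integrableOn_inv_sq ((hbm n).norm.pow 2) ?_
    filter_upwards [hbs] with t ht
    simpa using ht {n}
  have hb2 : ∀ n, MemLp (b n) 2 (volume.restrict (Set.Ioi (0 : ℝ))) := fun n =>
    (memLp_two_iff_integrable_sq_norm (hbm n)).2 (hbint n)
  have hbsum : Summable fun n => ∫ t in Set.Ioi (0 : ℝ), ‖b n t‖ ^ 2 := by
    refine summable_of_sum_le (c := ∫ t in Set.Ioi (0 : ℝ), ((1 + t) ^ 2)⁻¹)
      (fun n => by positivity) fun s => ?_
    rw [← integral_finsetSum _ fun n _ => hbint n]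
    exact integral_mono_ae (integrable_finsetSum _ fun n _ => hbint n) integrableOn_inv_sq
      (by filter_upwards [hbs] with t ht using ht s)
  obtain ⟨F, hFm, hF2, hF⟩ := exists_sum_of_summable ha hb2 hbsum
  -- Taking the real part does not change the coefficients, because of the symmetry `c (-n) = conj
  -- (c n)`.
  let f : ℝ → (Fin 3 → ℝ) → ℝ := fun t x => r t * (F (t, x)).re
  have hslice : ∀ᵐ t ∂(volume.restrict (Set.Ioi (0 : ℝ))),
      MemLp (fun x => F (t, x)) 2 (volume.restrict (torus a)) := by
    have h := (memLp_two_iff_integrable_sq_norm hF2.1).1 hF2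
    filter_upwards [h.prod_right_ae] with t ht
    exact (memLp_two_iff_integrable_sq_norm
      (hFm.comp_measurable measurable_prodMk_left).aestronglyMeasurable).2 ht
  have hfs : ∀ᵐ t ∂(volume.restrict (Set.Ioi (0 : ℝ))),
      MemLp (f t) 2 (volume.restrict (torus a)) := by
    filter_upwards [hslice] with t ht
    exact ht.re.const_mul (r t)
  have hcoef : ∀ᵐ t ∂(volume.restrict (Set.Ioi (0 : ℝ))), ∀ n, coeff a (f t) n = c n t := by
    filter_upwards [hF, hslice, hreal] with t h1 h2 h3 n
    have hi : IntegrableOn (fun x => F (t, x)) (torus a) := h2.integrable (by norm_num)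
    have hconj : IntegrableOn (fun x => (starRingEnd ℂ) (F (t, x))) (torus a) :=
      Complex.conjCLE.toContinuousLinearMap.integrable_comp hi
    have e1 : ∀ x, ((f t x : ℝ) : ℂ)
        = (r t / 2 : ℂ) * F (t, x) + (r t / 2 : ℂ) * (starRingEnd ℂ) (F (t, x)) := fun x => by
      simp only [f]
      rw [Complex.ofReal_mul, Complex.re_eq_add_conj]; ring
    have e2 : ccoeff a (fun x => (starRingEnd ℂ) (F (t, x))) n
        = (starRingEnd ℂ) (ccoeff a (fun x => F (t, x)) (-n)) := by
      simp only [ccoeff, map_mul, map_inv₀, Complex.conj_ofReal, ← integral_conj, conj_chr, neg_neg]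
    rw [coeff_eq_ccoeff]
    simp only [e1]
    rw [ccoeff_add (hi.const_mul _) (hconj.const_mul _), ccoeff_const_mul, ccoeff_const_mul, e2,
      h1, h1]
    simp only [b]
    rw [h3 n, map_mul, Complex.conj_conj, Complex.conj_ofReal]
    push_cast
    have : (r t : ℂ) ≠ 0 := Complex.ofReal_ne_zero.2 (hr t).ne'
    field_simp
    ring
  refine ⟨f, fun T => ?_, hcoef⟩
  have hrT : AEStronglyMeasurable r (volume.restrict (Set.Icc 0 T)) :=
    aestronglyMeasurable_Icc_of_Ioi hrm T
  rw [restrict_prod_torus]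
  have hfm : AEStronglyMeasurable (fun q : ℝ × (Fin 3 → ℝ) => f q.1 q.2)
      ((volume.restrict (Set.Icc 0 T)).prod (volume.restrict (torus a))) :=
    (hrT.comp_fst).mul (Complex.continuous_re.comp_stronglyMeasurable hFm).aestronglyMeasurable
  refine (memLp_two_iff_integrable_sq hfm).2 ?_
  have hfm2 : AEStronglyMeasurable (fun q : ℝ × (Fin 3 → ℝ) => f q.1 q.2 ^ 2)
      ((volume.restrict (Set.Icc 0 T)).prod (volume.restrict (torus a))) := hfm.pow 2
  rw [integrable_prod_iff hfm2]
  constructor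
  · filter_upwards [Icc_ae_of_Ioi hfs T] with t ht
    exact ht.integrable_sq
  · refine Integrable.mono' ((hG T).const_mul (torusVol a)) hfm2.norm.integral_prod_right' ?_
    filter_upwards [Icc_ae_of_Ioi hfs T, Icc_ae_of_Ioi hcoef T, Icc_ae_of_Ioi hcG T] with t h1 h2 h3
    have h4 := hasSum_norm_sq_coeff ha h1
    simp only [h2] at h4
    have h5 := h4.tsum_eq ▸ h3.2
    have hv := torusVol_pos ha
    rw [inv_mul_le_iff₀ hv] at h5
    rw [Real.norm_of_nonneg (by positivity)]
    refine le_trans (le_of_eq ?_) h5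
    congr 1; funext x
    simp

/-- A square summable family is the family of Fourier coefficients of a square integrable function. -/
theorem exists_function (ha : ∀ i, 0 < a i) {c : (Fin 3 → ℤ) → ℂ}
    (hreal : ∀ n, c (-n) = (starRingEnd ℂ) (c n)) (hs : Summable fun n => ‖c n‖ ^ 2) :
    ∃ f : (Fin 3 → ℝ) → ℝ, MemLp f 2 (volume.restrict (torus a)) ∧ ∀ n, coeff a f n = c n := by
  -- Coefficients constant in time; any one of the almost all good time slices is the required
  -- function.
  obtain ⟨f, hf, h⟩ := exists_field ha (c := fun n _ => c n) (G := fun _ => ∑' n, ‖c n‖ ^ 2)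
    (fun n => aestronglyMeasurable_const) (Filter.Eventually.of_forall fun _ => hreal)
    (fun T => integrableOn_const (by simp)) (Filter.Eventually.of_forall fun _ => ⟨hs, le_rfl⟩)
  have : (ae ((volume : Measure ℝ).restrict (Set.Ioi 0))).NeBot := by
    rw [ae_neBot, Ne, Measure.restrict_eq_zero]; simp
  obtain ⟨t, h1, h2⟩ := (hf.slice.and h).exists
  exact ⟨f t, h1, h2⟩

end StratifiedLimit
end

open scoped ContDiff

noncomputable section

namespace StratifiedLimit

open MeasureTheory

variable {a : Fin 3 → ℝ}

/-! ### Algebra of the modes -/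

lemma wave_eq_zero_iff (ha : ∀ i, 0 < a i) (n : Fin 3 → ℤ) (i : Fin 3) :
    wave a n i = 0 ↔ n i = 0 := by
  simp [wave, (ha i).ne']

lemma hLen_wave_pos (ha : ∀ i, 0 < a i) {n : Fin 3 → ℤ} (hn : ¬(n 0 = 0 ∧ n 1 = 0)) :
    0 < hLen (wave a n) := by
  refine Real.sqrt_pos.2 ?_
  rcases not_and_or.1 hn with h | h
  · have := (wave_eq_zero_iff ha n 0).not.2 h; positivity
  · have := (wave_eq_zero_iff ha n 1).not.2 h; positivity

lemma len_wave_pos (ha : ∀ i, 0 < a i) {n : Fin 3 → ℤ} (hn : ¬(n 0 = 0 ∧ n 1 = 0)) :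
    0 < len (wave a n) := by
  have h := hLen_wave_pos ha hn
  refine Real.sqrt_pos.2 ?_
  have h2 := hLen_sq (wave a n)
  nlinarith [sq_nonneg (wave a n 2), pow_pos h 2]

lemma hLen_wave_eq_zero {n : Fin 3 → ℤ} (hn : n 0 = 0 ∧ n 1 = 0) : hLen (wave a n) = 0 := by
  simp [hLen, wave, hn.1, hn.2]

lemma omega_zero (n : Fin 3 → ℤ) : omega a n 0 = 0 := by simp [omega]

lemma sign_cast_ne_zero {σ : SignType} (hσ : σ ≠ 0) : ((σ : ℝ)) ≠ 0 := by
  cases σ <;> simp_all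

lemma sign_cast_sq {σ : SignType} (hσ : σ ≠ 0) : ((σ : ℝ)) ^ 2 = 1 := by
  cases σ <;> simp_all

lemma omega_ne_zero (ha : ∀ i, 0 < a i) {n : Fin 3 → ℤ} (hn : ¬(n 0 = 0 ∧ n 1 = 0))
    {σ : SignType} (hσ : σ ≠ 0) : omega a n σ ≠ 0 :=
  mul_ne_zero (sign_cast_ne_zero hσ) (div_pos (hLen_wave_pos ha hn) (len_wave_pos ha hn)).ne'

lemma sum_sign {M : Type*} [AddCommMonoid M] (f : SignType → M) :
    ∑ σ, f σ = f 0 + (f 1 + f (-1)) := by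
  have : (Finset.univ : Finset SignType) = {0, 1, -1} := by decide
  rw [this, Finset.sum_insert (by decide), Finset.sum_insert (by decide), Finset.sum_singleton]

/-! #### The projections -/

lemma modeProj_add (n : Fin 3 → ℤ) (σ : SignType) (v w : Fin 4 → ℂ) :
    modeProj a n σ (v + w) = modeProj a n σ v + modeProj a n σ w := by
  unfold modeProj
  split_ifs
  · ext j; fin_cases j <;> simp
  · simp
  · simp only [Pi.add_apply, add_mul, Finset.sum_add_distrib, add_smul]

lemma modeProj_smul (n : Fin 3 → ℤ) (σ : SignType) (c : ℂ) (v : Fin 4 → ℂ) :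
    modeProj a n σ (c • v) = c • modeProj a n σ v := by
  unfold modeProj
  split_ifs
  · ext j; fin_cases j <;> simp
  · simp
  · simp only [Pi.smul_apply, smul_eq_mul, mul_assoc, ← Finset.mul_sum, smul_smul]

/-- The projection on a mode as a continuous linear map. -/
def modeProjL (a : Fin 3 → ℝ) (n : Fin 3 → ℤ) (σ : SignType) : (Fin 4 → ℂ) →L[ℂ] (Fin 4 → ℂ) :=
  LinearMap.toContinuousLinearMap
    { toFun := modeProj a n σ, map_add' := modeProj_add n σ, map_smul' := modeProj_smul n σ }

lemma modeProjL_apply (n : Fin 3 → ℤ) (σ : SignType) (v : Fin 4 → ℂ) :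
    modeProjL a n σ v = modeProj a n σ v := rfl

lemma modeProj_zero (n : Fin 3 → ℤ) (σ : SignType) : modeProj a n σ 0 = 0 :=
  (modeProjL a n σ).map_zero

lemma modeProj_sub (n : Fin 3 → ℤ) (σ : SignType) (v w : Fin 4 → ℂ) :
    modeProj a n σ (v - w) = modeProj a n σ v - modeProj a n σ w :=
  (modeProjL a n σ).map_sub v w

lemma modeProj_of_ne_zero {n : Fin 3 → ℤ} (hn : n 0 = 0 ∧ n 1 = 0) {σ : SignType} (hσ : σ ≠ 0)
    (v : Fin 4 → ℂ) : modeProj a n σ v = 0 := by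
  simp [modeProj, hn, hσ]

lemma modeProj_of_hzero {n : Fin 3 → ℤ} (hn : n 0 = 0 ∧ n 1 = 0) (h2 : n 2 ≠ 0)
    (v : Fin 4 → ℂ) : modeProj a n 0 v = ![v 0, v 1, 0, v 3] := by
  simp [modeProj, hn, h2]

lemma modeProj_of_zero (σ : SignType) (v : Fin 4 → ℂ) : modeProj a 0 σ v = 0 := by
  simp [modeProj]

lemma modeProj_eq {n : Fin 3 → ℤ} (hn : ¬(n 0 = 0 ∧ n 1 = 0)) (σ : SignType) (v : Fin 4 → ℂ) :
    modeProj a n σ v = (∑ j, v j * (starRingEnd ℂ) (eigvec a n σ j)) • eigvec a n σ := by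
  rw [modeProj, if_neg hn]

/-- The real polarisation vector of the oscillating modes. -/
def polar (ξ : Fin 3 → ℝ) : Fin 3 → ℝ :=
  ![ξ 0 * ξ 2 / (hLen ξ * len ξ), ξ 1 * ξ 2 / (hLen ξ * len ξ), -(hLen ξ / len ξ)]

lemma eigvec_osc (n : Fin 3 → ℤ) {σ : SignType} (hσ : σ ≠ 0) :
    eigvec a n σ = fun j => (1 / (Real.sqrt 2 : ℂ)) *
      ![((σ : ℝ) : ℂ) * Complex.I * (polar (wave a n) 0 : ℂ),
        ((σ : ℝ) : ℂ) * Complex.I * (polar (wave a n) 1 : ℂ),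
        ((σ : ℝ) : ℂ) * Complex.I * (polar (wave a n) 2 : ℂ), 1] j := by
  simp only [eigvec, if_neg hσ, polar]
  ext j
  fin_cases j <;> simp

lemma eigvec_zero (n : Fin 3 → ℤ) :
    eigvec a n 0 = ![((-wave a n 1 / hLen (wave a n) : ℝ) : ℂ),
      ((wave a n 0 / hLen (wave a n) : ℝ) : ℂ), 0, 0] := by
  simp only [eigvec, if_true]
  ext j
  fin_cases j <;> simp

lemma inv_sqrt_two_sq : (1 / (Real.sqrt 2 : ℂ)) * (1 / (Real.sqrt 2 : ℂ)) = 1 / 2 := by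
  have : (Real.sqrt 2 : ℂ) * (Real.sqrt 2 : ℂ) = 2 := by
    rw [← Complex.ofReal_mul, Real.mul_self_sqrt (by norm_num)]; norm_num
  field_simp
  rw [sq, this]

lemma conj_inv_sqrt_two : (starRingEnd ℂ) (1 / (Real.sqrt 2 : ℂ)) = 1 / (Real.sqrt 2 : ℂ) := by
  rw [map_div₀, map_one, Complex.conj_ofReal]

/-- The projection on an oscillating mode. -/
lemma modeProj_osc {n : Fin 3 → ℤ} (hn : ¬(n 0 = 0 ∧ n 1 = 0)) {σ : SignType} (hσ : σ ≠ 0)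
    (v : Fin 4 → ℂ) :
    let P := polar (wave a n)
    let s : ℂ := ((σ : ℝ) : ℂ)
    let w : ℂ := v 0 * P 0 + v 1 * P 1 + v 2 * P 2
    modeProj a n σ v = ((v 3 - s * Complex.I * w) / 2) •
      ![s * Complex.I * P 0, s * Complex.I * P 1, s * Complex.I * P 2, 1] := by
  intro P s w
  rw [modeProj_eq hn, eigvec_osc n hσ]
  simp only [map_mul, conj_inv_sqrt_two, Fin.sum_univ_four, Matrix.cons_val_zero,
    Matrix.cons_val_one, Matrix.cons_val, Complex.conj_ofReal, Complex.conj_I, map_one]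
  ext j
  simp only [Pi.smul_apply, smul_eq_mul]
  have h := inv_sqrt_two_sq
  set c := (1 / (Real.sqrt 2 : ℂ))
  simp only [w, P, s]
  linear_combination (v 3 - ((σ : ℝ) : ℂ) * Complex.I * (v 0 * polar (wave a n) 0 + v 1 * polar (wave a n) 1 + v 2 * polar (wave a n) 2)) * (![((σ : ℝ) : ℂ) * Complex.I * (polar (wave a n) 0 : ℂ),
        ((σ : ℝ) : ℂ) * Complex.I * (polar (wave a n) 1 : ℂ),
        ((σ : ℝ) : ℂ) * Complex.I * (polar (wave a n) 2 : ℂ), 1] j) * h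

/-- The projection on the kernel mode. -/
lemma modeProj_ker (ha : ∀ i, 0 < a i) {n : Fin 3 → ℤ} (hn : ¬(n 0 = 0 ∧ n 1 = 0))
    (v : Fin 4 → ℂ) :
    modeProj a n 0 v = ((-(wave a n 1 : ℂ) * v 0 + wave a n 0 * v 1) / (hLen (wave a n) : ℂ) ^ 2) •
      ![-(wave a n 1 : ℂ), (wave a n 0 : ℂ), 0, 0] := by
  rw [modeProj_eq hn, eigvec_zero]
  have hh : (hLen (wave a n) : ℂ) ≠ 0 := Complex.ofReal_ne_zero.2 (hLen_wave_pos ha hn).ne'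
  ext j
  fin_cases j
  · simp [Fin.sum_univ_four]; field_simp
  · simp [Fin.sum_univ_four]; field_simp
  · simp
  · simp

lemma polar_sq (ha : ∀ i, 0 < a i) {n : Fin 3 → ℤ} (hn : ¬(n 0 = 0 ∧ n 1 = 0)) :
    polar (wave a n) 0 ^ 2 + polar (wave a n) 1 ^ 2 + polar (wave a n) 2 ^ 2 = 1 := by
  have hh := hLen_wave_pos ha hn
  have hl := len_wave_pos ha hn
  have h1 := hLen_sq (wave a n)
  have h2 := len_sq (wave a n)
  simp only [polar, Matrix.cons_val_zero, Matrix.cons_val_one, Matrix.cons_val]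
  field_simp
  rw [h2]
  linear_combination (-wave a n 2 ^ 2 + hLen (wave a n) ^ 2) * h1

lemma polar_perp (ha : ∀ i, 0 < a i) {n : Fin 3 → ℤ} (hn : ¬(n 0 = 0 ∧ n 1 = 0)) :
    wave a n 0 * polar (wave a n) 0 + wave a n 1 * polar (wave a n) 1
      + wave a n 2 * polar (wave a n) 2 = 0 := by
  have hh := hLen_wave_pos ha hn
  have hl := len_wave_pos ha hn
  have h1 := hLen_sq (wave a n)
  simp only [polar, Matrix.cons_val_zero, Matrix.cons_val_one, Matrix.cons_val]
  field_simp
  linear_combination (-wave a n 2) * h1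

lemma polar_hperp (n : Fin 3 → ℤ) :
    -(wave a n 1) * polar (wave a n) 0 + wave a n 0 * polar (wave a n) 1 = 0 := by
  simp only [polar, Matrix.cons_val_zero, Matrix.cons_val_one]
  ring

/-- Orthonormality of the eigenvectors for `n_h ≠ 0`: `polar` is a unit vector whose horizontal part
is parallel to `ň_h`, hence orthogonal to `e⁰`, and the inner product of the modes `σ, τ ≠ 0` is `(1
+ στ)/2` up to order. For `n_h = 0` it follows from the conventions in `modeProj`. -/
lemma modeProj_modeProj (ha : ∀ i, 0 < a i) (n : Fin 3 → ℤ) (σ τ : SignType) (v : Fin 4 → ℂ) :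
    modeProj a n σ (modeProj a n τ v) = if σ = τ then modeProj a n σ v else 0 := by
  by_cases hn : n 0 = 0 ∧ n 1 = 0
  · by_cases hσ : σ = 0
    · by_cases hτ : τ = 0
      · subst hσ hτ
        by_cases h2 : n 2 = 0
        · simp [modeProj, h2, hn]
        · simp [modeProj_of_hzero hn h2]
      · rw [modeProj_of_ne_zero hn hτ, modeProj_zero, if_neg (by rintro rfl; exact hτ hσ)]
    · simp [modeProj_of_ne_zero hn hσ]
  · have hp : ((polar (wave a n) 0 : ℂ)) ^ 2 + (polar (wave a n) 1 : ℂ) ^ 2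
        + (polar (wave a n) 2 : ℂ) ^ 2 = 1 := by exact_mod_cast polar_sq ha hn
    have hq : -(wave a n 1 : ℂ) * polar (wave a n) 0 + wave a n 0 * polar (wave a n) 1 = 0 := by
      exact_mod_cast polar_hperp n
    have hh : (hLen (wave a n) : ℂ) ≠ 0 := Complex.ofReal_ne_zero.2 (hLen_wave_pos ha hn).ne'
    have hh2 : (hLen (wave a n) : ℂ) ^ 2 = (wave a n 0 : ℂ) ^ 2 + (wave a n 1 : ℂ) ^ 2 := by
      exact_mod_cast hLen_sq (wave a n)
    by_cases hτ : τ = 0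
    · subst hτ
      rw [modeProj_ker ha hn v, modeProj_smul]
      by_cases hσ : σ = 0
      · subst hσ
        rw [modeProj_ker ha hn, if_pos rfl, modeProj_ker ha hn]
        have : (-(wave a n 1 : ℂ) * -(wave a n 1 : ℂ) + wave a n 0 * wave a n 0)
            / (hLen (wave a n) : ℂ) ^ 2 = 1 := by
          rw [div_eq_one_iff_eq (pow_ne_zero 2 hh), hh2]; ring
        simp only [Matrix.cons_val_zero, Matrix.cons_val_one, this, one_smul]
      · rw [if_neg hσ, modeProj_osc hn hσ]
        have : -(wave a n 1 : ℂ) * polar (wave a n) 0 + wave a n 0 * polar (wave a n) 1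
            + 0 * polar (wave a n) 2 = 0 := by rw [hq]; ring
        simp only [Matrix.cons_val_zero, Matrix.cons_val_one, Matrix.cons_val]
        rw [this]
        simp
    · rw [modeProj_osc hn hτ v, modeProj_smul]
      by_cases hσ : σ = 0
      · subst hσ
        rw [if_neg (Ne.symm hτ), modeProj_ker ha hn]
        simp only [Matrix.cons_val_zero, Matrix.cons_val_one]
        have : -(wave a n 1 : ℂ) * (((τ : ℝ) : ℂ) * Complex.I * polar (wave a n) 0)
            + wave a n 0 * (((τ : ℝ) : ℂ) * Complex.I * polar (wave a n) 1) = 0 := by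
          linear_combination ((τ : ℝ) : ℂ) * Complex.I * hq
        rw [this]; simp
      · rw [modeProj_osc hn hσ]
        simp only [Matrix.cons_val_zero, Matrix.cons_val_one, Matrix.cons_val]
        have h1 : (1 - ((σ : ℝ) : ℂ) * Complex.I *
            (((τ : ℝ) : ℂ) * Complex.I * polar (wave a n) 0 * polar (wave a n) 0
            + ((τ : ℝ) : ℂ) * Complex.I * polar (wave a n) 1 * polar (wave a n) 1
            + ((τ : ℝ) : ℂ) * Complex.I * polar (wave a n) 2 * polar (wave a n) 2)) / 2
            = (1 + ((σ : ℝ) : ℂ) * ((τ : ℝ) : ℂ)) / 2 := by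
          linear_combination (((σ : ℝ) : ℂ) * ((τ : ℝ) : ℂ)) / 2 * hp - ((σ : ℝ) : ℂ) * ((τ : ℝ) : ℂ) / 2 *
            ((polar (wave a n) 0 : ℂ) ^ 2 + (polar (wave a n) 1 : ℂ) ^ 2
            + (polar (wave a n) 2 : ℂ) ^ 2) * Complex.I_sq
        rw [h1]
        by_cases hst : σ = τ
        · subst hst
          have h2 : ((σ : ℝ) : ℂ) * ((σ : ℝ) : ℂ) = 1 := by
            have := sign_cast_sq hσ; rw [sq] at this; exact_mod_cast this
          rw [if_pos rfl, modeProj_osc hn hσ, h2]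
          norm_num
        · have h2 : ((σ : ℝ) : ℂ) * ((τ : ℝ) : ℂ) = -1 := by
            cases σ <;> cases τ <;> simp_all
          rw [if_neg hst, h2]
          norm_num

/-- Every mode is orthogonal to `ň`. This is what allows the derivative in an advection term to be
moved from the input to the output frequency. -/
lemma modeProj_divFree (ha : ∀ i, 0 < a i) (n : Fin 3 → ℤ) (σ : SignType) (v : Fin 4 → ℂ) :
    ∑ j : Fin 3, modeProj a n σ v j.castSucc * (wave a n j : ℂ) = 0 := by
  rw [Fin.sum_univ_three]
  change modeProj a n σ v 0 * (wave a n 0 : ℂ) + modeProj a n σ v 1 * (wave a n 1 : ℂ)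
    + modeProj a n σ v 2 * (wave a n 2 : ℂ) = 0
  by_cases hn : n 0 = 0 ∧ n 1 = 0
  · have h0 : wave a n 0 = 0 := (wave_eq_zero_iff ha n 0).2 hn.1
    have h1 : wave a n 1 = 0 := (wave_eq_zero_iff ha n 1).2 hn.2
    rw [h0, h1, modeProj, if_pos hn]
    split_ifs <;> simp
  · by_cases hσ : σ = 0
    · subst hσ
      rw [modeProj_ker ha hn]
      simp only [Pi.smul_apply, Matrix.cons_val_zero, Matrix.cons_val_one, Matrix.cons_val, smul_eq_mul]
      ring
    · rw [modeProj_osc hn hσ]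
      have hp : (wave a n 0 : ℂ) * polar (wave a n) 0 + wave a n 1 * polar (wave a n) 1
          + wave a n 2 * polar (wave a n) 2 = 0 := by exact_mod_cast polar_perp ha hn
      simp only [Pi.smul_apply, Matrix.cons_val_zero, Matrix.cons_val_one, Matrix.cons_val, smul_eq_mul]
      linear_combination (v 3 - ((σ : ℝ) : ℂ) * Complex.I * (v 0 * polar (wave a n) 0
        + v 1 * polar (wave a n) 1 + v 2 * polar (wave a n) 2)) / 2 * ((σ : ℝ) : ℂ) * Complex.I * hp

/-- The modes span the divergence free vectors. -/
lemma sum_modeProj (ha : ∀ i, 0 < a i) {n : Fin 3 → ℤ} (hn0 : n ≠ 0) {v : Fin 4 → ℂ}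
    (hv : ∑ j : Fin 3, (wave a n j : ℂ) * v j.castSucc = 0) :
    modeProj a n 0 v + (modeProj a n 1 v + modeProj a n (-1) v) = v := by
  rw [Fin.sum_univ_three] at hv
  change (wave a n 0 : ℂ) * v 0 + wave a n 1 * v 1 + wave a n 2 * v 2 = 0 at hv
  by_cases hn : n 0 = 0 ∧ n 1 = 0
  · have h2 : n 2 ≠ 0 := fun h => hn0 (by
      funext i; fin_cases i
      exacts [hn.1, hn.2, h])
    rw [(wave_eq_zero_iff ha n 0).2 hn.1, (wave_eq_zero_iff ha n 1).2 hn.2] at hv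
    have hw : (wave a n 2 : ℂ) ≠ 0 :=
      Complex.ofReal_ne_zero.2 ((wave_eq_zero_iff ha n 2).not.2 h2)
    have hv2 : v 2 = 0 := by
      simpa [hw] using hv
    rw [modeProj_of_hzero hn h2, modeProj_of_ne_zero hn (by decide),
      modeProj_of_ne_zero hn (by decide)]
    ext j
    fin_cases j <;> simp [hv2]
  · have hh : (hLen (wave a n) : ℂ) ≠ 0 := Complex.ofReal_ne_zero.2 (hLen_wave_pos ha hn).ne'
    have hl : (len (wave a n) : ℂ) ≠ 0 := Complex.ofReal_ne_zero.2 (len_wave_pos ha hn).ne'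
    have hh2 : (hLen (wave a n) : ℂ) ^ 2 = (wave a n 0 : ℂ) ^ 2 + (wave a n 1 : ℂ) ^ 2 := by
      exact_mod_cast hLen_sq (wave a n)
    have hl2 : (len (wave a n) : ℂ) ^ 2 = (wave a n 0 : ℂ) ^ 2 + (wave a n 1 : ℂ) ^ 2
        + (wave a n 2 : ℂ) ^ 2 := by
      exact_mod_cast len_sq (wave a n)
    rw [modeProj_ker ha hn, modeProj_osc hn (by decide), modeProj_osc hn (by decide)]
    set P := polar (wave a n) with hP
    -- The divergence condition determines the component of `v` along `polar` from `v 2` alone.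
    have hw : v 0 * P 0 + v 1 * P 1 + v 2 * P 2
        = -(len (wave a n) / hLen (wave a n) : ℂ) * v 2 := by
      simp only [hP, polar, Matrix.cons_val_zero, Matrix.cons_val_one, Matrix.cons_val]
      push_cast
      field_simp
      linear_combination (wave a n 2 : ℂ) * hv + v 2 * hl2 - v 2 * hh2
    rw [hw]
    have hI := Complex.I_sq
    ext j
    fin_cases j
    · simp
      simp only [hP, polar, Matrix.cons_val_zero]
      push_cast
      field_simp
      linear_combination 2 * wave a n 0 * wave a n 2 * len (wave a n) * v 2 * hI
        - 2 * v 0 * len (wave a n) * hh2 - 2 * len (wave a n) * wave a n 0 * hv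
    · simp
      simp only [hP, polar, Matrix.cons_val_one]
      push_cast
      field_simp
      linear_combination 2 * wave a n 1 * wave a n 2 * len (wave a n) * v 2 * hI
        - 2 * v 1 * len (wave a n) * hh2 - 2 * len (wave a n) * wave a n 1 * hv
    · simp
      simp only [hP, polar, Matrix.cons_val]
      push_cast
      field_simp
      linear_combination -2 * len (wave a n) * v 2 * hI
    · simp
      ring

lemma norm_eigvec_le (ha : ∀ i, 0 < a i) {n : Fin 3 → ℤ} (hn : ¬(n 0 = 0 ∧ n 1 = 0))
    (σ : SignType) (j : Fin 4) : ‖eigvec a n σ j‖ ≤ 1 := by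
  have hh := hLen_wave_pos ha hn
  have h1 := hLen_sq (wave a n)
  by_cases hσ : σ = 0
  · subst hσ
    rw [eigvec_zero]
    have hb : ∀ x : ℝ, x ^ 2 ≤ hLen (wave a n) ^ 2 → ‖((x / hLen (wave a n) : ℝ) : ℂ)‖ ≤ 1 := by
      intro x hx
      rw [Complex.norm_real, Real.norm_eq_abs, abs_div, abs_of_pos hh, div_le_one hh]
      exact abs_le_of_sq_le_sq hx hh.le
    fin_cases j
    · exact hb _ (by nlinarith [sq_nonneg (wave a n 0)])
    · exact hb _ (by nlinarith [sq_nonneg (wave a n 1)])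
    · simp
    · simp
  · have hp := polar_sq ha hn
    have hc : ‖(1 / (Real.sqrt 2 : ℂ))‖ ≤ 1 := by
      rw [norm_div, norm_one, Complex.norm_real, Real.norm_of_nonneg (by positivity)]
      rw [div_le_one (by positivity)]
      exact Real.one_le_sqrt.2 (by norm_num)
    have hs : |(σ : ℝ)| = 1 := by
      rw [← sq_eq_sq₀ (abs_nonneg _) zero_le_one, sq_abs,
        sign_cast_sq hσ, one_pow]
    have hb : ∀ i, ‖(polar (wave a n) i : ℂ)‖ ≤ 1 := by
      intro i
      rw [Complex.norm_real, Real.norm_eq_abs, ← sq_le_one_iff_abs_le_one]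
      fin_cases i <;> simp only [Fin.zero_eta, Fin.mk_one, Fin.reduceFinMk] <;>
        nlinarith [sq_nonneg (polar (wave a n) 0), sq_nonneg (polar (wave a n) 1),
          sq_nonneg (polar (wave a n) 2)]
    rw [eigvec_osc n hσ, norm_mul]
    refine mul_le_one₀ hc (norm_nonneg _) ?_
    fin_cases j
    · simpa [hs] using hb 0
    · simpa [hs] using hb 1
    · simpa [hs] using hb 2
    · simp

/-- The constant `4` counts the terms of the inner product, since vectors carry the sup norm; only
uniformity in `n` matters. -/
lemma norm_modeProj_le (ha : ∀ i, 0 < a i) (n : Fin 3 → ℤ) (σ : SignType) (v : Fin 4 → ℂ) :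
    ‖modeProj a n σ v‖ ≤ 4 * ‖v‖ := by
  have hv := norm_nonneg v
  by_cases hn : n 0 = 0 ∧ n 1 = 0
  · rw [modeProj, if_pos hn]
    split_ifs
    · refine (pi_norm_le_iff_of_nonneg (by positivity)).2 fun j => ?_
      have := norm_le_pi_norm v
      fin_cases j <;> simp <;> linarith [this 0, this 1, this 3]
    · simp
  · rw [modeProj_eq hn, norm_smul]
    have h1 : ‖eigvec a n σ‖ ≤ 1 :=
      (pi_norm_le_iff_of_nonneg zero_le_one).2 (norm_eigvec_le ha hn σ)
    have h2 : ‖∑ j, v j * (starRingEnd ℂ) (eigvec a n σ j)‖ ≤ ∑ _j : Fin 4, ‖v‖ := by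
      refine norm_sum_le_of_le _ fun j _ => ?_
      rw [norm_mul, RCLike.norm_conj]
      exact (mul_le_of_le_one_right (norm_nonneg _) (norm_eigvec_le ha hn σ j)).trans
        (norm_le_pi_norm v j)
    have h3 : ∑ _j : Fin 4, ‖v‖ = 4 * ‖v‖ := by simp
    rw [h3] at h2
    calc _ ≤ 4 * ‖v‖ * 1 := mul_le_mul h2 h1 (norm_nonneg _) (by positivity)
      _ = _ := mul_one _

end StratifiedLimit
end

open scoped ContDiff

noncomputable section

namespace StratifiedLimit

open MeasureTheory

variable {a : Fin 3 → ℝ}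

/-! ### Triads -/

/-- The advection term `(v · i η) w`. -/
def adv (v : Fin 4 → ℂ) (η : Fin 3 → ℝ) (w : Fin 4 → ℂ) : Fin 4 → ℂ :=
  (∑ j : Fin 3, v j.castSucc * (Complex.I * (η j : ℂ))) • w

lemma adv_zero_left (η : Fin 3 → ℝ) (w : Fin 4 → ℂ) : adv 0 η w = 0 := by simp [adv]

lemma adv_zero_right (v : Fin 4 → ℂ) (η : Fin 3 → ℝ) : adv v η 0 = 0 := by simp [adv]

open Classical in
/-- The contribution of one triad to the resonant transport. -/
def triad (a : Fin 3 → ℝ) (A B : (Fin 3 → ℤ) → (Fin 4 → ℂ)) (n : Fin 3 → ℤ) (α β γ : SignType)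
    (k : Fin 3 → ℤ) : Fin 4 → ℂ :=
  if omega a k α + omega a (n - k) β = omega a n γ then
    modeProj a n γ (adv (modeProj a k α (A k)) (wave a (n - k)) (modeProj a (n - k) β (B (n - k))))
  else 0

lemma resonantTransport_eq (A B : (Fin 3 → ℤ) → (Fin 4 → ℂ)) (n : Fin 3 → ℤ) :
    resonantTransport a A B n = ∑ α, ∑ β, ∑ γ, ∑' k, triad a A B n α β γ k := rfl

lemma abs_wave_le_wt (n : Fin 3 → ℤ) (i : Fin 3) : |wave a n i| ≤ wt a n := by
  have h : |wave a n i| ^ 2 ≤ len (wave a n) ^ 2 := by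
    rw [len_sq, sq_abs]
    fin_cases i <;> simp only [Fin.zero_eta, Fin.mk_one, Fin.reduceFinMk] <;>
      nlinarith [sq_nonneg (wave a n 0), sq_nonneg (wave a n 1), sq_nonneg (wave a n 2)]
  unfold wt
  nlinarith [sq_nonneg (|wave a n i| - 1)]

/-- The advecting mode is orthogonal to `ǩ`, so the wave vector of the second input may be replaced
by `ň`. The derivative then costs only a power of the output frequency, which test functions absorb,
and no regularity of `A` or `B` is needed. The constant is `4 · 3 · 4 · 4`: three projection bounds
and three components. -/
lemma norm_triad_le (ha : ∀ i, 0 < a i) (A B : (Fin 3 → ℤ) → (Fin 4 → ℂ)) (n : Fin 3 → ℤ)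
    (α β γ : SignType) (k : Fin 3 → ℤ) :
    ‖triad a A B n α β γ k‖ ≤ 192 * wt a n * (‖A k‖ * ‖B (n - k)‖) := by
  have hw := wt_pos (a := a) n
  rw [triad]
  split_ifs
  · refine (norm_modeProj_le ha _ _ _).trans ?_
    rw [adv, norm_smul]
    have h1 : ∑ j : Fin 3, modeProj a k α (A k) j.castSucc * (Complex.I * (wave a (n - k) j : ℂ))
        = ∑ j : Fin 3, modeProj a k α (A k) j.castSucc * (Complex.I * (wave a n j : ℂ)) := by
      have h := modeProj_divFree ha k α (A k)
      rw [← sub_eq_zero, ← Finset.sum_sub_distrib]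
      rw [← mul_zero (-Complex.I), ← h, Finset.mul_sum]
      refine Finset.sum_congr rfl fun j _ => ?_
      rw [wave_sub]; push_cast; ring
    have h2 : ‖∑ j : Fin 3, modeProj a k α (A k) j.castSucc * (Complex.I * (wave a n j : ℂ))‖
        ≤ ∑ _j : Fin 3, (4 * ‖A k‖) * wt a n := by
      refine norm_sum_le_of_le _ fun j _ => ?_
      rw [norm_mul, norm_mul, Complex.norm_I, one_mul, Complex.norm_real, Real.norm_eq_abs]
      exact mul_le_mul ((norm_le_pi_norm _ _).trans (norm_modeProj_le ha _ _ _))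
        (abs_wave_le_wt n j) (abs_nonneg _) (by positivity)
    simp only [Finset.sum_const, Finset.card_univ, Fintype.card_fin, nsmul_eq_mul] at h2
    rw [h1]
    calc _ ≤ 4 * (((3 : ℕ) * ((4 * ‖A k‖) * wt a n)) * (4 * ‖B (n - k)‖)) := by
          gcongr
          exact norm_modeProj_le ha _ _ _
      _ = _ := by push_cast; ring
  · rw [norm_zero]; positivity

/-- `xy ≤ x² + y²` summed over `k`; the resulting bound is uniform in `n`. -/
lemma summable_conv {f g : (Fin 3 → ℤ) → ℝ} (hf : ∀ k, 0 ≤ f k) (hg : ∀ k, 0 ≤ g k)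
    (hf2 : Summable fun k => f k ^ 2) (hg2 : Summable fun k => g k ^ 2) (n : Fin 3 → ℤ) :
    (Summable fun k => f k * g (n - k)) ∧
      ∑' k, f k * g (n - k) ≤ ∑' k, f k ^ 2 + ∑' k, g k ^ 2 := by
  have hg3 : Summable fun k => g (n - k) ^ 2 := hg2.comp_injective (Equiv.subLeft n).injective
  have hle : ∀ k, f k * g (n - k) ≤ f k ^ 2 + g (n - k) ^ 2 := fun k => by
    nlinarith [sq_nonneg (f k - g (n - k)), sq_nonneg (f k), sq_nonneg (g (n - k))]
  have hs : Summable fun k => f k * g (n - k) :=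
    Summable.of_nonneg_of_le (fun k => mul_nonneg (hf _) (hg _)) hle (hf2.add hg3)
  refine ⟨hs, (hs.tsum_le_tsum hle (hf2.add hg3)).trans_eq ?_⟩
  rw [hf2.tsum_add hg3]
  congr 1
  exact (Equiv.subLeft n).tsum_eq (fun k => g k ^ 2)

lemma summable_triad (ha : ∀ i, 0 < a i) {A B : (Fin 3 → ℤ) → (Fin 4 → ℂ)}
    (hA : Summable fun k => ‖A k‖ ^ 2) (hB : Summable fun k => ‖B k‖ ^ 2) (n : Fin 3 → ℤ)
    (α β γ : SignType) : Summable (triad a A B n α β γ) :=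
  Summable.of_norm_bounded ((summable_conv (fun k => norm_nonneg (A k)) (fun k => norm_nonneg (B k))
    hA hB n).1.mul_left (192 * wt a n)) (norm_triad_le ha A B n α β γ)

/-- `5184 = 27 · 192`, one term for each triple of labels. -/
lemma norm_resonantTransport_le (ha : ∀ i, 0 < a i) {A B : (Fin 3 → ℤ) → (Fin 4 → ℂ)}
    (hA : Summable fun k => ‖A k‖ ^ 2) (hB : Summable fun k => ‖B k‖ ^ 2) (n : Fin 3 → ℤ) :
    ‖resonantTransport a A B n‖ ≤ wt a n * (5184 * (∑' k, ‖A k‖ ^ 2 + ∑' k, ‖B k‖ ^ 2)) := by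
  have h := summable_conv (fun k => norm_nonneg (A k)) (fun k => norm_nonneg (B k)) hA hB n
  have hw := wt_pos (a := a) n
  have h1 : ∀ α β γ, ‖∑' k, triad a A B n α β γ k‖
      ≤ 192 * wt a n * (∑' k, ‖A k‖ ^ 2 + ∑' k, ‖B k‖ ^ 2) := fun α β γ =>
    (tsum_of_norm_bounded (h.1.mul_left (192 * wt a n)).hasSum (norm_triad_le ha A B n α β γ)).trans
      (by rw [tsum_mul_left]; gcongr; exact h.2)
  rw [resonantTransport_eq]
  calc _ ≤ ∑ _α : SignType, ∑ _β : SignType, ∑ _γ : SignType,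
        192 * wt a n * (∑' k, ‖A k‖ ^ 2 + ∑' k, ‖B k‖ ^ 2) :=
        norm_sum_le_of_le _ fun α _ => norm_sum_le_of_le _ fun β _ =>
          norm_sum_le_of_le _ fun γ _ => h1 α β γ
    _ = _ := by
      simp only [Finset.sum_const, Finset.card_univ, show Fintype.card SignType = 3 from rfl,
        nsmul_eq_mul]
      push_cast
      ring

/-! #### Vanishing triads -/

/-- Resonance forces `ω^γ(n) = 0`, hence `n_h = 0`, where the oscillating projections are zero. -/
lemma triad_zero_zero (ha : ∀ i, 0 < a i) (A B : (Fin 3 → ℤ) → (Fin 4 → ℂ)) (n : Fin 3 → ℤ)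
    {γ : SignType} (hγ : γ ≠ 0) (k : Fin 3 → ℤ) : triad a A B n 0 0 γ k = 0 := by
  rw [triad]
  split_ifs with h
  · by_cases hn : n 0 = 0 ∧ n 1 = 0
    · exact modeProj_of_ne_zero hn hγ _
    · rw [omega_zero, omega_zero, add_zero] at h
      exact absurd h.symm (omega_ne_zero ha hn hγ)
  · rfl

/-- Resonance forces the oscillating input to have frequency zero, hence zero horizontal wave
vector, and there this input is absent. Together with the same statement for the other order, a
kernel mode and an oscillating mode never feed the kernel. -/
lemma triad_zero_osc_zero (ha : ∀ i, 0 < a i) (A B : (Fin 3 → ℤ) → (Fin 4 → ℂ)) (n : Fin 3 → ℤ)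
    {β : SignType} (hβ : β ≠ 0) (k : Fin 3 → ℤ) : triad a A B n 0 β 0 k = 0 := by
  rw [triad]
  split_ifs with h
  · by_cases hm : (n - k) 0 = 0 ∧ (n - k) 1 = 0
    · rw [modeProj_of_ne_zero hm hβ, adv_zero_right, modeProj_zero]
    · rw [omega_zero, omega_zero, zero_add] at h
      exact absurd h (omega_ne_zero ha hm hβ)
  · rfl

lemma triad_osc_zero_zero (ha : ∀ i, 0 < a i) (A B : (Fin 3 → ℤ) → (Fin 4 → ℂ)) (n : Fin 3 → ℤ)
    {α : SignType} (hα : α ≠ 0) (k : Fin 3 → ℤ) : triad a A B n α 0 0 k = 0 := by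
  rw [triad]
  split_ifs with h
  · by_cases hm : k 0 = 0 ∧ k 1 = 0
    · rw [modeProj_of_ne_zero hm hα, adv_zero_left, modeProj_zero]
    · rw [omega_zero, omega_zero, add_zero] at h
      exact absurd h (omega_ne_zero ha hm hα)
  · rfl

/-- When `n_h = 0` the horizontal wave vectors of the inputs are opposite, while the kernel velocity
at `k` is horizontal and orthogonal to `ǩ_h`: the advection factor is zero. Hence kernel modes do
not force the horizontal averages. -/
lemma triad_hzero (ha : ∀ i, 0 < a i) (A B : (Fin 3 → ℤ) → (Fin 4 → ℂ)) {n : Fin 3 → ℤ}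
    (hn : n 0 = 0 ∧ n 1 = 0) (k : Fin 3 → ℤ) : triad a A B n 0 0 0 k = 0 := by
  rw [triad]
  split_ifs with h
  · have hw0 : wave a (n - k) 0 = -wave a k 0 := by
      rw [wave_sub, (wave_eq_zero_iff ha n 0).2 hn.1, zero_sub]
    have hw1 : wave a (n - k) 1 = -wave a k 1 := by
      rw [wave_sub, (wave_eq_zero_iff ha n 1).2 hn.2, zero_sub]
    have hs : ∑ j : Fin 3, modeProj a k 0 (A k) j.castSucc * (Complex.I * (wave a (n - k) j : ℂ))
        = 0 := by
      rw [Fin.sum_univ_three]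
      change modeProj a k 0 (A k) 0 * (Complex.I * (wave a (n - k) 0 : ℂ))
        + modeProj a k 0 (A k) 1 * (Complex.I * (wave a (n - k) 1 : ℂ))
        + modeProj a k 0 (A k) 2 * (Complex.I * (wave a (n - k) 2 : ℂ)) = 0
      rw [hw0, hw1]
      by_cases hk : k 0 = 0 ∧ k 1 = 0
      · rw [(wave_eq_zero_iff ha k 0).2 hk.1, (wave_eq_zero_iff ha k 1).2 hk.2, modeProj, if_pos hk]
        split_ifs <;> simp
      · rw [modeProj_ker ha hk]
        simp only [Pi.smul_apply, Matrix.cons_val_zero, Matrix.cons_val_one, Matrix.cons_val,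
          smul_eq_mul]
        push_cast
        ring
    rw [adv, hs, zero_smul, modeProj_zero]
  · rfl

/-- The polarisations of two frequencies with the same ratio `|ξ_h| / |ξ|`: the sum of the two
advection terms has no component orthogonal to `ξ_h + η_h`. -/
lemma polar_cancel {ξ η : Fin 3 → ℝ} (h1 : 0 < hLen ξ) (h2 : 0 < hLen η) (l1 : 0 < len ξ)
    (l2 : 0 < len η) (hr : hLen ξ / len ξ = hLen η / len η) {p r : ℝ}
    (hp : p = polar ξ 0 * η 0 + polar ξ 1 * η 1 + polar ξ 2 * η 2)
    (hq : r = polar η 0 * ξ 0 + polar η 1 * ξ 1 + polar η 2 * ξ 2) :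
    -(ξ 1 + η 1) * (p * polar η 0 + r * polar ξ 0)
      + (ξ 0 + η 0) * (p * polar η 1 + r * polar ξ 1) = 0 := by
  have a1 := hLen_sq ξ
  have a2 := hLen_sq η
  have b1 := len_sq ξ
  have b2 := len_sq η
  have hr' : hLen ξ * len η = hLen η * len ξ := by
    rwa [div_eq_div_iff l1.ne' l2.ne'] at hr
  -- Equality of the ratios `|ξ_h|/|ξ|`, rewritten as equality of the ratios `ξ₃²/|ξ_h|²`. It is the
  -- only consequence of resonance that the cancellation uses.
  have hr2 : ξ 2 ^ 2 * hLen η ^ 2 = η 2 ^ 2 * hLen ξ ^ 2 := by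
    have : hLen ξ ^ 2 * len η ^ 2 = hLen η ^ 2 * len ξ ^ 2 := by
      rw [← mul_pow, ← mul_pow, hr']
    rw [b1, b2] at this
    rw [← a1, ← a2] at this
    linarith
  have e1 : p = (ξ 2 * (ξ 0 * η 0 + ξ 1 * η 1) - hLen ξ ^ 2 * η 2) / (hLen ξ * len ξ) := by
    simp only [hp, polar, Matrix.cons_val_zero, Matrix.cons_val_one, Matrix.cons_val]
    field_simp
    ring
  have e2 : r = (η 2 * (ξ 0 * η 0 + ξ 1 * η 1) - hLen η ^ 2 * ξ 2) / (hLen η * len η) := by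
    simp only [hq, polar, Matrix.cons_val_zero, Matrix.cons_val_one, Matrix.cons_val]
    field_simp
    ring
  rw [e1, e2]
  simp only [polar, Matrix.cons_val_zero, Matrix.cons_val_one]
  field_simp
  -- The terms containing `ξ_h · η_h` cancel between the two products; what is left is the wedge
  -- `ξ_h ∧ η_h` times the difference of the two sides of `hr2`.
  linear_combination (ξ 0 * η 1 - ξ 1 * η 0) * hr2

/-- Output frequency zero forces opposite signs and equal ratios `|ξ_h|/|ξ|` for the two inputs. If
`n_h ≠ 0` the kernel is the line of `ň_h^⊥` and `polar_cancel` applies. If `n_h = 0` and `n ≠ 0`,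
the inputs are related by `ξ_h ↦ -ξ_h` with the same `ξ₃`, and every coordinate seen by `Π⁰` cancels
explicitly. -/
lemma modeProj_cancel (ha : ∀ i, 0 < a i) {n k m : Fin 3 → ℤ} (hkm : k + m = n) {α β : SignType}
    (hα : α ≠ 0) (hβ : β ≠ 0) (hres : omega a k α + omega a m β = 0) (v w : Fin 4 → ℂ) :
    modeProj a n 0 (adv (modeProj a k α v) (wave a m) (modeProj a m β w)
      + adv (modeProj a m β w) (wave a k) (modeProj a k α v)) = 0 := by
  by_cases hk : k 0 = 0 ∧ k 1 = 0
  · rw [modeProj_of_ne_zero hk hα, adv_zero_left, adv_zero_right, add_zero, modeProj_zero]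
  by_cases hm : m 0 = 0 ∧ m 1 = 0
  · rw [modeProj_of_ne_zero hm hβ, adv_zero_left, adv_zero_right, add_zero, modeProj_zero]
  have k1 := hLen_wave_pos ha hk
  have k2 := len_wave_pos ha hk
  have m1 := hLen_wave_pos ha hm
  have m2 := len_wave_pos ha hm
  have q1 : 0 < hLen (wave a k) / len (wave a k) := div_pos k1 k2
  have q2 : 0 < hLen (wave a m) / len (wave a m) := div_pos m1 m2
  simp only [omega] at hres
  have hβα : ((β : ℝ)) = -((α : ℝ)) ∧
      hLen (wave a k) / len (wave a k) = hLen (wave a m) / len (wave a m) := by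
    clear k1 k2 m1 m2
    set x := hLen (wave a k) / len (wave a k)
    set y := hLen (wave a m) / len (wave a m)
    clear_value x y
    cases α <;> cases β <;> simp_all <;> linarith
  obtain ⟨hs, hr⟩ := hβα
  rw [modeProj_osc hk hα, modeProj_osc hm hβ, hs]
  set s : ℂ := ((α : ℝ) : ℂ)
  have hs2 : s ^ 2 = 1 := by
    change ((α : ℝ) : ℂ) ^ 2 = 1
    exact_mod_cast sign_cast_sq hα
  set c : ℂ := (v 3 - s * Complex.I * _) / 2 with hc
  set d : ℂ := (w 3 - _ * Complex.I * _) / 2 with hd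
  clear_value c d
  set P := polar (wave a k) with hP
  set R := polar (wave a m) with hR
  set ξ := wave a k with hξ
  set η := wave a m with hη
  set p : ℝ := P 0 * η 0 + P 1 * η 1 + P 2 * η 2 with hp
  set r : ℝ := R 0 * ξ 0 + R 1 * ξ 1 + R 2 * ξ 2 with hrr
  have hI := Complex.I_sq
  -- Both advection terms in closed form, with `p = P · η` and `r = R · ξ`. The fourth component
  -- matters only for `n_h = 0`, where the kernel contains the fourth coordinate.
  have key : adv (c • ![s * Complex.I * P 0, s * Complex.I * P 1, s * Complex.I * P 2, 1]) η
        (d • ![((-(α : ℝ) : ℝ) : ℂ) * Complex.I * R 0, ((-(α : ℝ) : ℝ) : ℂ) * Complex.I * R 1,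
          ((-(α : ℝ) : ℝ) : ℂ) * Complex.I * R 2, 1])
      + adv (d • ![((-(α : ℝ) : ℝ) : ℂ) * Complex.I * R 0, ((-(α : ℝ) : ℝ) : ℂ) * Complex.I * R 1,
          ((-(α : ℝ) : ℝ) : ℂ) * Complex.I * R 2, 1]) ξ
        (c • ![s * Complex.I * P 0, s * Complex.I * P 1, s * Complex.I * P 2, 1])
      = (c * d) • ![Complex.I * (p * R 0 + r * P 0), Complex.I * (p * R 1 + r * P 1),
          Complex.I * (p * R 2 + r * P 2), -s * (p - r)] := by
    have e0 : ∀ X : ℂ, ![s * Complex.I * (P 0 : ℂ), s * Complex.I * P 1, s * Complex.I * P 2, X] 2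
        = s * Complex.I * P 2 := fun X => rfl
    have e1 : ∑ j : Fin 3, (c • ![s * Complex.I * (P 0 : ℂ), s * Complex.I * P 1,
        s * Complex.I * P 2, 1]) j.castSucc * (Complex.I * (η j : ℂ)) = -(c * s * p) := by
      rw [Fin.sum_univ_three]
      change c * (s * Complex.I * (P 0 : ℂ)) * (Complex.I * (η 0 : ℂ))
        + c * (s * Complex.I * (P 1 : ℂ)) * (Complex.I * (η 1 : ℂ))
        + c * (s * Complex.I * (P 2 : ℂ)) * (Complex.I * (η 2 : ℂ)) = _
      rw [hp]; push_cast
      linear_combination c * s * (P 0 * η 0 + P 1 * η 1 + P 2 * η 2) * hI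
    have e2 : ∑ j : Fin 3, (d • ![((-(α : ℝ) : ℝ) : ℂ) * Complex.I * (R 0 : ℂ),
        ((-(α : ℝ) : ℝ) : ℂ) * Complex.I * R 1,
        ((-(α : ℝ) : ℝ) : ℂ) * Complex.I * R 2, 1]) j.castSucc * (Complex.I * (ξ j : ℂ))
        = d * s * r := by
      rw [Fin.sum_univ_three]
      change d * (((-(α : ℝ) : ℝ) : ℂ) * Complex.I * (R 0 : ℂ)) * (Complex.I * (ξ 0 : ℂ))
        + d * (((-(α : ℝ) : ℝ) : ℂ) * Complex.I * (R 1 : ℂ)) * (Complex.I * (ξ 1 : ℂ))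
        + d * (((-(α : ℝ) : ℝ) : ℂ) * Complex.I * (R 2 : ℂ)) * (Complex.I * (ξ 2 : ℂ)) = _
      rw [hrr]; push_cast
      linear_combination -d * s * (R 0 * ξ 0 + R 1 * ξ 1 + R 2 * ξ 2) * hI
    rw [adv, adv, e1, e2]
    have hneg : ((-(α : ℝ) : ℝ) : ℂ) = -s := by simp [s]
    rw [hneg]
    ext j
    fin_cases j
    · simp
      linear_combination c * d * Complex.I * (p * R 0 + r * P 0) * hs2
    · simp
      linear_combination c * d * Complex.I * (p * R 1 + r * P 1) * hs2
    · simp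
      linear_combination c * d * Complex.I * (p * R 2 + r * P 2) * hs2
    · simp
      ring
  refine (congrArg (modeProj a n 0) key).trans ?_
  rw [modeProj_smul]
  by_cases hn : n 0 = 0 ∧ n 1 = 0
  · by_cases hn2 : n 2 = 0
    · have : n = 0 := by
        funext i; fin_cases i
        exacts [hn.1, hn.2, hn2]
      rw [this, modeProj_of_zero, smul_zero]
    · have x0 : η 0 = -ξ 0 := by
        have h := (wave_eq_zero_iff ha n 0).2 hn.1
        rw [← hkm, wave_add] at h; linarith
      have x1 : η 1 = -ξ 1 := by
        have h := (wave_eq_zero_iff ha n 1).2 hn.2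
        rw [← hkm, wave_add] at h; linarith
      have hh : hLen η = hLen ξ := by simp [hLen, x0, x1]
      have hl : len η = len ξ := by
        rw [hh, div_eq_div_iff k2.ne' m2.ne'] at hr
        exact mul_left_cancel₀ k1.ne' hr
      -- Equal lengths leave `η₃ = ±ξ₃`; the minus sign would make the vertical component of `n`
      -- zero.
      have x2 : η 2 = ξ 2 := by
        have h2 : ξ 2 + η 2 ≠ 0 := by
          have h := (wave_eq_zero_iff ha n 2).not.2 hn2
          rwa [← hkm, wave_add] at h
        have h3 : η 2 ^ 2 = ξ 2 ^ 2 := by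
          have e1 := len_sq η
          have e2 := len_sq ξ
          rw [hl, x0, x1] at e1
          linarith
        rcases sq_eq_sq_iff_eq_or_eq_neg.1 h3 with h | h
        · exact h
        · exact absurd (by rw [h]; ring) h2
      have r0 : R 0 = -P 0 := by simp [hR, hP, polar, hh, hl, x0, x2]; ring
      have r1 : R 1 = -P 1 := by simp [hR, hP, polar, hh, hl, x1, x2]; ring
      have r2 : R 2 = P 2 := by simp [hR, hP, polar, hh, hl]
      have hpr : p = r := by
        rw [hp, hrr, r0, r1, r2, x0, x1, x2]; ring
      rw [modeProj_of_hzero hn hn2]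
      ext j
      fin_cases j <;> simp [hpr, r0, r1]
  · have hc2 := polar_cancel k1 m1 k2 m2 hr hp hrr
    have hc3 : -((ξ 1 : ℂ) + η 1) * (p * R 0 + r * P 0)
      + ((ξ 0 : ℂ) + η 0) * (p * R 1 + r * P 1) = 0 := by exact_mod_cast hc2
    rw [modeProj_ker ha hn]
    have hz : -(wave a n 1 : ℂ) * (Complex.I * (p * R 0 + r * P 0))
        + wave a n 0 * (Complex.I * (p * R 1 + r * P 1)) = 0 := by
      rw [← hkm, wave_add, wave_add]
      push_cast
      linear_combination Complex.I * hc3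
    simp only [Matrix.cons_val_zero, Matrix.cons_val_one]
    rw [hz, zero_div, zero_smul, smul_zero]

/-- The substitution `k ↦ n - k` exchanges the two inputs, so the two series pair up termwise into
the symmetrised advection of `modeProj_cancel`. For `α = β` the conclusion says that twice one sum
is zero. -/
lemma tsum_triad_cancel (ha : ∀ i, 0 < a i) {A : (Fin 3 → ℤ) → (Fin 4 → ℂ)}
    (hA : Summable fun k => ‖A k‖ ^ 2) (n : Fin 3 → ℤ) {α β : SignType} (hα : α ≠ 0) (hβ : β ≠ 0) :
    ∑' k, triad a A A n α β 0 k + ∑' k, triad a A A n β α 0 k = 0 := by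
  have hs : Summable fun k => triad a A A n β α 0 ((Equiv.subLeft n) k) :=
    (Equiv.subLeft n).summable_iff.2 (summable_triad ha hA hA n β α 0)
  rw [← (Equiv.subLeft n).tsum_eq (triad a A A n β α 0),
    ← (summable_triad ha hA hA n α β 0).tsum_add hs]
  rw [← tsum_zero (α := Fin 4 → ℂ) (β := Fin 3 → ℤ)]
  congr 1
  funext k
  simp only [Equiv.subLeft_apply, triad, sub_sub_cancel, omega_zero]
  by_cases h : omega a k α + omega a (n - k) β = 0
  · rw [if_pos h, if_pos (by rw [add_comm]; exact h), ← modeProj_add]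
    exact modeProj_cancel ha (add_sub_cancel k n) hα hβ h _ _
  · rw [if_neg h, if_neg (by rw [add_comm]; exact h), add_zero]

/-- No resonance between three oscillating modes. -/
def Nonresonant (a : Fin 3 → ℝ) : Prop :=
  ∀ k m : Fin 3 → ℤ, ¬(k 0 = 0 ∧ k 1 = 0) → ¬(m 0 = 0 ∧ m 1 = 0) →
    ¬((k + m) 0 = 0 ∧ (k + m) 1 = 0) → ∀ α β γ : SignType, α ≠ 0 → β ≠ 0 → γ ≠ 0 →
    omega a k α + omega a m β ≠ omega a (k + m) γ

lemma triad_nonresonant (h : Nonresonant a) (A B : (Fin 3 → ℤ) → (Fin 4 → ℂ)) (n : Fin 3 → ℤ)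
    {α β γ : SignType} (hα : α ≠ 0) (hβ : β ≠ 0) (hγ : γ ≠ 0) (k : Fin 3 → ℤ) :
    triad a A B n α β γ k = 0 := by
  rw [triad]
  split_ifs with hr
  · by_cases hk : k 0 = 0 ∧ k 1 = 0
    · rw [modeProj_of_ne_zero hk hα, adv_zero_left, modeProj_zero]
    by_cases hm : (n - k) 0 = 0 ∧ (n - k) 1 = 0
    · rw [modeProj_of_ne_zero hm hβ, adv_zero_right, modeProj_zero]
    by_cases hn : n 0 = 0 ∧ n 1 = 0
    · exact modeProj_of_ne_zero hn hγ _
    have := h k (n - k) hk hm (by rwa [add_sub_cancel]) α β γ hα hβ hγ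
    rw [add_sub_cancel] at this
    exact absurd hr this
  · rfl

/-! #### Decomposition of the quadratic form -/

lemma modeProj_kerPart (ha : ∀ i, 0 < a i) (A : (Fin 3 → ℤ) → (Fin 4 → ℂ)) (n : Fin 3 → ℤ)
    (σ : SignType) : modeProj a n σ (kerPart a A n) = if σ = 0 then modeProj a n 0 (A n) else 0 := by
  rw [kerPart, modeProj_modeProj ha]
  split_ifs with h
  · rw [h]
  · rfl

lemma modeProj_oscPart (ha : ∀ i, 0 < a i) (A : (Fin 3 → ℤ) → (Fin 4 → ℂ)) (n : Fin 3 → ℤ)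
    (σ : SignType) : modeProj a n σ (oscPart a A n) = if σ = 0 then 0 else modeProj a n σ (A n) := by
  rw [oscPart, modeProj_add, modeProj_modeProj ha, modeProj_modeProj ha]
  cases σ <;> simp

lemma triad_ker_osc (ha : ∀ i, 0 < a i) (A : (Fin 3 → ℤ) → (Fin 4 → ℂ)) (n : Fin 3 → ℤ)
    (α β γ : SignType) : triad a (kerPart a A) (oscPart a A) n α β γ
      = if α = 0 ∧ β ≠ 0 then triad a A A n α β γ else 0 := by
  funext k
  simp only [triad, modeProj_kerPart ha, modeProj_oscPart ha]
  by_cases h1 : α = 0 <;> by_cases h2 : β = 0 <;>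
    simp [h1, h2, triad, adv_zero_left, adv_zero_right, modeProj_zero]

lemma triad_osc_ker (ha : ∀ i, 0 < a i) (A : (Fin 3 → ℤ) → (Fin 4 → ℂ)) (n : Fin 3 → ℤ)
    (α β γ : SignType) : triad a (oscPart a A) (kerPart a A) n α β γ
      = if α ≠ 0 ∧ β = 0 then triad a A A n α β γ else 0 := by
  funext k
  simp only [triad, modeProj_kerPart ha, modeProj_oscPart ha]
  by_cases h1 : α = 0 <;> by_cases h2 : β = 0 <;>
    simp [h1, h2, triad, adv_zero_left, adv_zero_right, modeProj_zero]

/-- The self-interaction of the kernel modes. -/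
def kerTransport (a : Fin 3 → ℝ) (A : (Fin 3 → ℤ) → (Fin 4 → ℂ)) (n : Fin 3 → ℤ) : Fin 4 → ℂ :=
  ∑' k, triad a A A n 0 0 0 k

lemma limitQ_self (A : (Fin 3 → ℤ) → (Fin 4 → ℂ)) (n : Fin 3 → ℤ) :
    limitQ a A A n = resonantTransport a A A n := by
  rw [limitQ, ← two_smul ℂ, smul_smul]; norm_num

lemma two_smul_limitQ (A B : (Fin 3 → ℤ) → (Fin 4 → ℂ)) (n : Fin 3 → ℤ) :
    (2 : ℂ) • limitQ a A B n = resonantTransport a A B n + resonantTransport a B A n := by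
  rw [limitQ, smul_smul]; norm_num

/-- The oscillating modes do not act on each other when forming the kernel part of `𝒬`; what
remains is the interaction of two kernel modes, the interaction of a kernel mode and an oscillating
mode, and the interaction of three oscillating modes. -/
lemma limitQ_self_eq (ha : ∀ i, 0 < a i) {A : (Fin 3 → ℤ) → (Fin 4 → ℂ)}
    (hA : Summable fun k => ‖A k‖ ^ 2) (n : Fin 3 → ℤ) :
    limitQ a A A n = kerTransport a A n + (2 : ℂ) • limitQ a (kerPart a A) (oscPart a A) n
      + ∑ α : SignType, ∑ β : SignType, ∑ γ : SignType,
        if α ≠ 0 ∧ β ≠ 0 ∧ γ ≠ 0 then ∑' k, triad a A A n α β γ k else 0 := by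
  have z1 : ∀ γ : SignType, γ ≠ 0 → ∑' k, triad a A A n 0 0 γ k = 0 := fun γ hγ => by
    simp [triad_zero_zero ha A A n hγ]
  have c1 := tsum_triad_cancel ha hA n (α := 1) (β := 1) (by decide) (by decide)
  have c2 := tsum_triad_cancel ha hA n (α := 1) (β := -1) (by decide) (by decide)
  have c3 := tsum_triad_cancel ha hA n (α := -1) (β := -1) (by decide) (by decide)
  rw [limitQ_self, two_smul_limitQ, resonantTransport_eq, resonantTransport_eq,
    resonantTransport_eq]
  simp only [triad_ker_osc ha, triad_osc_ker ha]
  simp only [sum_sign, kerTransport]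
  rw [z1 1 (by decide), z1 (-1) (by decide)]
  simp only [ne_eq, not_true_eq_false, and_false, if_false,
    show ¬((1 : SignType) = 0) from by decide, show ¬((-1 : SignType) = 0) from by decide,
    not_false_eq_true, and_true, if_true, Pi.zero_apply, tsum_zero, and_self]
  have d1 : ∑' k, triad a A A n 1 1 0 k = 0 := by
    rw [← two_smul ℂ] at c1; simpa using c1
  have d3 : ∑' k, triad a A A n (-1) (-1) 0 k = 0 := by
    rw [← two_smul ℂ] at c3; simpa using c3
  rw [d1, d3, eq_neg_of_add_eq_zero_left c2]
  abel

/-- The kernel part of `𝒬(A, A)`. -/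
lemma modeProj_limitQ (ha : ∀ i, 0 < a i) {A : (Fin 3 → ℤ) → (Fin 4 → ℂ)}
    (hA : Summable fun k => ‖A k‖ ^ 2) (n : Fin 3 → ℤ) :
    modeProj a n 0 (limitQ a A A n) = kerTransport a A n := by
  -- Each triad already lies in the range of `Π^γ`, so `Π⁰` keeps exactly the terms with `γ = 0`.
  have hγ : ∀ (B C : (Fin 3 → ℤ) → (Fin 4 → ℂ)) (α β γ σ : SignType),
      (∀ k, triad a B C n α β γ k = modeProj a n γ (triad a B C n α β γ k)) := by
    intro B C α β γ σ k
    rw [triad]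
    split_ifs
    · rw [modeProj_modeProj ha, if_pos rfl]
    · rw [modeProj_zero]
  have hT : ∀ α β γ, modeProj a n 0 (∑' k, triad a A A n α β γ k)
      = if γ = 0 then ∑' k, triad a A A n α β γ k else 0 := by
    intro α β γ
    rw [← modeProjL_apply, (modeProjL a n 0).map_tsum (summable_triad ha hA hA n α β γ)]
    simp only [modeProjL_apply]
    split_ifs with h
    · subst h
      congr 1; funext k; exact (hγ A A α β 0 0 k).symm
    · rw [← tsum_zero (α := Fin 4 → ℂ) (β := Fin 3 → ℤ)]
      congr 1; funext k
      rw [hγ A A α β γ 0 k, modeProj_modeProj ha, if_neg (Ne.symm h)]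
  have c1 := tsum_triad_cancel ha hA n (α := 1) (β := 1) (by decide) (by decide)
  have c2 := tsum_triad_cancel ha hA n (α := 1) (β := -1) (by decide) (by decide)
  have c3 := tsum_triad_cancel ha hA n (α := -1) (β := -1) (by decide) (by decide)
  have d1 : ∑' k, triad a A A n 1 1 0 k = 0 := by
    rw [← two_smul ℂ] at c1; simpa using c1
  have d3 : ∑' k, triad a A A n (-1) (-1) 0 k = 0 := by
    rw [← two_smul ℂ] at c3; simpa using c3
  rw [limitQ_self, resonantTransport_eq]
  simp only [sum_sign, modeProj_add, hT, if_true,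
    show ¬((1 : SignType) = 0) from by decide, show ¬((-1 : SignType) = 0) from by decide, if_false,
    triad_zero_osc_zero ha A A n (show (1 : SignType) ≠ 0 by decide),
    triad_zero_osc_zero ha A A n (show (-1 : SignType) ≠ 0 by decide),
    triad_osc_zero_zero ha A A n (show (1 : SignType) ≠ 0 by decide),
    triad_osc_zero_zero ha A A n (show (-1 : SignType) ≠ 0 by decide), tsum_zero, kerTransport, modeProj_zero]
  rw [d1, d3, eq_neg_of_add_eq_zero_left c2]
  abel

/-- For nonresonant tori, `𝒬(A, A)` only involves kernel modes and interactions with kernel modes. -/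
lemma limitQ_self_nonresonant (ha : ∀ i, 0 < a i) (hnr : Nonresonant a)
    {A : (Fin 3 → ℤ) → (Fin 4 → ℂ)} (hA : Summable fun k => ‖A k‖ ^ 2) (n : Fin 3 → ℤ) :
    limitQ a A A n = kerTransport a A n + (2 : ℂ) • limitQ a (kerPart a A) (oscPart a A) n := by
  rw [limitQ_self_eq ha hA n, add_eq_left]
  refine Finset.sum_eq_zero fun α _ => Finset.sum_eq_zero fun β _ => Finset.sum_eq_zero fun γ _ => ?_
  split_ifs with h
  · simp [triad_nonresonant hnr A A n h.1 h.2.1 h.2.2]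
  · rfl

lemma kerTransport_hzero (ha : ∀ i, 0 < a i) (A : (Fin 3 → ℤ) → (Fin 4 → ℂ)) {n : Fin 3 → ℤ}
    (hn : n 0 = 0 ∧ n 1 = 0) : kerTransport a A n = 0 := by
  simp [kerTransport, triad_hzero ha A A hn]

/-! #### The second order operator -/

lemma limitD_hzero {ν ν' : ℝ} (A : (Fin 3 → ℤ) → (Fin 4 → ℂ)) {n : Fin 3 → ℤ}
    (hn : n 0 = 0 ∧ n 1 = 0) :
    limitD a ν ν' A n = modeProj a n 0 (diffSymbol a ν ν' n (modeProj a n 0 (A n))) := by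
  have hD : diffSymbol a ν ν' n 0 = 0 := by
    ext j; simp [diffSymbol]
  rw [limitD]
  simp only [sum_sign, modeProj_of_ne_zero hn (show (1 : SignType) ≠ 0 by decide),
    modeProj_of_ne_zero hn (show (-1 : SignType) ≠ 0 by decide), if_true, hD, modeProj_zero]
  simp

/-- For `n_h ≠ 0` the three eigenfrequencies are distinct, so only `α = β` remains. The vector `e⁰`
has no fourth component and yields `ν`; `e^±` has half of its squared length in the velocity and
half in the fourth component, which yields the mean of `ν` and `ν'`. -/
lemma limitD_eq (ha : ∀ i, 0 < a i) {ν ν' : ℝ} (A : (Fin 3 → ℤ) → (Fin 4 → ℂ)) {n : Fin 3 → ℤ}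
    (hn : ¬(n 0 = 0 ∧ n 1 = 0)) :
    limitD a ν ν' A n = -((ν * len (wave a n) ^ 2 : ℝ) : ℂ) • kerPart a A n
      - (((ν + ν') / 2 * len (wave a n) ^ 2 : ℝ) : ℂ) • oscPart a A n := by
  have q : 0 < hLen (wave a n) / len (wave a n) :=
    div_pos (hLen_wave_pos ha hn) (len_wave_pos ha hn)
  have hω : ∀ α β : SignType, omega a n α = omega a n β ↔ α = β := by
    intro α β
    simp only [omega, mul_left_inj' q.ne']
    cases α <;> cases β <;> norm_num; decide
  have h0 : modeProj a n 0 (diffSymbol a ν ν' n (modeProj a n 0 (A n)))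
      = -((ν * len (wave a n) ^ 2 : ℝ) : ℂ) • modeProj a n 0 (A n) := by
    have : diffSymbol a ν ν' n (modeProj a n 0 (A n))
        = -((ν * len (wave a n) ^ 2 : ℝ) : ℂ) • modeProj a n 0 (A n) := by
      rw [modeProj_ker ha hn]
      ext j
      fin_cases j <;> simp [diffSymbol]
    rw [this, modeProj_smul, modeProj_modeProj ha, if_pos rfl]
  have h1 : ∀ σ : SignType, σ ≠ 0 → modeProj a n σ (diffSymbol a ν ν' n (modeProj a n σ (A n)))
      = -(((ν + ν') / 2 * len (wave a n) ^ 2 : ℝ) : ℂ) • modeProj a n σ (A n) := by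
    intro σ hσ
    have hp : (polar (wave a n) 0 : ℂ) ^ 2 + (polar (wave a n) 1 : ℂ) ^ 2
        + (polar (wave a n) 2 : ℂ) ^ 2 = 1 := by exact_mod_cast polar_sq ha hn
    have hs2 : ((σ : ℝ) : ℂ) ^ 2 = 1 := by exact_mod_cast sign_cast_sq hσ
    rw [modeProj_osc hn hσ (A n)]
    set c : ℂ := (A n 3 - ((σ : ℝ) : ℂ) * Complex.I * _) / 2
    rw [modeProj_osc hn hσ, smul_smul]
    congr 1
    simp only [diffSymbol, Pi.smul_apply, smul_eq_mul, Matrix.cons_val_zero, Matrix.cons_val_one,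
      Matrix.cons_val]
    push_cast
    set s := ((σ : ℝ) : ℂ)
    set L := (len (wave a n) : ℂ)
    linear_combination c * ν * L ^ 2 * s ^ 2 / 2 * ((polar (wave a n) 0 : ℂ) ^ 2 + (polar (wave a n) 1 : ℂ) ^ 2
        + (polar (wave a n) 2 : ℂ) ^ 2) * Complex.I_sq - c * ν * L ^ 2 * s ^ 2 / 2 * hp
        - c * ν * L ^ 2 / 2 * hs2
  rw [limitD]
  simp only [sum_sign, hω]
  simp [kerPart, oscPart, h0, h1]
  ring

end StratifiedLimit
end

open scoped ContDiff

noncomputable section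

namespace StratifiedLimit

open MeasureTheory

variable {a : Fin 3 → ℝ}

/-! ### Nonresonance of almost every torus -/

/-- The nonzero limit at infinity shows that the analytic function is not identically zero on the
connected half-line, so its zero set there is discrete, hence null. -/
lemma ae_ne_zero_of_analyticOnNhd {g : ℝ → ℝ} (hg : AnalyticOnNhd ℝ g (Set.Ioi 0)) {l : ℝ}
    (hl : l ≠ 0) (hlim : Filter.Tendsto g Filter.atTop (nhds l)) :
    ∀ᵐ x : ℝ, 0 < x → g x ≠ 0 := by
  obtain ⟨x, hx, hx0⟩ : ∃ x, g x ≠ 0 ∧ 0 < x :=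
    ((hlim.eventually_ne hl).and (Filter.eventually_gt_atTop 0)).exists
  have h := hg.preimage_zero_mem_codiscreteWithin hx hx0
    ⟨⟨1, Set.mem_Ioi.2 one_pos⟩, isPreconnected_Ioi⟩
  have h2 : ∀ᵐ y ∂volume.restrict (Set.Ioi (0 : ℝ)), g y ≠ 0 :=
    ae_restrict_le_codiscreteWithin measurableSet_Ioi h
  exact (ae_restrict_iff' measurableSet_Ioi).1 h2

/-- The point with vertical coordinate `x` and horizontal coordinates `y`. -/
def stack (x : ℝ) (y : Fin 2 → ℝ) : Fin 3 → ℝ := Fin.insertNth (α := fun _ => ℝ) 2 x y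

/-- The ratio `|n_h| / |n|` as a function of the vertical period. -/
lemma omega_insertNth (σ : SignType) (x : ℝ) (y : Fin 2 → ℝ) (n : Fin 3 → ℤ) :
    omega (stack x y) n σ
      = σ * (Real.sqrt ((n 0 / y 0) ^ 2 + (n 1 / y 1) ^ 2)
        / Real.sqrt ((n 0 / y 0) ^ 2 + (n 1 / y 1) ^ 2 + (n 2 / x) ^ 2)) := by
  rfl

lemma hpos_of_ne {y : Fin 2 → ℝ} (hy : ∀ i, 0 < y i) {n : Fin 3 → ℤ} (hn : ¬(n 0 = 0 ∧ n 1 = 0)) :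
    0 < ((n 0 : ℝ) / y 0) ^ 2 + ((n 1 : ℝ) / y 1) ^ 2 := by
  have h0 := (hy 0).ne'
  have h1 := (hy 1).ne'
  by_contra! h
  have e0 : ((n 0 : ℝ) / y 0) ^ 2 = 0 := by
    nlinarith [sq_nonneg ((n 0 : ℝ) / y 0), sq_nonneg ((n 1 : ℝ) / y 1)]
  have e1 : ((n 1 : ℝ) / y 1) ^ 2 = 0 := by
    nlinarith [sq_nonneg ((n 0 : ℝ) / y 0), sq_nonneg ((n 1 : ℝ) / y 1)]
  refine hn ⟨?_, ?_⟩
  · simpa [h0] using e0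
  · simpa [h1] using e1

lemma analyticOnNhd_omega {y : Fin 2 → ℝ} (hy : ∀ i, 0 < y i) {n : Fin 3 → ℤ}
    (hn : ¬(n 0 = 0 ∧ n 1 = 0)) (σ : SignType) :
    AnalyticOnNhd ℝ (fun x => omega (stack x y) n σ) (Set.Ioi 0) := by
  intro x hx
  have h := hpos_of_ne hy hn
  simp only [omega_insertNth]
  set c := ((n 0 : ℝ) / y 0) ^ 2 + ((n 1 : ℝ) / y 1) ^ 2
  have h2 : 0 < c + ((n 2 : ℝ) / x) ^ 2 := by positivity
  have hx' : x ≠ 0 := (Set.mem_Ioi.1 hx).ne'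
  apply ContDiffAt.analyticAt
  refine contDiffAt_const.mul (contDiffAt_const.div (ContDiffAt.sqrt ?_ h2.ne')
    (Real.sqrt_pos.2 h2).ne')
  exact contDiffAt_const.add ((contDiffAt_const.div contDiffAt_id hx').pow 2)

/-- As the vertical period grows, the vertical wave number tends to `0` and the ratio `|n_h|/|n|`
tends to `1`. -/
lemma tendsto_omega {y : Fin 2 → ℝ} (hy : ∀ i, 0 < y i) {n : Fin 3 → ℤ}
    (hn : ¬(n 0 = 0 ∧ n 1 = 0)) (σ : SignType) :
    Filter.Tendsto (fun x => omega (stack x y) n σ) Filter.atTop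
      (nhds (σ : ℝ)) := by
  have h := hpos_of_ne hy hn
  simp only [omega_insertNth]
  set c := ((n 0 : ℝ) / y 0) ^ 2 + ((n 1 : ℝ) / y 1) ^ 2
  have h1 : Filter.Tendsto (fun x : ℝ => c + ((n 2 : ℝ) / x) ^ 2) Filter.atTop (nhds (c + 0 ^ 2)) :=
    tendsto_const_nhds.add ((tendsto_const_nhds.div_atTop Filter.tendsto_id).pow 2)
  rw [zero_pow two_ne_zero, add_zero] at h1
  have h2 := (tendsto_const_nhds (x := Real.sqrt c)).div h1.sqrt (Real.sqrt_pos.2 h).ne'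
  rw [div_self (Real.sqrt_pos.2 h).ne'] at h2
  simpa using h2.const_mul (σ : ℝ)

lemma measurable_omega (n : Fin 3 → ℤ) (σ : SignType) : Measurable fun a => omega a n σ := by
  unfold omega hLen len wave
  fun_prop

/-- With the horizontal periods fixed, the difference of the two sides is analytic in the vertical
period and tends to `α + β - γ`, a sum of three signs, hence odd and nonzero. Fubini, with the
horizontal periods outermost, gives the statement in all three periods; this is where measurability
of the resonant set is needed. -/
lemma ae_nonresonant_triad {k m : Fin 3 → ℤ} (hk : ¬(k 0 = 0 ∧ k 1 = 0))
    (hm : ¬(m 0 = 0 ∧ m 1 = 0)) (hn : ¬((k + m) 0 = 0 ∧ (k + m) 1 = 0)) {α β γ : SignType}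
    (hα : α ≠ 0) (hβ : β ≠ 0) (hγ : γ ≠ 0) :
    ∀ᵐ a : Fin 3 → ℝ, (∀ i, 0 < a i) →
      omega a k α + omega a m β ≠ omega a (k + m) γ := by
  have hmeas : MeasurableSet {a : Fin 3 → ℝ | ¬((∀ i, 0 < a i) →
      omega a k α + omega a m β ≠ omega a (k + m) γ)} := by
    have : {a : Fin 3 → ℝ | ¬((∀ i, 0 < a i) →
      omega a k α + omega a m β ≠ omega a (k + m) γ)} = (⋂ i, {a | 0 < a i}) ∩
        {a | omega a k α + omega a m β = omega a (k + m) γ} := by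
      ext a; simp
    rw [this]
    refine (MeasurableSet.iInter fun i => measurableSet_lt measurable_const
      (measurable_pi_apply i)).inter (measurableSet_eq_fun
        ((measurable_omega k α).add (measurable_omega m β)) (measurable_omega _ γ))
  have hp := (volume_preserving_piFinSuccAbove (fun _ : Fin 3 => ℝ) 2).symm
  rw [← hp.map_eq, (MeasurableEquiv.measurableEmbedding _).ae_map_iff]
  have hmeas' : MeasurableSet {z : ℝ × (Fin 2 → ℝ) | (∀ i, 0 < stack z.1 z.2 i) →
      omega (stack z.1 z.2) k α + omega (stack z.1 z.2) m β
        ≠ omega (stack z.1 z.2) (k + m) γ} :=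
    ((MeasurableEquiv.piFinSuccAbove (fun _ : Fin 3 => ℝ) 2).symm.measurable hmeas).of_compl
  change ∀ᵐ z : ℝ × (Fin 2 → ℝ) ∂(volume.prod volume),
    (∀ i, 0 < stack z.1 z.2 i) →
      omega (stack z.1 z.2) k α + omega (stack z.1 z.2) m β
        ≠ omega (stack z.1 z.2) (k + m) γ
  rw [Measure.ae_prod_iff_ae_ae hmeas', Measure.ae_ae_comm hmeas']
  refine Filter.Eventually.of_forall fun y => ?_
  by_cases hy : ∀ i, 0 < y i
  · have hl : (α : ℝ) + β - γ ≠ 0 := by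
      cases α <;> cases β <;> cases γ <;> simp_all <;> norm_num
    filter_upwards [ae_ne_zero_of_analyticOnNhd
      (((analyticOnNhd_omega hy hk α).add (analyticOnNhd_omega hy hm β)).sub
        (analyticOnNhd_omega hy hn γ)) hl
      (((tendsto_omega hy hk α).add (tendsto_omega hy hm β)).sub (tendsto_omega hy hn γ))]
      with x hx hpos
    exact fun h => hx (hpos 2) (sub_eq_zero.2 h)
  · refine Filter.Eventually.of_forall fun x hpos => absurd (fun i => ?_) hy
    fin_cases i
    exacts [hpos 0, hpos 1]

/-- There are countably many frequencies and labels. The condition involves the periods only, so the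
null set is independent of the viscosities, of the datum and of the solution. -/
theorem ae_nonresonant : ∀ᵐ a : Fin 3 → ℝ, (∀ i, 0 < a i) → Nonresonant a := by
  have h : ∀ᵐ a : Fin 3 → ℝ, ∀ (k m : Fin 3 → ℤ) (α β γ : SignType), ¬(k 0 = 0 ∧ k 1 = 0) →
      ¬(m 0 = 0 ∧ m 1 = 0) → ¬((k + m) 0 = 0 ∧ (k + m) 1 = 0) → α ≠ 0 → β ≠ 0 → γ ≠ 0 →
      (∀ i, 0 < a i) → omega a k α + omega a m β ≠ omega a (k + m) γ := by
    simp only [Filter.eventually_imp_distrib_left, eventually_countable_forall]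
    intro k m α β γ hk hm hn hα hβ hγ
    exact ae_nonresonant_triad hk hm hn hα hβ hγ
  filter_upwards [h] with a h ha k m hk hm hn α β γ hα hβ hγ
  exact h k m α β γ hk hm hn hα hβ hγ ha

end StratifiedLimit

end

open scoped ContDiff

noncomputable section

namespace StratifiedLimit

open MeasureTheory

variable {a : Fin 3 → ℝ}

/-! ### Divergence -/

lemma memLp_of_contDiff {ψ : (Fin 3 → ℝ) → ℝ} (hψ : ContDiff ℝ ∞ ψ) :
    MemLp ψ 2 (volume.restrict (torus a)) := by
  obtain ⟨C, hC⟩ := isCompact_torus.exists_bound_of_continuousOn (s := torus a)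
    hψ.continuous.continuousOn
  exact MemLp.of_bound hψ.continuous.aestronglyMeasurable C
    ((ae_restrict_iff' measurableSet_torus).2 (Filter.Eventually.of_forall hC))

lemma integrableOn_mul_contDiff {f ψ : (Fin 3 → ℝ) → ℝ} (hf : IntegrableOn f (torus a))
    (hψ : ContDiff ℝ ∞ ψ) : IntegrableOn (fun x => f x * ψ x) (torus a) :=
  hf.mul_continuousOn hψ.continuous.continuousOn isCompact_torus

lemma hasSum_pairing (ha : ∀ i, 0 < a i) {f ψ : (Fin 3 → ℝ) → ℝ}
    (hf : IntegrableOn f (torus a)) (hψ : ContDiff ℝ ∞ ψ) (hp : IsPeriodic a ψ) :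
    HasSum (fun n => (torusVol a : ℂ) * (coeff a f n * (starRingEnd ℂ) (coeff a ψ n)))
      ((∫ x in torus a, f x * ψ x : ℝ) : ℂ) := by
  have := (hasSum_coeff_mul_conj ha hf (memLp_of_contDiff hψ)
    (summable_coeff_of_contDiff ha hψ hp)).mul_left (torusVol a : ℂ)
  rwa [mul_inv_cancel_left₀ (Complex.ofReal_ne_zero.2 (torusVol_pos ha).ne')] at this

/-- The weak divergence in Fourier variables. -/
lemma integral_sum_mul_pd (ha : ∀ i, 0 < a i) {ι : Type*} [Fintype ι]
    {f : ι → (Fin 3 → ℝ) → ℝ} (hf : ∀ i, IntegrableOn (f i) (torus a)) (e : ι → Fin 3)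
    {ψ : (Fin 3 → ℝ) → ℝ} (hψ : ContDiff ℝ ∞ ψ) (hp : IsPeriodic a ψ) :
    ((∫ x in torus a, ∑ i, f i x * pd (e i) ψ x : ℝ) : ℂ)
      = pairing a (fun n => -Complex.I * ∑ i, coeff a (f i) n * (wave a n (e i) : ℂ)) ψ := by
  rw [integral_finsetSum _ fun i _ => integrableOn_mul_contDiff (hf i) (ContDiff.pd hψ (e i))]
  push_cast
  rw [pairing, ← tsum_mul_left]
  have h := hasSum_sum (s := Finset.univ) fun i _ =>
    hasSum_pairing ha (hf i) (ContDiff.pd hψ (e i)) (hp.pd (e i))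
  refine h.tsum_eq.symm.trans ?_
  congr 1; funext n
  simp only [coeff_pd ha hψ hp, map_mul, Complex.conj_I, Complex.conj_ofReal, Finset.mul_sum,
    Finset.sum_mul]
  refine Finset.sum_congr rfl fun i _ => ?_
  ring

/-- In one direction a pair of trigonometric test functions (`modeTest` with constant `θ`) isolates
a frequency; in the other, the Fourier form of the weak divergence has zero terms. -/
lemma weak_div_eq_zero_iff (ha : ∀ i, 0 < a i) {ι : Type*} [Fintype ι]
    {f : ι → (Fin 3 → ℝ) → ℝ} (hf : ∀ i, IntegrableOn (f i) (torus a)) (e : ι → Fin 3) :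
    (∀ ψ : (Fin 3 → ℝ) → ℝ, ContDiff ℝ ∞ ψ → IsPeriodic a ψ →
        ∫ x in torus a, ∑ i, f i x * pd (e i) ψ x = 0)
      ↔ ∀ n, ∑ i, coeff a (f i) n * (wave a n (e i) : ℂ) = 0 := by
  constructor
  · intro h n
    have hc : ∀ c : ℂ, ContDiff ℝ ∞ (modeTest a n (fun _ => c) 0) ∧
        IsPeriodic a (modeTest a n (fun _ => c) 0) := fun c =>
      ⟨Complex.reCLM.contDiff.comp (contDiff_const.mul (contDiff_chr (-n))),
        fun x i => by simp only [modeTest, isPeriodic_chr ha (-n) x i]⟩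
    have k := pairing_modeTest_add ha
      (fun n => -Complex.I * ∑ i, coeff a (f i) n * (wave a n (e i) : ℂ)) n (fun _ => 1) 0
    rw [← integral_sum_mul_pd ha hf e (hc _).1 (hc _).2,
      ← integral_sum_mul_pd ha hf e (hc _).1 (hc _).2, h _ (hc _).1 (hc _).2,
      h _ (hc _).1 (hc _).2] at k
    have hv : (torusVol a : ℂ) ≠ 0 := Complex.ofReal_ne_zero.2 (torusVol_pos ha).ne'
    simpa [hv] using k.symm
  · intro h ψ hψ hp
    have k := integral_sum_mul_pd ha hf e hψ hp
    simp only [h, mul_zero] at k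
    rw [pairing] at k
    simp only [zero_mul, tsum_zero, mul_zero] at k
    exact_mod_cast k

lemma isDivFree_iff (ha : ∀ i, 0 < a i) {V : (Fin 3 → ℝ) → (Fin 4 → ℝ)}
    (hV : ∀ j, IntegrableOn (fun x => V x j) (torus a)) :
    IsDivFree a V ↔ ∀ n, ∑ i : Fin 3, (wave a n i : ℂ) * vcoeff a V n i.castSucc = 0 := by
  simp only [mul_comm ((wave a _ _ : ℝ) : ℂ)]
  exact weak_div_eq_zero_iff ha (f := fun (i : Fin 3) x => V x i.castSucc) (fun i => hV _) id

lemma isHDivFree_iff (ha : ∀ i, 0 < a i) {u : (Fin 3 → ℝ) → (Fin 2 → ℝ)}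
    (hu : ∀ j, IntegrableOn (fun x => u x j) (torus a)) :
    IsHDivFree a u ↔ ∀ n, ∑ i : Fin 2, (wave a n i.castSucc : ℂ) * vcoeff a u n i = 0 := by
  simp only [mul_comm ((wave a _ _ : ℝ) : ℂ)]
  exact weak_div_eq_zero_iff ha (f := fun (i : Fin 2) x => u x i) (fun i => hu _) Fin.castSucc

lemma IsL2.integrableOn {d : ℕ} {V : (Fin 3 → ℝ) → (Fin d → ℝ)} (hV : IsL2 a V) (j : Fin d) :
    IntegrableOn (fun x => V x j) (torus a) :=
  ((memLp_pi_iff.1 hV) j).integrable (by norm_num)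

/-! ### Time dependent coefficients -/

/-- Time dependent families of coefficients of fields in `L²_loc([0, ∞); L²)`. -/
structure IsL2Coeff {d : ℕ} (A : ℝ → (Fin 3 → ℤ) → (Fin d → ℂ)) : Prop where
  measurable : ∀ n, AEStronglyMeasurable (fun t => A t n) (volume.restrict (Set.Ioi (0 : ℝ)))
  bounded : ∃ G : ℝ → ℝ, (∀ T : ℝ, IntegrableOn G (Set.Icc 0 T)) ∧
    ∀ᵐ t ∂(volume.restrict (Set.Ioi (0 : ℝ))), (Summable fun n => ‖A t n‖ ^ 2) ∧
      ∑' n, ‖A t n‖ ^ 2 ≤ G t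

lemma norm_sq_le_sum {d : ℕ} (v : Fin d → ℂ) : ‖v‖ ^ 2 ≤ ∑ j, ‖v j‖ ^ 2 := by
  have h : ‖v‖ ≤ Real.sqrt (∑ j, ‖v j‖ ^ 2) :=
    (pi_norm_le_iff_of_nonneg (Real.sqrt_nonneg _)).2 fun j =>
      Real.le_sqrt_of_sq_le (Finset.single_le_sum (f := fun j => ‖v j‖ ^ 2)
        (fun i _ => sq_nonneg _) (Finset.mem_univ j))
  calc ‖v‖ ^ 2 ≤ Real.sqrt (∑ j, ‖v j‖ ^ 2) ^ 2 := by gcongr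
    _ = _ := Real.sq_sqrt (Finset.sum_nonneg fun i _ => sq_nonneg _)

lemma IsL2Loc.isL2Coeff (ha : ∀ i, 0 < a i) {d : ℕ} {u : ℝ → (Fin 3 → ℝ) → (Fin d → ℝ)}
    (hu : IsL2Loc a u) : IsL2Coeff (fun t => vcoeff a (u t)) where
  measurable n := (aemeasurable_pi_iff.2 fun j =>
    ((hu.comp j).locL1.aestronglyMeasurable_coeff n).aemeasurable).aestronglyMeasurable
  bounded := by
    refine ⟨fun t => ∑ j, (torusVol a)⁻¹ * ∫ x in torus a, u t x j * u t x j, fun T =>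
      integrable_finsetSum _ fun j _ =>
        (((hu.comp j).mul (hu.comp j)).integrableOn_integral T).const_mul _, ?_⟩
    filter_upwards [ae_all_iff.2 fun j => (hu.comp j).slice] with t ht
    have hs := hasSum_sum (s := Finset.univ) fun j _ => hasSum_norm_sq_coeff ha (ht j)
    have hsum : Summable fun n => ‖vcoeff a (u t) n‖ ^ 2 :=
      Summable.of_nonneg_of_le (fun n => sq_nonneg _) (fun n => norm_sq_le_sum _) hs.summable
    refine ⟨hsum, (hsum.tsum_le_tsum (fun n => norm_sq_le_sum _) hs.summable).trans ?_⟩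
    refine hs.tsum_eq.le.trans ?_
    simp only [pow_two]
    exact le_rfl

lemma IsL2Coeff.map {d e : ℕ} {A : ℝ → (Fin 3 → ℤ) → (Fin d → ℂ)} (hA : IsL2Coeff A)
    (L : (Fin 3 → ℤ) → (Fin d → ℂ) → (Fin e → ℂ)) (hL : ∀ n, Continuous (L n)) {C : ℝ}
    (hC : ∀ n v, ‖L n v‖ ≤ C * ‖v‖) : IsL2Coeff (fun t n => L n (A t n)) where
  measurable n := (hL n).comp_aestronglyMeasurable (hA.measurable n)
  bounded := by
    obtain ⟨G, hG, h⟩ := hA.bounded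
    refine ⟨fun t => C ^ 2 * G t, fun T => (hG T).const_mul _, ?_⟩
    filter_upwards [h] with t ht
    have hle : ∀ n, ‖L n (A t n)‖ ^ 2 ≤ C ^ 2 * ‖A t n‖ ^ 2 := fun n => by
      rw [← mul_pow]
      exact pow_le_pow_left₀ (norm_nonneg _) (hC n _) 2
    have hs := Summable.of_nonneg_of_le (fun n => sq_nonneg _) hle (ht.1.mul_left (C ^ 2))
    refine ⟨hs, (hs.tsum_le_tsum hle (ht.1.mul_left _)).trans ?_⟩
    rw [tsum_mul_left]
    exact mul_le_mul_of_nonneg_left ht.2 (sq_nonneg C)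

lemma continuous_modeProj (n : Fin 3 → ℤ) (σ : SignType) : Continuous (modeProj a n σ) :=
  (modeProjL a n σ).continuous

lemma IsL2Coeff.kerPart (ha : ∀ i, 0 < a i) {A : ℝ → (Fin 3 → ℤ) → (Fin 4 → ℂ)}
    (hA : IsL2Coeff A) : IsL2Coeff (fun t => kerPart a (A t)) :=
  hA.map (fun n => modeProj a n 0) (fun n => continuous_modeProj n 0) fun n => norm_modeProj_le ha n 0

/-- Symbols of order two applied to coefficients are sources. -/
lemma IsL2Coeff.isSource {d : ℕ} {A : ℝ → (Fin 3 → ℤ) → (Fin d → ℂ)} (hA : IsL2Coeff A)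
    (L : (Fin 3 → ℤ) → (Fin d → ℂ) → ℂ) (hL : ∀ n, Continuous (L n)) {C : ℝ} (hC0 : 0 ≤ C)
    (hC : ∀ n v, ‖L n v‖ ≤ wt a n * (C * ‖v‖)) : IsSource a (fun t n => L n (A t n)) where
  measurable n := (hL n).comp_aestronglyMeasurable (hA.measurable n)
  bounded := by
    obtain ⟨G, hG, h⟩ := hA.bounded
    refine ⟨fun t => C * (1 + G t), fun T => ((integrable_const 1).add (hG T)).const_mul _, ?_⟩
    filter_upwards [h] with t ht n
    refine (hC n _).trans ?_
    have h1 : ‖A t n‖ ^ 2 ≤ G t := (ht.1.le_tsum n fun m _ => sq_nonneg _).trans ht.2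
    have h2 : ‖A t n‖ ≤ 1 + G t := by nlinarith [sq_nonneg (‖A t n‖ - 1)]
    have := wt_pos (a := a) n
    gcongr

lemma continuous_adv {X : Type*} [TopologicalSpace X] {f g : X → Fin 4 → ℂ} (hf : Continuous f)
    (hg : Continuous g) (η : Fin 3 → ℝ) : Continuous fun x => adv (f x) η (g x) := by
  unfold adv
  fun_prop

lemma aestronglyMeasurable_tsum {ι X E : Type*} [Countable ι] [MeasurableSpace X] {μ : Measure X}
    [NormedAddCommGroup E] {f : X → ι → E}
    (hf : ∀ i, AEStronglyMeasurable (fun x => f x i) μ) (hs : ∀ᵐ x ∂μ, Summable (f x)) :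
    AEStronglyMeasurable (fun x => ∑' i, f x i) μ :=
  aestronglyMeasurable_of_tendsto_ae (Filter.atTop : Filter (Finset ι))
    (f := fun s x => ∑ i ∈ s, f x i)
    (fun s => Finset.aestronglyMeasurable_fun_sum s fun i _ => hf i)
    (hs.mono fun _ hx => hx.hasSum)

lemma aestronglyMeasurable_triad {A B : ℝ → (Fin 3 → ℤ) → (Fin 4 → ℂ)} (hA : IsL2Coeff A)
    (hB : IsL2Coeff B) (n : Fin 3 → ℤ) (α β γ : SignType) (k : Fin 3 → ℤ) :
    AEStronglyMeasurable (fun t => triad a (A t) (B t) n α β γ k)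
      (volume.restrict (Set.Ioi (0 : ℝ))) := by
  by_cases hr : omega a k α + omega a (n - k) β = omega a n γ
  · have h : Continuous fun p : (Fin 4 → ℂ) × (Fin 4 → ℂ) => modeProj a n γ
        (adv (modeProj a k α p.1) (wave a (n - k)) (modeProj a (n - k) β p.2)) :=
      (continuous_modeProj n γ).comp (continuous_adv ((continuous_modeProj k α).comp continuous_fst)
        ((continuous_modeProj (n - k) β).comp continuous_snd) _)
    have h2 := h.comp_aestronglyMeasurable ((hA.measurable k).prodMk (hB.measurable (n - k)))
    have h3 : (fun t => triad a (A t) (B t) n α β γ k) = fun t => modeProj a n γ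
        (adv (modeProj a k α (A t k)) (wave a (n - k)) (modeProj a (n - k) β (B t (n - k)))) :=
      funext fun t => if_pos hr
    rw [h3]
    exact h2
  · have h3 : (fun t => triad a (A t) (B t) n α β γ k) = fun _ => 0 := funext fun t => if_neg hr
    rw [h3]
    exact aestronglyMeasurable_const

lemma aestronglyMeasurable_resonantTransport (ha : ∀ i, 0 < a i)
    {A B : ℝ → (Fin 3 → ℤ) → (Fin 4 → ℂ)} (hA : IsL2Coeff A) (hB : IsL2Coeff B)
    (n : Fin 3 → ℤ) : AEStronglyMeasurable (fun t => resonantTransport a (A t) (B t) n)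
      (volume.restrict (Set.Ioi (0 : ℝ))) := by
  obtain ⟨G, -, h⟩ := hA.bounded
  obtain ⟨G', -, h'⟩ := hB.bounded
  simp only [resonantTransport_eq]
  refine Finset.aestronglyMeasurable_fun_sum _ fun α _ => Finset.aestronglyMeasurable_fun_sum _
    fun β _ => Finset.aestronglyMeasurable_fun_sum _ fun γ _ => aestronglyMeasurable_tsum
      (fun k => aestronglyMeasurable_triad hA hB n α β γ k) ?_
  filter_upwards [h, h'] with t ht ht'
  exact summable_triad ha ht.1 ht'.1 n α β γ

/-- The pairing of `𝒬` with test functions is meaningful for fields that are merely in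
`L²_loc([0,∞); L²)`: its coefficients are bounded by `wt` times the sum of the two squared norms,
which is locally integrable in time. -/
lemma isSource_limitQ (ha : ∀ i, 0 < a i) {A B : ℝ → (Fin 3 → ℤ) → (Fin 4 → ℂ)}
    (hA : IsL2Coeff A) (hB : IsL2Coeff B) (j : Fin 4) :
    IsSource a (fun t n => limitQ a (A t) (B t) n j) where
  measurable n := (continuous_apply j).comp_aestronglyMeasurable
    (((aestronglyMeasurable_resonantTransport ha hA hB n).add
      (aestronglyMeasurable_resonantTransport ha hB hA n)).const_smul (1 / 2 : ℂ))
  bounded := by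
    obtain ⟨G, hG, h⟩ := hA.bounded
    obtain ⟨G', hG', h'⟩ := hB.bounded
    refine ⟨fun t => 5184 * (G t + G' t), fun T => ((hG T).add (hG' T)).const_mul _, ?_⟩
    filter_upwards [h, h'] with t ht ht' n
    have h1 := norm_resonantTransport_le ha ht.1 ht'.1 n
    have h2 := norm_resonantTransport_le ha ht'.1 ht.1 n
    have hw := wt_pos (a := a) n
    refine (norm_le_pi_norm _ j).trans ?_
    rw [limitQ, norm_smul]
    have h3 : ‖resonantTransport a (A t) (B t) n + resonantTransport a (B t) (A t) n‖
        ≤ 2 * (wt a n * (5184 * (∑' k, ‖A t k‖ ^ 2 + ∑' k, ‖B t k‖ ^ 2))) := by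
      refine (norm_add_le _ _).trans ?_
      rw [add_comm (∑' k, ‖B t k‖ ^ 2)] at h2
      linarith
    calc _ ≤ 1 / 2 * (2 * (wt a n * (5184 * (∑' k, ‖A t k‖ ^ 2 + ∑' k, ‖B t k‖ ^ 2)))) := by
          norm_num at h3 ⊢; linarith
      _ ≤ 1 / 2 * (2 * (wt a n * (5184 * (G t + G' t)))) := by
          gcongr
          exacts [ht.2, ht'.2]
      _ = _ := by ring

lemma norm_diffSymbol_le (ν ν' : ℝ) (n : Fin 3 → ℤ) (v : Fin 4 → ℂ) :
    ‖diffSymbol a ν ν' n v‖ ≤ wt a n * ((|ν| + |ν'|) * ‖v‖) := by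
  have hw := wt_pos (a := a) n
  refine (pi_norm_le_iff_of_nonneg (by positivity)).2 fun j => ?_
  rw [diffSymbol, norm_mul, norm_neg, Complex.norm_real, Real.norm_eq_abs, abs_mul,
    abs_of_nonneg (sq_nonneg (len (wave a n)))]
  have h1 : |(![ν, ν, ν, ν'] : Fin 4 → ℝ) j| ≤ |ν| + |ν'| := by
    fin_cases j <;> simp
  have h2 : len (wave a n) ^ 2 ≤ wt a n := by unfold wt; linarith
  calc _ ≤ (|ν| + |ν'|) * wt a n * ‖v‖ := by
        gcongr
        exact norm_le_pi_norm v j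
    _ = _ := by ring

lemma continuous_diffSymbol (ν ν' : ℝ) (n : Fin 3 → ℤ) : Continuous (diffSymbol a ν ν' n) := by
  unfold diffSymbol
  fun_prop

lemma isSource_limitD (ha : ∀ i, 0 < a i) (ν ν' : ℝ) {A : ℝ → (Fin 3 → ℤ) → (Fin 4 → ℂ)}
    (hA : IsL2Coeff A) (j : Fin 4) : IsSource a (fun t n => limitD a ν ν' (A t) n j) := by
  refine hA.isSource (a := a) (fun n v => limitD a ν ν' (fun _ => v) n j) (fun n => ?_)
    -- `144 = 9 · 16`: nine pairs of labels, and two projection bounds of `4` each.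
    (C := 144 * (|ν| + |ν'|)) (by positivity) fun n v => ?_
  · refine (continuous_apply j).comp (continuous_finsetSum _ fun α _ => continuous_finsetSum _
      fun β _ => ?_)
    split_ifs
    · exact (continuous_modeProj n β).comp ((continuous_diffSymbol ν ν' n).comp
        (continuous_modeProj n α))
    · exact continuous_const
  · refine (norm_le_pi_norm _ j).trans ?_
    have hw := wt_pos (a := a) n
    rw [limitD]
    calc _ ≤ ∑ _α : SignType, ∑ _β : SignType, 16 * (wt a n * ((|ν| + |ν'|) * ‖v‖)) := by
          refine norm_sum_le_of_le _ fun α _ => norm_sum_le_of_le _ fun β _ => ?_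
          split_ifs
          · have h1 := norm_modeProj_le ha n β (diffSymbol a ν ν' n (modeProj a n α v))
            have h2 := norm_diffSymbol_le (a := a) ν ν' n (modeProj a n α v)
            have h3 := norm_modeProj_le ha n α v
            calc _ ≤ 4 * (wt a n * ((|ν| + |ν'|) * (4 * ‖v‖))) := by
                  refine h1.trans ?_
                  gcongr
                  refine h2.trans ?_
                  gcongr
              _ = _ := by ring
          · rw [norm_zero]; positivity
      _ = _ := by
        simp only [Finset.sum_const, Finset.card_univ, show Fintype.card SignType = 3 from rfl,
          nsmul_eq_mul]
        push_cast
        ring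

/-! ### Linear combinations of mode equations -/

lemma integrableOn_mul_of_eq_zero {y ζ : ℝ → ℂ} (hy : ∀ T : ℝ, IntegrableOn y (Set.Icc 0 T))
    (hζ : Continuous ζ) {R : ℝ} (hζ0 : ∀ t, R ≤ t → ζ t = 0) :
    IntegrableOn (fun t => y t * ζ t) (Set.Ioi 0) := by
  refine integrableOn_Ioi_of_Icc (T := R) ?_ fun t ht => by rw [hζ0 t ht, mul_zero]
  exact (hy R).mul_continuousOn hζ.continuousOn isCompact_Icc

lemma deriv_eq_zero_of_le {θ : ℝ → ℂ} {T : ℝ} (hT : ∀ t, T ≤ t → θ t = 0) :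
    ∀ t, T + 1 ≤ t → deriv θ t = 0 := fun t ht => by
  have : θ =ᶠ[nhds t] fun _ => 0 := by
    filter_upwards [lt_mem_nhds (show T < t by linarith)] with s hs
    exact hT s hs.le
  rw [this.deriv_eq, deriv_const]

lemma ModeEq.sum {ι : Type*} (s : Finset ι) {c : ι → ℂ} {y h : ι → ℝ → ℂ} {y₀ : ι → ℂ}
    (hy : ∀ i ∈ s, ∀ T : ℝ, IntegrableOn (y i) (Set.Icc 0 T))
    (hh : ∀ i ∈ s, ∀ T : ℝ, IntegrableOn (h i) (Set.Icc 0 T))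
    (H : ∀ i ∈ s, ModeEq (y i) (y₀ i) (h i)) :
    ModeEq (fun t => ∑ i ∈ s, c i * y i t) (∑ i ∈ s, c i * y₀ i) (fun t => ∑ i ∈ s, c i * h i t) := by
  intro θ hθ ⟨T, hT⟩
  have hd := deriv_eq_zero_of_le hT
  have hc : Continuous (deriv θ) := (contDiff_infty_iff_deriv.1 hθ).2.continuous
  simp only [Finset.sum_mul, mul_assoc]
  rw [integral_finsetSum _ fun i hi => (integrableOn_mul_of_eq_zero (hy i hi) hc hd).const_mul _,
    integral_finsetSum _ fun i hi =>
      (integrableOn_mul_of_eq_zero (hh i hi) hθ.continuous hT).const_mul _, ← Finset.sum_add_distrib]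
  refine Finset.sum_congr rfl fun i hi => ?_
  rw [integral_const_mul, integral_const_mul, ← H i hi θ hθ ⟨T, hT⟩]
  ring

lemma ModeEq.congr {y y' h h' : ℝ → ℂ} {y₀ y₀' : ℂ} (H : ModeEq y y₀ h)
    (hy : ∀ᵐ t ∂(volume.restrict (Set.Ioi (0 : ℝ))), y t = y' t) (h0 : y₀ = y₀')
    (hh : ∀ᵐ t ∂(volume.restrict (Set.Ioi (0 : ℝ))), h t = h' t) : ModeEq y' y₀' h' := by
  intro θ hθ hs
  have e1 : ∫ t in Set.Ioi (0 : ℝ), y' t * deriv θ t = ∫ t in Set.Ioi (0 : ℝ), y t * deriv θ t :=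
    integral_congr_ae (hy.mono fun t ht => by simp only [ht])
  have e2 : ∫ t in Set.Ioi (0 : ℝ), h' t * θ t = ∫ t in Set.Ioi (0 : ℝ), h t * θ t :=
    integral_congr_ae (hh.mono fun t ht => by simp only [ht])
  rw [e1, e2, ← h0]
  exact H θ hθ hs

/-- A linear map applied to a system of mode equations. -/
lemma ModeEq.map {d e : ℕ} (L : (Fin d → ℂ) →ₗ[ℂ] (Fin e → ℂ)) {y h : ℝ → Fin d → ℂ}
    {y₀ : Fin d → ℂ} (hy : ∀ j (T : ℝ), IntegrableOn (fun t => y t j) (Set.Icc 0 T))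
    (hh : ∀ j (T : ℝ), IntegrableOn (fun t => h t j) (Set.Icc 0 T))
    (H : ∀ j, ModeEq (fun t => y t j) (y₀ j) (fun t => h t j)) (i : Fin e) :
    ModeEq (fun t => L (y t) i) (L y₀ i) (fun t => L (h t) i) := by
  have key : ∀ v : Fin d → ℂ, L v i = ∑ j, L (Pi.single j 1) i * v j := fun v => by
    conv_lhs => rw [← Finset.univ_sum_single v]
    rw [map_sum, Finset.sum_apply]
    refine Finset.sum_congr rfl fun j _ => ?_
    rw [show (Pi.single j (v j) : Fin d → ℂ) = v j • Pi.single j 1 by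
      rw [← Pi.single_smul, smul_eq_mul, mul_one], map_smul, Pi.smul_apply, smul_eq_mul, mul_comm]
  rw [funext fun t => key (y t), funext fun t => key (h t), key y₀]
  exact ModeEq.sum _ (fun j _ => hy j) (fun j _ => hh j) fun j _ => H j

end StratifiedLimit

end

open scoped ContDiff

noncomputable section

namespace StratifiedLimit

open MeasureTheory

variable {a : Fin 3 → ℝ}

/-! ### Averages -/

lemma coeff_at_zero (f : (Fin 3 → ℝ) → ℝ) :
    coeff a f 0 = (torusVol a : ℂ)⁻¹ * ((∫ x in torus a, f x : ℝ) : ℂ) := by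
  rw [coeff, ← integral_complex_ofReal]
  congr 2
  funext x
  simp [wave]

lemma piFinSuccAbove_preimage_torus :
    (MeasurableEquiv.piFinSuccAbove (fun _ : Fin 3 => ℝ) 2).symm ⁻¹' torus a
      = Set.Icc 0 (2 * Real.pi * a 2) ×ˢ
        Set.Icc (0 : Fin 2 → ℝ) (fun i => 2 * Real.pi * a i.castSucc) := by
  ext ⟨s, y⟩
  have h : (MeasurableEquiv.piFinSuccAbove (fun _ : Fin 3 => ℝ) 2).symm (s, y) = ![y 0, y 1, s] := by
    funext i; fin_cases i <;> rfl
  simp only [Set.mem_preimage, h, torus, Set.mem_prod, Set.mem_Icc, Pi.le_def, Fin.forall_fin_succ]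
  simp
  tauto

/-- For `n_h = 0` the character depends on `x₃` only, so Fubini exposes the horizontal averages as
inner integrals. -/
lemma coeff_eq_zero_of_hzero {V : (Fin 3 → ℝ) → (Fin 4 → ℝ)} (hV : IsL2 a V)
    (h0 : HasZeroHAverage a V) {n : Fin 3 → ℤ} (hn : n 0 = 0 ∧ n 1 = 0) : vcoeff a V n = 0 := by
  funext j
  have hp := (volume_preserving_piFinSuccAbove (fun _ : Fin 3 => ℝ) 2).symm
  have he := (MeasurableEquiv.piFinSuccAbove (fun _ : Fin 3 => ℝ) 2).symm.measurableEmbedding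
  have hpt : ∀ z : ℝ × (Fin 2 → ℝ),
      (MeasurableEquiv.piFinSuccAbove (fun _ : Fin 3 => ℝ) 2).symm z = ![z.2 0, z.2 1, z.1] := by
    intro z; funext i; fin_cases i <;> rfl
  have hrp : MeasurePreserving (MeasurableEquiv.piFinSuccAbove (fun _ : Fin 3 => ℝ) 2).symm
      (((volume : Measure ℝ).restrict (Set.Icc 0 (2 * Real.pi * a 2))).prod
        ((volume : Measure (Fin 2 → ℝ)).restrict
          (Set.Icc (0 : Fin 2 → ℝ) (fun i => 2 * Real.pi * a i.castSucc))))
      (volume.restrict (torus a)) := by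
    rw [Measure.prod_restrict, ← piFinSuccAbove_preimage_torus]
    exact hp.restrict_preimage measurableSet_torus
  have hint : ∀ j, Integrable (fun z : ℝ × (Fin 2 → ℝ) => V ![z.2 0, z.2 1, z.1] j)
      (((volume : Measure ℝ).restrict (Set.Icc 0 (2 * Real.pi * a 2))).prod
        ((volume : Measure (Fin 2 → ℝ)).restrict
          (Set.Icc (0 : Fin 2 → ℝ) (fun i => 2 * Real.pi * a i.castSucc)))) := fun j => by
    have := hrp.integrable_comp_of_integrable (hV.integrableOn j)
    refine this.congr (Filter.Eventually.of_forall fun z => ?_)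
    simp only [Function.comp, hpt]
  have hw0 : wave a n 0 = 0 := by simp [wave, hn.1]
  have hw1 : wave a n 1 = 0 := by simp [wave, hn.2]
  have hexp : ∀ z : ℝ × (Fin 2 → ℝ), Complex.exp (-(Complex.I *
      ((∑ i, wave a n i * (![z.2 0, z.2 1, z.1] : Fin 3 → ℝ) i : ℝ) : ℂ)))
      = Complex.exp (-(Complex.I * ((wave a n 2 * z.1 : ℝ) : ℂ))) := fun z => by
    rw [Fin.sum_univ_three, hw0, hw1]; simp
  have hint2 : Integrable (fun z : ℝ × (Fin 2 → ℝ) => (V ![z.2 0, z.2 1, z.1] j : ℂ)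
      * Complex.exp (-(Complex.I * ((wave a n 2 * z.1 : ℝ) : ℂ))))
      (((volume : Measure ℝ).restrict (Set.Icc 0 (2 * Real.pi * a 2))).prod
        ((volume : Measure (Fin 2 → ℝ)).restrict
          (Set.Icc (0 : Fin 2 → ℝ) (fun i => 2 * Real.pi * a i.castSucc)))) := by
    refine (integrable_ofReal (hint j)).mul_bdd (c := 1) (Continuous.aestronglyMeasurable
      (by fun_prop)) (Filter.Eventually.of_forall fun z => ?_)
    rw [Complex.norm_exp]; simp
  rw [vcoeff, coeff, ← hrp.integral_comp he]
  simp only [hpt, hexp]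
  rw [integral_prod _ hint2, integral_eq_zero_of_ae, mul_zero, Pi.zero_apply]
  filter_upwards [h0, ae_all_iff.2 fun j => (hint j).prod_right_ae] with s hs hsi
  simp only [Pi.zero_apply]
  rw [integral_mul_const, integral_complex_ofReal]
  have := congrFun hs j
  rw [eval_integral hsi] at this
  rw [this]; simp

/-! ### The modes of a solution of the limit system -/

lemma pairing_zero (F : (Fin 3 → ℤ) → ℂ) : pairing a F (fun _ => 0) = 0 := by
  simp [pairing, coeff_zero]

lemma isTest_single {d : ℕ} (j : Fin d) {φ : ℝ → (Fin 3 → ℝ) → ℝ} (hφ : IsTest a φ) :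
    IsTest a (fun t x => (Pi.single j (φ t x) : Fin d → ℝ)) where
  smooth := (ContinuousLinearMap.single ℝ (fun _ : Fin d => ℝ) j).contDiff.comp hφ.smooth
  periodic t x i := by simp only [hφ.periodic t x i]
  support := by
    obtain ⟨T, hT⟩ := hφ.support
    exact ⟨T, fun t x ht => by rw [hT t x ht, Pi.single_zero]⟩

variable {ν ν' : ℝ} {V₀ : (Fin 3 → ℝ) → (Fin 4 → ℝ)} {U : ℝ → (Fin 3 → ℝ) → (Fin 4 → ℝ)}

lemma isSource_limit (ha : ∀ i, 0 < a i) (ν ν' : ℝ) {A : ℝ → (Fin 3 → ℤ) → (Fin 4 → ℂ)}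
    (hA : IsL2Coeff A) (j : Fin 4) :
    IsSource a (fun t n => (limitQ a (A t) (A t) n - limitD a ν ν' (A t) n) j) := by
  refine ((isSource_limitQ ha hA hA j).add ((isSource_limitD ha ν ν' hA j).const_mul
    (c := fun _ => -1) (C := 1) (by simp))).congr (Filter.Eventually.of_forall fun t n => ?_)
  simp [sub_eq_add_neg]

/-- Test fields with a single nonzero component decouple the vector equation into scalar ones, to
which `modeEq_of_equation` applies. -/
lemma IsLimitSolution.modeEq (ha : ∀ i, 0 < a i) (hV : IsInitialDatum a V₀)
    (hU : IsLimitSolution a ν ν' V₀ U) (n : Fin 3 → ℤ) (j : Fin 4) :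
    ModeEq (fun t => vcoeff a (U t) n j) (vcoeff a V₀ n j)
      (fun t => (limitQ a (vcoeff a (U t)) (vcoeff a (U t)) n
        - limitD a ν ν' (vcoeff a (U t)) n) j) := by
  refine modeEq_of_equation ha (hU.isL2Loc.comp j).locL1 (hV.isL2.integrableOn j)
    (isSource_limit ha ν ν' (hU.isL2Loc.isL2Coeff ha) j) (fun φ hφ => ?_) n
  have hs := isTest_single j hφ
  have h := hU.equation _ hs
  have e1 : ∀ t x, ∑ i, U t x i * deriv (fun s => (Pi.single j (φ s x) : Fin 4 → ℝ)) t i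
      = U t x j * dt φ t x := fun t x => by
    rw [Finset.sum_eq_single j]
    · rw [dt_apply hs]; simp
    · intro i _ hi
      rw [dt_apply hs]; simp [Pi.single_eq_of_ne hi, dt]
    · simp
  have e2 : ∀ x, ∑ i, V₀ x i * (Pi.single j (φ 0 x) : Fin 4 → ℝ) i = V₀ x j * φ 0 x := fun x => by
    rw [Finset.sum_eq_single j]
    · simp
    · intro i _ hi
      simp [Pi.single_eq_of_ne hi]
    · simp
  have e3 : ∀ t (F : (Fin 3 → ℤ) → (Fin 4 → ℂ)),
      vpairing a F (fun x => (Pi.single j (φ t x) : Fin 4 → ℝ)) = pairing a (fun n => F n j) (φ t) :=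
    fun t F => by
      rw [vpairing, Finset.sum_eq_single j]
      · simp
      · intro i _ hi
        simp [Pi.single_eq_of_ne hi, pairing_zero]
      · simp
  simp only [e1, e2] at h
  refine h.trans (integral_congr_ae (Filter.Eventually.of_forall fun t => e3 t _))

lemma IsLimitSolution.ae_slice (hU : IsLimitSolution a ν ν' V₀ U) :
    ∀ᵐ t ∂(volume.restrict (Set.Ioi (0 : ℝ))), ∀ j, IntegrableOn (fun x => U t x j) (torus a) :=
  ae_all_iff.2 fun j => (hU.isL2Loc.comp j).locL1.slice

lemma IsLimitSolution.ae_divFree (ha : ∀ i, 0 < a i) (hU : IsLimitSolution a ν ν' V₀ U) :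
    ∀ᵐ t ∂(volume.restrict (Set.Ioi (0 : ℝ))), ∀ n,
      ∑ i : Fin 3, (wave a n i : ℂ) * vcoeff a (U t) n i.castSucc = 0 := by
  filter_upwards [hU.divFree, hU.ae_slice] with t ht hs
  exact (isDivFree_iff ha hs).1 ht

lemma IsLimitSolution.ae_coeff_zero (hU : IsLimitSolution a ν ν' V₀ U) :
    ∀ᵐ t ∂(volume.restrict (Set.Ioi (0 : ℝ))), vcoeff a (U t) 0 = 0 := by
  filter_upwards [hU.meanZero, hU.ae_slice] with t ht hs
  funext j
  have := congrFun ht j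
  rw [eval_integral hs] at this
  rw [vcoeff, coeff_at_zero, this]; simp

lemma IsL2Coeff.integrableOn {d : ℕ} {A : ℝ → (Fin 3 → ℤ) → (Fin d → ℂ)} (hA : IsL2Coeff A)
    (n : Fin 3 → ℤ) (j : Fin d) (T : ℝ) : IntegrableOn (fun t => A t n j) (Set.Icc 0 T) :=
  -- The torus with `a = 1` is a dummy: integrability in time does not involve space, and any weight
  -- at least `1` serves.
  (hA.isSource (a := fun _ => 1) (fun _ v => v j) (fun _ => continuous_apply j) (C := 1) zero_le_one
    fun n v => by
      have := one_le_wt (a := fun _ => 1) n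
      nlinarith [norm_le_pi_norm v j, norm_nonneg v]).locallyIntegrable n T

/-- A linear map applied to the mode equations of a solution. -/
lemma IsLimitSolution.modeEq_map (ha : ∀ i, 0 < a i) (hV : IsInitialDatum a V₀)
    (hU : IsLimitSolution a ν ν' V₀ U) (L : (Fin 4 → ℂ) →ₗ[ℂ] (Fin 4 → ℂ)) (n : Fin 3 → ℤ)
    (j : Fin 4) :
    ModeEq (fun t => L (vcoeff a (U t) n) j) (L (vcoeff a V₀ n) j)
      (fun t => L (limitQ a (vcoeff a (U t)) (vcoeff a (U t)) n
        - limitD a ν ν' (vcoeff a (U t)) n) j) :=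
  ModeEq.map L (fun j T => (hU.isL2Loc.isL2Coeff ha).integrableOn n j T)
    (fun j T => (isSource_limit ha ν ν' (hU.isL2Loc.isL2Coeff ha) j).locallyIntegrable n T)
    (fun j => hU.modeEq ha hV n j) j

lemma IsLimitSolution.ae_summable (ha : ∀ i, 0 < a i) (hU : IsLimitSolution a ν ν' V₀ U) :
    ∀ᵐ t ∂(volume.restrict (Set.Ioi (0 : ℝ))), Summable fun n => ‖vcoeff a (U t) n‖ ^ 2 := by
  obtain ⟨G, -, h⟩ := (hU.isL2Loc.isL2Coeff ha).bounded
  exact h.mono fun t ht => ht.1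

/-- The horizontal averages vanish for all times. -/
lemma IsLimitSolution.ae_hzero (ha : ∀ i, 0 < a i) (hV : IsInitialDatum a V₀)
    (hU : IsLimitSolution a ν ν' V₀ U) :
    ∀ᵐ t ∂(volume.restrict (Set.Ioi (0 : ℝ))), ∀ n : Fin 3 → ℤ, n 0 = 0 ∧ n 1 = 0 →
      vcoeff a (U t) n = 0 := by
  refine ae_all_iff.2 fun n => ?_
  by_cases hn : n 0 = 0 ∧ n 1 = 0
  swap
  · exact Filter.Eventually.of_forall fun t h => absurd h hn
  by_cases hn2 : n 2 = 0
  · have : n = 0 := by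
      funext i; fin_cases i
      exacts [hn.1, hn.2, hn2]
    rw [this]
    exact hU.ae_coeff_zero.mono fun t ht _ => ht
  have hA := hU.isL2Loc.isL2Coeff ha
  have key : ∀ j, ∀ᵐ t ∂(volume.restrict (Set.Ioi (0 : ℝ))),
      modeProj a n 0 (vcoeff a (U t) n) j = 0 := fun j => by
    -- At `n_h = 0` the projected quadratic term is zero, so each kernel component solves `y' + l y
    -- = 0` with zero initial value, `l` being its own viscosity times `|ň|²`.
    refine ModeEq.eq_zero (l := (![ν, ν, ν, ν'] : Fin 4 → ℝ) j * len (wave a n) ^ 2)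
      (fun T => (hA.kerPart ha).integrableOn n j T) ?_
    refine (hU.modeEq_map ha hV (modeProjL a n 0).toLinearMap n j).congr
      (Filter.Eventually.of_forall fun t => rfl) ?_ ?_
    · rw [coeff_eq_zero_of_hzero hV.isL2 hV.zeroHAverage hn, map_zero, Pi.zero_apply]
    · filter_upwards [hU.ae_summable ha] with t ht
      change modeProj a n 0 _ j = _
      rw [modeProj_sub, modeProj_limitQ ha ht, kerTransport_hzero ha _ hn, limitD_hzero _ hn,
        modeProj_modeProj ha, if_pos rfl, zero_sub, modeProj_of_hzero hn hn2,
        modeProj_of_hzero hn hn2]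
      fin_cases j <;> simp [diffSymbol]
  have hw2 : (wave a n 2 : ℂ) ≠ 0 := Complex.ofReal_ne_zero.2 ((wave_eq_zero_iff ha n 2).not.2 hn2)
  filter_upwards [ae_all_iff.2 key, hU.ae_divFree ha] with t ht hd _
  have hd := hd n
  rw [Fin.sum_univ_three, (wave_eq_zero_iff ha n 0).2 hn.1, (wave_eq_zero_iff ha n 1).2 hn.2] at hd
  rw [modeProj_of_hzero hn hn2] at ht
  funext j
  fin_cases j
  · exact ht 0
  · exact ht 1
  -- The third component is invisible to `Π⁰`; it is zero because `ň` is vertical and the field is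
  -- divergence free.
  · simpa [hw2] using hd
  · exact ht 3

lemma limitD_eq_zero {A : (Fin 3 → ℤ) → (Fin 4 → ℂ)} {n : Fin 3 → ℤ} (hn : n 0 = 0 ∧ n 1 = 0)
    (hA : A n = 0) : limitD a ν ν' A n = 0 := by
  rw [limitD_hzero A hn, hA, modeProj_zero]
  have : diffSymbol a ν ν' n 0 = 0 := by ext j; simp [diffSymbol]
  rw [this, modeProj_zero]

/-- The equation of the kernel modes. -/
lemma IsLimitSolution.modeEq_ker (ha : ∀ i, 0 < a i) (hV : IsInitialDatum a V₀)
    (hU : IsLimitSolution a ν ν' V₀ U) (n : Fin 3 → ℤ) (j : Fin 4) :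
    ModeEq (fun t => kerPart a (vcoeff a (U t)) n j) (kerPart a (vcoeff a V₀) n j)
      (fun t => kerTransport a (vcoeff a (U t)) n j
        + ν * (len (wave a n) ^ 2 : ℝ) * kerPart a (vcoeff a (U t)) n j) := by
  refine (hU.modeEq_map ha hV (modeProjL a n 0).toLinearMap n j).congr
    (Filter.Eventually.of_forall fun t => rfl) rfl ?_
  filter_upwards [hU.ae_summable ha, hU.ae_hzero ha hV] with t ht hz
  change modeProj a n 0 _ j = _
  rw [modeProj_sub, modeProj_limitQ ha ht, Pi.sub_apply, sub_eq_add_neg]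
  congr 1
  by_cases hn : n 0 = 0 ∧ n 1 = 0
  · rw [limitD_eq_zero hn (hz n hn), kerPart, hz n hn, modeProj_zero]; simp
  · rw [limitD_eq ha _ hn, modeProj_sub, modeProj_smul, modeProj_smul,
      modeProj_kerPart ha, modeProj_oscPart ha, if_pos rfl, if_pos rfl, smul_zero, sub_zero, kerPart,
      Pi.smul_apply, smul_eq_mul]
    push_cast; ring

/-- The modes span the divergence-free vectors at every `n ≠ 0`, and the coefficient at `n = 0` is
zero by the mean condition. -/
lemma IsLimitSolution.ae_oscPart (ha : ∀ i, 0 < a i) (hU : IsLimitSolution a ν ν' V₀ U) :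
    ∀ᵐ t ∂(volume.restrict (Set.Ioi (0 : ℝ))), ∀ n,
      vcoeff a (U t) n - kerPart a (vcoeff a (U t)) n = oscPart a (vcoeff a (U t)) n := by
  filter_upwards [hU.ae_divFree ha, hU.ae_coeff_zero] with t hd h0 n
  by_cases hn : n = 0
  · rw [hn, kerPart, oscPart, h0]; simp [modeProj_zero]
  · rw [sub_eq_iff_eq_add', kerPart, oscPart, sum_modeProj ha hn (hd n)]

/-- The equation of the oscillating modes. -/
lemma IsLimitSolution.modeEq_osc (ha : ∀ i, 0 < a i) (hnr : Nonresonant a)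
    (hV : IsInitialDatum a V₀) (hU : IsLimitSolution a ν ν' V₀ U) (n : Fin 3 → ℤ) (j : Fin 4) :
    ModeEq (fun t => oscPart a (vcoeff a (U t)) n j)
      (vcoeff a V₀ n j - kerPart a (vcoeff a V₀) n j)
      (fun t => ((2 : ℂ) • limitQ a (kerPart a (vcoeff a (U t))) (oscPart a (vcoeff a (U t))) n) j
        + ((ν + ν') / 2 : ℝ) * (len (wave a n) ^ 2 : ℝ) * oscPart a (vcoeff a (U t)) n j) := by
  -- Applying `1 - Π⁰` instead of `Π⁺ + Π⁻` removes exactly `kerTransport` from `𝒬(U, U)`, leaves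
  -- the interaction term unprojected, and produces the initial value `V₀ - Ū₀` directly. On the
  -- solution the two operators agree by `ae_oscPart`.
  refine (hU.modeEq_map ha hV (LinearMap.id - (modeProjL a n 0).toLinearMap) n j).congr
    ?_ rfl ?_
  · filter_upwards [hU.ae_oscPart ha] with t ht
    rw [← ht n]; rfl
  filter_upwards [hU.ae_summable ha, hU.ae_hzero ha hV] with t ht hz
  change (limitQ a _ _ n j - limitD a ν ν' _ n j) - modeProj a n 0 _ j = _
  rw [modeProj_sub, modeProj_limitQ ha ht, limitQ_self_nonresonant ha hnr ht, Pi.sub_apply,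
    Pi.add_apply]
  have hD : limitD a ν ν' (vcoeff a (U t)) n j - modeProj a n 0 (limitD a ν ν' (vcoeff a (U t)) n) j
      = -(((ν + ν') / 2 : ℝ) * (len (wave a n) ^ 2 : ℝ) * oscPart a (vcoeff a (U t)) n j) := by
    by_cases hn : n 0 = 0 ∧ n 1 = 0
    · rw [limitD_eq_zero hn (hz n hn), oscPart, hz n hn]; simp [modeProj_zero]
    · rw [limitD_eq ha _ hn, modeProj_sub, modeProj_smul, modeProj_smul,
        modeProj_kerPart ha, modeProj_oscPart ha, if_pos rfl, if_pos rfl, smul_zero, sub_zero,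
        Pi.sub_apply, Pi.smul_apply, Pi.smul_apply, Pi.smul_apply, kerPart]
      simp only [smul_eq_mul]
      push_cast; ring
  linear_combination -hD

end StratifiedLimit

end

open scoped ContDiff

noncomputable section

namespace StratifiedLimit

open MeasureTheory

variable {a : Fin 3 → ℝ}

/-! ### Space-time integrals -/

/-- Functions for which the iterated integral over `(0, ∞) × 𝕋³` exists. -/
structure IterIntegrable (a : Fin 3 → ℝ) (F : ℝ → (Fin 3 → ℝ) → ℝ) : Prop where
  slice : ∀ᵐ t ∂(volume.restrict (Set.Ioi (0 : ℝ))), IntegrableOn (F t) (torus a)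
  outer : IntegrableOn (fun t => ∫ x in torus a, F t x) (Set.Ioi 0)

lemma LocL1.iterIntegrable {f φ : ℝ → (Fin 3 → ℝ) → ℝ} (hf : LocL1 a f) (hφ : IsTest a φ) :
    IterIntegrable a (fun t x => f t x * φ t x) :=
  ⟨(hf.mul_test hφ).slice, hf.integrable_mul_test hφ⟩

lemma IterIntegrable.add {F G : ℝ → (Fin 3 → ℝ) → ℝ} (hF : IterIntegrable a F)
    (hG : IterIntegrable a G) : IterIntegrable a (fun t x => F t x + G t x) ∧
      ∫ t in Set.Ioi (0 : ℝ), ∫ x in torus a, F t x + G t x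
        = (∫ t in Set.Ioi (0 : ℝ), ∫ x in torus a, F t x)
          + ∫ t in Set.Ioi (0 : ℝ), ∫ x in torus a, G t x := by
  have h : ∀ᵐ t ∂(volume.restrict (Set.Ioi (0 : ℝ))),
      (∫ x in torus a, F t x) + ∫ x in torus a, G t x = ∫ x in torus a, F t x + G t x := by
    filter_upwards [hF.slice, hG.slice] with t h1 h2
    exact (integral_add h1 h2).symm
  refine ⟨⟨?_, (hF.outer.add hG.outer).congr h⟩, ?_⟩
  · filter_upwards [hF.slice, hG.slice] with t h1 h2 using h1.add h2
  · rw [← integral_congr_ae h]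
    exact integral_add hF.outer hG.outer

lemma IterIntegrable.const_mul {F : ℝ → (Fin 3 → ℝ) → ℝ} (hF : IterIntegrable a F) (c : ℝ) :
    IterIntegrable a (fun t x => c * F t x) ∧
      ∫ t in Set.Ioi (0 : ℝ), ∫ x in torus a, c * F t x
        = c * ∫ t in Set.Ioi (0 : ℝ), ∫ x in torus a, F t x := by
  simp only [integral_const_mul]
  refine ⟨⟨hF.slice.mono fun t h => h.const_mul c, ?_⟩, trivial⟩
  simp only [integral_const_mul]
  exact hF.outer.const_mul c

lemma iterIntegrable_sum {ι : Type*} (s : Finset ι) {F : ι → ℝ → (Fin 3 → ℝ) → ℝ}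
    (hF : ∀ i ∈ s, IterIntegrable a (F i)) : IterIntegrable a (fun t x => ∑ i ∈ s, F i t x) ∧
      ∫ t in Set.Ioi (0 : ℝ), ∫ x in torus a, ∑ i ∈ s, F i t x
        = ∑ i ∈ s, ∫ t in Set.Ioi (0 : ℝ), ∫ x in torus a, F i t x := by
  classical
  induction s using Finset.induction_on with
  | empty =>
    simp only [Finset.sum_empty, integral_zero, and_true]
    exact ⟨Filter.Eventually.of_forall fun t => integrableOn_zero, by simp⟩
  | insert i s hi ih =>
    have h1 := ih fun j hj => hF j (Finset.mem_insert_of_mem hj)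
    have h2 := (hF i (Finset.mem_insert_self i s)).add h1.1
    simp only [Finset.sum_insert hi]
    exact ⟨h2.1, by rw [h2.2, h1.2]⟩

/-! ### Pairings with sources -/

lemma ae_nonneg_Ioi : ∀ᵐ t ∂(volume.restrict (Set.Ioi (0 : ℝ))), 0 ≤ t :=
  (ae_restrict_iff' measurableSet_Ioi).2 (Filter.Eventually.of_forall fun _ ht => (Set.mem_Ioi.1 ht).le)

lemma IsSource.ae_summable (ha : ∀ i, 0 < a i) {H : ℝ → (Fin 3 → ℤ) → ℂ} (hH : IsSource a H)
    {φ : ℝ → (Fin 3 → ℝ) → ℝ} (hφ : IsTest a φ) :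
    ∀ᵐ t ∂(volume.restrict (Set.Ioi (0 : ℝ))),
      Summable fun n => H t n * (starRingEnd ℂ) (coeff a (φ t) n) := by
  obtain ⟨g, -, h⟩ := hH.bounded
  filter_upwards [h, ae_nonneg_Ioi] with t ht h0
  exact summable_mul_conj_coeff ha hφ h0 ht

lemma IsSource.integral_pairing_add (ha : ∀ i, 0 < a i) {H K : ℝ → (Fin 3 → ℤ) → ℂ}
    (hH : IsSource a H) (hK : IsSource a K) {φ : ℝ → (Fin 3 → ℝ) → ℝ} (hφ : IsTest a φ) :
    ∫ t in Set.Ioi (0 : ℝ), pairing a (fun n => H t n + K t n) (φ t)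
      = (∫ t in Set.Ioi (0 : ℝ), pairing a (H t) (φ t))
        + ∫ t in Set.Ioi (0 : ℝ), pairing a (K t) (φ t) := by
  rw [← integral_add (hH.hasSum_integral ha hφ).1 (hK.hasSum_integral ha hφ).1]
  refine integral_congr_ae ?_
  filter_upwards [hH.ae_summable ha hφ, hK.ae_summable ha hφ] with t h1 h2
  simp only [pairing, add_mul]
  rw [h1.tsum_add h2, mul_add]

lemma IsSource.integral_pairing_sum (ha : ∀ i, 0 < a i) {ι : Type*} (s : Finset ι)
    {H : ι → ℝ → (Fin 3 → ℤ) → ℂ} (hH : ∀ i ∈ s, IsSource a (H i)) {φ : ℝ → (Fin 3 → ℝ) → ℝ}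
    (hφ : IsTest a φ) :
    ∫ t in Set.Ioi (0 : ℝ), pairing a (fun n => ∑ i ∈ s, H i t n) (φ t)
      = ∑ i ∈ s, ∫ t in Set.Ioi (0 : ℝ), pairing a (H i t) (φ t) := by
  classical
  induction s using Finset.induction_on with
  | empty => simp [pairing]
  | insert i s hi ih =>
    have hs : ∀ j ∈ s, IsSource a (H j) := fun j hj => hH j (Finset.mem_insert_of_mem hj)
    simp only [Finset.sum_insert hi]
    rw [(hH i (Finset.mem_insert_self i s)).integral_pairing_add ha (IsSource.sum s hs) hφ, ih hs]

/-- Additivity of the pairing in the test function. -/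
lemma IsSource.integral_pairing_test_sum (ha : ∀ i, 0 < a i) {ι : Type*} (s : Finset ι)
    {H : ℝ → (Fin 3 → ℤ) → ℂ} (hH : IsSource a H) {φ : ι → ℝ → (Fin 3 → ℝ) → ℝ}
    (hφ : ∀ i, IsTest a (φ i)) :
    ∫ t in Set.Ioi (0 : ℝ), pairing a (H t) (fun x => ∑ i ∈ s, φ i t x)
      = ∑ i ∈ s, ∫ t in Set.Ioi (0 : ℝ), pairing a (H t) (φ i t) := by
  rw [← integral_finsetSum _ fun i _ => (hH.hasSum_integral ha (hφ i)).1]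
  refine integral_congr_ae ?_
  filter_upwards [(Filter.eventually_all_finset s).2 fun i _ => hH.ae_summable ha (hφ i)] with t ht
  simp only [pairing]
  rw [← Finset.mul_sum, ← Summable.tsum_finsetSum ht]
  congr 2
  funext n
  rw [coeff_sum s (fun i _ => integrableOn_of_contDiff ((hφ i).contDiff_slice t)), map_sum,
    Finset.mul_sum]

lemma pairing_I_wave_mul (ha : ∀ i, 0 < a i) (F : (Fin 3 → ℤ) → ℂ) (i : Fin 3)
    {ψ : (Fin 3 → ℝ) → ℝ} (hψ : ContDiff ℝ ∞ ψ) (hp : IsPeriodic a ψ) :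
    pairing a (fun n => Complex.I * (wave a n i : ℂ) * F n) ψ = -pairing a F (pd i ψ) := by
  simp only [pairing]
  rw [← mul_neg, ← tsum_neg]
  congr 2; funext n
  rw [coeff_pd ha hψ hp, map_mul, map_mul, Complex.conj_I, Complex.conj_ofReal]
  ring

lemma pairing_len_sq_mul (ha : ∀ i, 0 < a i) (F : (Fin 3 → ℤ) → ℂ) (c : ℝ)
    {ψ : (Fin 3 → ℝ) → ℝ} (hψ : ContDiff ℝ ∞ ψ) (hp : IsPeriodic a ψ) :
    pairing a (fun n => (c : ℂ) * (len (wave a n) ^ 2 : ℝ) * F n) ψ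
      = -(c * pairing a F (lap ψ)) := by
  have h : ∀ n, (c : ℂ) * (len (wave a n) ^ 2 : ℝ) * F n * (starRingEnd ℂ) (coeff a ψ n)
      = -(c * (F n * (starRingEnd ℂ) (coeff a (lap ψ) n))) := fun n => by
    rw [coeff_lap ha hψ hp, map_mul, map_neg, Complex.conj_ofReal]
    ring
  simp only [pairing, h]
  rw [tsum_neg, tsum_mul_left]
  ring

/-- A symbol of order at most two applied to uniformly bounded coefficients. -/
lemma isSource_symbol {H : ℝ → (Fin 3 → ℤ) → ℂ}
    (hm : ∀ n, AEStronglyMeasurable (fun t => H t n) (volume.restrict (Set.Ioi (0 : ℝ))))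
    {g : ℝ → ℝ} (hg : ∀ T : ℝ, IntegrableOn g (Set.Icc 0 T))
    (h : ∀ᵐ t ∂(volume.restrict (Set.Ioi (0 : ℝ))), ∀ n, ‖H t n‖ ≤ g t)
    {c : (Fin 3 → ℤ) → ℂ} {C : ℝ} (hc : ∀ n, ‖c n‖ ≤ C * wt a n) :
    IsSource a (fun t n => c n * H t n) where
  measurable n := (hm n).const_mul (c n)
  bounded := by
    refine ⟨fun t => C * g t, fun T => (hg T).const_mul C, ?_⟩
    filter_upwards [h] with t ht n
    have h1 := (norm_nonneg _).trans (hc n)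
    calc ‖c n * H t n‖ ≤ (C * wt a n) * g t := by
          rw [norm_mul]; exact mul_le_mul (hc n) (ht n) (norm_nonneg _) h1
      _ = _ := by ring

lemma norm_I_wave_le (n : Fin 3 → ℤ) (i : Fin 3) : ‖Complex.I * (wave a n i : ℂ)‖ ≤ 1 * wt a n := by
  rw [norm_mul, Complex.norm_I, Complex.norm_real, Real.norm_eq_abs, one_mul, one_mul]
  exact abs_wave_le_wt n i

lemma norm_len_sq_le (n : Fin 3 → ℤ) (c : ℝ) :
    ‖(c : ℂ) * (len (wave a n) ^ 2 : ℝ)‖ ≤ |c| * wt a n := by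
  rw [norm_mul, Complex.norm_real, Complex.norm_real, Real.norm_eq_abs, Real.norm_eq_abs,
    abs_of_nonneg (sq_nonneg (len (wave a n)))]
  have : len (wave a n) ^ 2 ≤ wt a n := by unfold wt; linarith
  gcongr

lemma LocL1.isSource_symbol (ha : ∀ i, 0 < a i) {f : ℝ → (Fin 3 → ℝ) → ℝ} (hf : LocL1 a f)
    {c : (Fin 3 → ℤ) → ℂ} {C : ℝ} (hc : ∀ n, ‖c n‖ ≤ C * wt a n) :
    IsSource a (fun t n => c n * coeff a (f t) n) :=
  StratifiedLimit.isSource_symbol (fun n => hf.aestronglyMeasurable_coeff n)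
    (fun T => (hf.integrableOn_norm T).const_mul (torusVol a)⁻¹)
    (Filter.Eventually.of_forall fun t n => norm_coeff_le ha (f t) n) hc

/-! ### The kernel part of a field -/

lemma vcoeff_lift (u : (Fin 3 → ℝ) → (Fin 2 → ℝ)) (n : Fin 3 → ℤ) :
    vcoeff a (lift u) n = ![vcoeff a u n 0, vcoeff a u n 1, 0, 0] := by
  funext j
  fin_cases j
  · rfl
  · rfl
  · exact coeff_zero n
  · exact coeff_zero n

/-- The kernel projection respects the symmetry `A(-n) = conj (A(n))` of coefficients of real
fields, so the kernel part is again the coefficient family of a real field. -/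
lemma modeProj_neg (ha : ∀ i, 0 < a i) (n : Fin 3 → ℤ) {v w : Fin 4 → ℂ}
    (h : ∀ j, w j = (starRingEnd ℂ) (v j)) (j : Fin 4) :
    modeProj a (-n) 0 w j = (starRingEnd ℂ) (modeProj a n 0 v j) := by
  by_cases hn : n 0 = 0 ∧ n 1 = 0
  · have hn' : (-n) 0 = 0 ∧ (-n) 1 = 0 := by simpa using hn
    by_cases hn2 : n 2 = 0
    · have : n = 0 := by
        funext i; fin_cases i
        exacts [hn.1, hn.2, hn2]
      rw [this, neg_zero, modeProj_of_zero, modeProj_of_zero]; simp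
    · rw [modeProj_of_hzero hn hn2, modeProj_of_hzero hn' (by simpa using hn2)]
      fin_cases j <;> simp [h]
  · have hn' : ¬((-n) 0 = 0 ∧ (-n) 1 = 0) := by simpa using hn
    have hh : hLen (wave a (-n)) = hLen (wave a n) := by simp [hLen, wave_neg]
    rw [modeProj_ker ha hn, modeProj_ker ha hn', hh, wave_neg, wave_neg, h, h]
    fin_cases j <;> simp [Complex.conj_ofReal] <;> ring

/-- Away from `n_h = 0` the kernel is the line of `e⁰`, which is horizontal. This is the form `(ū^h,
0, 0)` of the kernel part. -/
lemma kerPart_eq_cons (ha : ∀ i, 0 < a i) {A : (Fin 3 → ℤ) → (Fin 4 → ℂ)} {n : Fin 3 → ℤ}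
    (hA : n 0 = 0 ∧ n 1 = 0 → A n = 0) :
    kerPart a A n = ![kerPart a A n 0, kerPart a A n 1, 0, 0] := by
  by_cases hn : n 0 = 0 ∧ n 1 = 0
  · rw [kerPart, hA hn, modeProj_zero]
    funext j; fin_cases j <;> rfl
  · rw [kerPart, modeProj_ker ha hn]
    funext j; fin_cases j <;> simp

lemma exists_kerPart_initial (ha : ∀ i, 0 < a i) {V₀ : (Fin 3 → ℝ) → (Fin 4 → ℝ)}
    (hV : IsInitialDatum a V₀) :
    ∃ u₀ : (Fin 3 → ℝ) → (Fin 2 → ℝ), IsL2 a u₀ ∧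
      vcoeff a (lift u₀) = kerPart a (vcoeff a V₀) := by
  have hs : Summable fun n => ‖vcoeff a V₀ n‖ ^ 2 :=
    Summable.of_nonneg_of_le (fun n => sq_nonneg _) (fun n => norm_sq_le_sum _)
      (hasSum_sum (s := Finset.univ) fun j _ =>
        hasSum_norm_sq_coeff ha ((memLp_pi_iff.1 hV.isL2) j)).summable
  have key : ∀ i : Fin 4, ∃ f : (Fin 3 → ℝ) → ℝ, MemLp f 2 (volume.restrict (torus a)) ∧
      ∀ n, coeff a f n = kerPart a (vcoeff a V₀) n i := fun i => by
    refine exists_function ha (fun n => modeProj_neg ha n (fun j => (conj_coeff _ n).symm) i) ?_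
    refine Summable.of_nonneg_of_le (fun n => sq_nonneg _) (fun n => ?_) (hs.mul_left (4 ^ 2))
    rw [← mul_pow]
    exact pow_le_pow_left₀ (norm_nonneg _)
      ((norm_le_pi_norm _ i).trans (norm_modeProj_le ha n 0 _)) 2
  choose f hf hc using key
  refine ⟨fun x => ![f 0 x, f 1 x], memLp_pi_iff.2 fun i => ?_, ?_⟩
  · fin_cases i
    exacts [hf 0, hf 1]
  · funext n
    rw [vcoeff_lift, kerPart_eq_cons ha (fun hn =>
      coeff_eq_zero_of_hzero hV.isL2 hV.zeroHAverage hn), ← hc 0, ← hc 1]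
    rfl

variable {ν ν' : ℝ} {V₀ : (Fin 3 → ℝ) → (Fin 4 → ℝ)} {U : ℝ → (Fin 3 → ℝ) → (Fin 4 → ℝ)}

/-- Riesz–Fischer: `Π⁰` is bounded uniformly in `n` and preserves reality, so `exists_field`
realises each component. Two components suffice because the modes with `n_h = 0` are absent for
almost every time. -/
lemma IsLimitSolution.exists_kerPart (ha : ∀ i, 0 < a i) (hV : IsInitialDatum a V₀)
    (hU : IsLimitSolution a ν ν' V₀ U) :
    ∃ u : ℝ → (Fin 3 → ℝ) → (Fin 2 → ℝ), IsL2Loc a u ∧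
      ∀ᵐ t ∂(volume.restrict (Set.Ioi (0 : ℝ))),
        vcoeff a (lift (u t)) = kerPart a (vcoeff a (U t)) := by
  have hA := (hU.isL2Loc.isL2Coeff ha).kerPart ha
  have key : ∀ i : Fin 4, ∃ f : ℝ → (Fin 3 → ℝ) → ℝ, LocL2 a f ∧
      ∀ᵐ t ∂(volume.restrict (Set.Ioi (0 : ℝ))), ∀ n,
        coeff a (f t) n = kerPart a (vcoeff a (U t)) n i := fun i => by
    obtain ⟨G, hG, hAG⟩ := hA.bounded
    refine exists_field ha (c := fun n t => kerPart a (vcoeff a (U t)) n i)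
      (fun n => (continuous_apply i).comp_aestronglyMeasurable (hA.measurable n))
      (Filter.Eventually.of_forall fun t n =>
        modeProj_neg ha n (fun j => (conj_coeff _ n).symm) i) hG ?_
    filter_upwards [hAG] with t ht
    have hle : ∀ n, ‖kerPart a (vcoeff a (U t)) n i‖ ^ 2 ≤ ‖kerPart a (vcoeff a (U t)) n‖ ^ 2 :=
      fun n => pow_le_pow_left₀ (norm_nonneg _) (norm_le_pi_norm _ i) 2
    have hs := Summable.of_nonneg_of_le (fun n => sq_nonneg _) hle ht.1
    exact ⟨hs, (hs.tsum_le_tsum hle ht.1).trans ht.2⟩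
  choose f hf hc using key
  refine ⟨fun t x => ![f 0 t x, f 1 t x], isL2Loc_of_comp fun i => ?_, ?_⟩
  · fin_cases i
    exacts [hf 0, hf 1]
  · filter_upwards [hc 0, hc 1, hU.ae_hzero ha hV] with t h0 h1 hz
    funext n
    rw [vcoeff_lift, kerPart_eq_cons ha (hz n), ← h0, ← h1]
    rfl

/-- For `n_h ≠ 0`, projecting on `ň_h^⊥` is the Biot–Savart law in Fourier variables. At `n_h = 0`
both sides are zero: the left one by the zero horizontal average, the right one by the convention
for division by zero. -/
lemma isHorizontalPart_of_kerPart (ha : ∀ i, 0 < a i) (hV : IsInitialDatum a V₀)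
    {u₀ : (Fin 3 → ℝ) → (Fin 2 → ℝ)} (h2 : IsL2 a u₀)
    (h : vcoeff a (lift u₀) = kerPart a (vcoeff a V₀)) : IsHorizontalPart a V₀ u₀ where
  isL2 := h2
  biotSavart n := by
    intro d ω₀ ψ₀
    have hn' := congrFun h n
    rw [vcoeff_lift] at hn'
    have e0 : vcoeff a u₀ n 0 = kerPart a (vcoeff a V₀) n 0 := congrFun hn' 0
    have e1 : vcoeff a u₀ n 1 = kerPart a (vcoeff a V₀) n 1 := congrFun hn' 1
    by_cases hn : n 0 = 0 ∧ n 1 = 0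
    · have hz := coeff_eq_zero_of_hzero hV.isL2 hV.zeroHAverage hn
      rw [kerPart, hz, modeProj_zero] at e0 e1
      have hψ : ψ₀ = 0 := by simp [ψ₀, hLen_wave_eq_zero hn]
      funext i
      fin_cases i
      · simpa [hψ] using e0
      · simpa [hψ] using e1
    · have hl : (hLen (wave a n) : ℂ) ≠ 0 := Complex.ofReal_ne_zero.2 (hLen_wave_pos ha hn).ne'
      rw [kerPart, modeProj_ker ha hn] at e0 e1
      have hI := Complex.I_sq
      funext i
      fin_cases i
      · refine e0.trans ?_
        simp only [Pi.smul_apply, Matrix.cons_val_zero, smul_eq_mul, ψ₀, ω₀, d, Fin.zero_eta]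
        field_simp
        linear_combination -(-(wave a n 1 : ℂ) * vcoeff a V₀ n 0
          + wave a n 0 * vcoeff a V₀ n 1) * wave a n 1 * hI
      · refine e1.trans ?_
        simp only [Pi.smul_apply, Matrix.cons_val_one, Matrix.cons_val_zero, smul_eq_mul, ψ₀, ω₀, d, Fin.mk_one]
        field_simp
        linear_combination (-(wave a n 1 : ℂ) * vcoeff a V₀ n 0
          + wave a n 0 * vcoeff a V₀ n 1) * wave a n 0 * hI

end StratifiedLimit

end

open scoped ContDiff

noncomputable section

namespace StratifiedLimit

open MeasureTheory

variable {a : Fin 3 → ℝ}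

/-! ### The horizontal transport and the pressure -/

/-- The symbol `ξᵢ ξⱼ / |ξ_h|²`. -/
def rieszSymbol (a : Fin 3 → ℝ) (i j : Fin 2) (n : Fin 3 → ℤ) : ℝ :=
  wave a n i.castSucc * wave a n j.castSucc / hLen (wave a n) ^ 2

/-- The pressure of a horizontal field, in Fourier variables. -/
def pressure (a : Fin 3 → ℝ) (u : (Fin 3 → ℝ) → (Fin 2 → ℝ)) (n : Fin 3 → ℤ) : ℂ :=
  -∑ i, ∑ j, (rieszSymbol a i j n : ℂ) * coeff a (fun x => u x i * u x j) n

lemma abs_rieszSymbol_le (i j : Fin 2) (n : Fin 3 → ℤ) : |rieszSymbol a i j n| ≤ 1 := by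
  have hle : ∀ i : Fin 2, |wave a n i.castSucc| ≤ hLen (wave a n) := fun i => by
    refine Real.abs_le_sqrt ?_
    fin_cases i
    · exact le_add_of_nonneg_right (sq_nonneg _)
    · exact le_add_of_nonneg_left (sq_nonneg _)
  rw [rieszSymbol, abs_div, abs_mul, abs_of_nonneg (sq_nonneg (hLen (wave a n)))]
  refine div_le_one_of_le₀ ?_ (sq_nonneg _)
  rw [pow_two]
  exact mul_le_mul (hle i) (hle j) (abs_nonneg _) ((abs_nonneg _).trans (hle i))

/-- The kernel velocity has no third component and is divergence free, so the derivative may be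
placed on the output frequency, and the sum over `k` becomes the convolution formula for the
products `u i * u j`. Thus `N` is the coefficient of `div_h (u ⊗ u)`, and the right-hand side is its
projection on `ň_h^⊥`. -/
lemma kerTransport_eq (ha : ∀ i, 0 < a i) {A : (Fin 3 → ℤ) → (Fin 4 → ℂ)}
    {u : (Fin 3 → ℝ) → (Fin 2 → ℝ)}
    (hu : ∀ i, MemLp (fun x => u x i) 2 (volume.restrict (torus a)))
    (h : vcoeff a (lift u) = kerPart a A) {n : Fin 3 → ℤ} (hn : ¬(n 0 = 0 ∧ n 1 = 0))
    {N : Fin 2 → ℂ}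
    (hN : ∀ i, N i = ∑ j : Fin 2, Complex.I * (wave a n j.castSucc : ℂ)
      * coeff a (fun x => u x i * u x j) n) :
    kerTransport a A n = ((-(wave a n 1 : ℂ) * N 0 + wave a n 0 * N 1)
      / (hLen (wave a n) : ℂ) ^ 2) • ![-(wave a n 1 : ℂ), (wave a n 0 : ℂ), 0, 0] := by
  have hK : ∀ k, modeProj a k 0 (A k) = ![vcoeff a u k 0, vcoeff a u k 1, 0, 0] := fun k => by
    rw [← vcoeff_lift, h]; rfl
  have hS : ∀ k, ∑ j : Fin 3, modeProj a k 0 (A k) j.castSucc * (Complex.I * (wave a (n - k) j : ℂ))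
      = ∑ j : Fin 2, Complex.I * (wave a n j.castSucc : ℂ) * coeff a (fun x => u x j) k := fun k => by
    have h1 := modeProj_divFree ha k 0 (A k)
    rw [hK, Fin.sum_univ_three] at h1
    rw [hK, Fin.sum_univ_three, Fin.sum_univ_two]
    simp only [wave_sub]
    change vcoeff a u k 0 * (wave a k 0 : ℂ) + vcoeff a u k 1 * (wave a k 1 : ℂ)
      + 0 * (wave a k 2 : ℂ) = 0 at h1
    change vcoeff a u k 0 * (Complex.I * ((wave a n 0 - wave a k 0 : ℝ) : ℂ))
      + vcoeff a u k 1 * (Complex.I * ((wave a n 1 - wave a k 1 : ℝ) : ℂ))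
      + 0 * (Complex.I * ((wave a n 2 - wave a k 2 : ℝ) : ℂ))
      = Complex.I * (wave a n 0 : ℂ) * vcoeff a u k 0 + Complex.I * (wave a n 1 : ℂ) * vcoeff a u k 1
    push_cast
    linear_combination -Complex.I * h1
  have hsum : ∀ i : Fin 2, HasSum (fun k =>
      (∑ j : Fin 2, Complex.I * (wave a n j.castSucc : ℂ) * coeff a (fun x => u x j) k)
        * coeff a (fun x => u x i) (n - k)) (N i) := fun i => by
    have e : N i = ∑ j : Fin 2, Complex.I * (wave a n j.castSucc : ℂ)
        * coeff a (fun x => u x j * u x i) n := by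
      rw [hN]
      refine Finset.sum_congr rfl fun j _ => ?_
      congr 2; funext x; ring
    rw [e]
    have := hasSum_sum (s := Finset.univ) fun (j : Fin 2) _ =>
      (hasSum_coeff_mul ha (hu j) (hu i) n).mul_left (Complex.I * (wave a n j.castSucc : ℂ))
    convert! this using 1
    funext k
    rw [Finset.sum_mul]
    simp only [mul_assoc]
  refine HasSum.tsum_eq ?_
  have hform : ∀ k, triad a A A n 0 0 0 k = ((-(wave a n 1 : ℂ)
      * ((∑ j : Fin 2, Complex.I * (wave a n j.castSucc : ℂ) * coeff a (fun x => u x j) k)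
        * coeff a (fun x => u x 0) (n - k)) + wave a n 0
      * ((∑ j : Fin 2, Complex.I * (wave a n j.castSucc : ℂ) * coeff a (fun x => u x j) k)
        * coeff a (fun x => u x 1) (n - k))) / (hLen (wave a n) : ℂ) ^ 2) •
        ![-(wave a n 1 : ℂ), (wave a n 0 : ℂ), 0, 0] := fun k => by
    rw [triad, if_pos (by simp only [omega_zero, add_zero]), modeProj_ker ha hn, adv, hS, hK]
    rfl
  rw [funext hform]
  exact ((((hsum 0).mul_left _).add ((hsum 1).mul_left _)).div_const _).smul_const _

/-- The self-interaction of the kernel modes is the projected horizontal transport. -/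
lemma kerTransport_eq_add_pressure (ha : ∀ i, 0 < a i) {A : (Fin 3 → ℤ) → (Fin 4 → ℂ)}
    {u : (Fin 3 → ℝ) → (Fin 2 → ℝ)}
    (hu : ∀ i, MemLp (fun x => u x i) 2 (volume.restrict (torus a)))
    (h : vcoeff a (lift u) = kerPart a A) (n : Fin 3 → ℤ) (i : Fin 2) :
    kerTransport a A n i.castSucc.castSucc
      = ∑ j : Fin 2, Complex.I * (wave a n j.castSucc : ℂ) * coeff a (fun x => u x i * u x j) n
        + Complex.I * (wave a n i.castSucc : ℂ) * pressure a u n := by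
  -- At `n_h = 0` all horizontal derivatives vanish on the right, and `kerTransport` vanishes on the
  -- left.
  by_cases hn : n 0 = 0 ∧ n 1 = 0
  · have hw : ∀ j : Fin 2, wave a n j.castSucc = 0 := fun j => by
      fin_cases j
      exacts [(wave_eq_zero_iff ha n 0).2 hn.1, (wave_eq_zero_iff ha n 1).2 hn.2]
    rw [kerTransport_hzero ha A hn]
    simp [hw]
  -- In the plane, projecting on `ň_h^⊥` is the identity minus the projection on `ň_h`; the
  -- subtracted part is the gradient of the pressure.
  · rw [kerTransport_eq ha hu h hn fun i => rfl]
    have hl : (hLen (wave a n) : ℂ) ≠ 0 := Complex.ofReal_ne_zero.2 (hLen_wave_pos ha hn).ne'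
    have hl2 : (hLen (wave a n) : ℂ) ^ 2 = (wave a n 0 : ℂ) ^ 2 + (wave a n 1 : ℂ) ^ 2 := by
      exact_mod_cast hLen_sq (wave a n)
    have hc : coeff a (fun x => u x 1 * u x 0) n = coeff a (fun x => u x 0 * u x 1) n := by
      simp only [mul_comm]
    simp only [pressure, rieszSymbol, Fin.sum_univ_two]
    fin_cases i <;>
    · simp [hc]
      field_simp
      rw [hl2]
      ring

lemma norm_pressure_le (ha : ∀ i, 0 < a i) (u : (Fin 3 → ℝ) → (Fin 2 → ℝ)) (n : Fin 3 → ℤ) :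
    ‖pressure a u n‖ ≤ ∑ i, ∑ j, (torusVol a)⁻¹ * ∫ x in torus a, |u x i * u x j| := by
  rw [pressure, norm_neg]
  refine norm_sum_le_of_le _ fun i _ => norm_sum_le_of_le _ fun j _ => ?_
  rw [norm_mul, Complex.norm_real, Real.norm_eq_abs]
  exact (mul_le_of_le_one_left (norm_nonneg _) (abs_rieszSymbol_le i j n)).trans
    (norm_coeff_le ha _ n)

lemma isPressure_pressure (ha : ∀ i, 0 < a i) {u : ℝ → (Fin 3 → ℝ) → (Fin 2 → ℝ)}
    (hu : IsL2Loc a u) : IsPressure (fun t => pressure a (u t)) where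
  measurable n := (Finset.aestronglyMeasurable_fun_sum _ fun i _ =>
    Finset.aestronglyMeasurable_fun_sum _ fun j _ =>
      (((hu.comp i).mul (hu.comp j)).aestronglyMeasurable_coeff n).const_mul _).neg
  real t n := by
    have hr : ∀ i j, rieszSymbol a i j (-n) = rieszSymbol a i j n := fun i j => by
      have hh : hLen (wave a (-n)) = hLen (wave a n) := by simp [hLen, wave_neg]
      rw [rieszSymbol, rieszSymbol, hh, wave_neg, wave_neg, neg_mul_neg]
    simp only [pressure, map_neg, map_sum, map_mul, Complex.conj_ofReal, conj_coeff, hr]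
  bounded := ⟨fun t => ∑ i, ∑ j, (torusVol a)⁻¹ * ∫ x in torus a, |u t x i * u t x j|,
    fun T => integrable_finsetSum _ fun i _ => integrable_finsetSum _ fun j _ =>
      (((hu.comp i).mul (hu.comp j)).integrableOn_norm T).const_mul _,
    Filter.Eventually.of_forall fun t n => norm_pressure_le ha (u t) n⟩

lemma IsPressure.isSource_symbol {p : ℝ → (Fin 3 → ℤ) → ℂ} (hp : IsPressure p)
    {c : (Fin 3 → ℤ) → ℂ} {C : ℝ} (hc : ∀ n, ‖c n‖ ≤ C * wt a n) :
    IsSource a (fun t n => c n * p t n) := by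
  obtain ⟨g, hg, h⟩ := hp.bounded
  exact StratifiedLimit.isSource_symbol hp.measurable hg h hc

lemma IsPressure.isSource {p : ℝ → (Fin 3 → ℤ) → ℂ} (hp : IsPressure p) : IsSource a p := by
  obtain ⟨g, hg, h⟩ := hp.bounded
  exact isSource_of_bounded hp.measurable hg h

/-! ### The stratified Navier–Stokes system -/

lemma integral_sum_mul_eq {d : ℕ} {f : (Fin 3 → ℝ) → (Fin d → ℝ)}
    (hf : ∀ i, IntegrableOn (fun x => f x i) (torus a)) {ψ : (Fin 3 → ℝ) → (Fin d → ℝ)}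
    (hψ : ∀ i, ContDiff ℝ ∞ fun x => ψ x i) :
    ∫ x in torus a, ∑ i, f x i * ψ x i = ∑ i, ∫ x in torus a, f x i * ψ x i :=
  integral_finsetSum _ fun i _ => integrableOn_mul_contDiff (hf i) (hψ i)

/-- Fields whose modes solve the mode equations of the Navier–Stokes system. -/
theorem isStratifiedNS_of_modeEq (ha : ∀ i, 0 < a i) {ν : ℝ} {u₀ : (Fin 3 → ℝ) → (Fin 2 → ℝ)}
    {u : ℝ → (Fin 3 → ℝ) → (Fin 2 → ℝ)} (hu₀ : IsL2 a u₀) (hu : IsL2Loc a u)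
    (hdiv : ∀ᵐ t ∂(volume.restrict (Set.Ioi (0 : ℝ))), ∀ n,
      ∑ i : Fin 2, (wave a n i.castSucc : ℂ) * vcoeff a (u t) n i = 0)
    (h : ∀ n (i : Fin 2), ModeEq (fun t => vcoeff a (u t) n i) (vcoeff a u₀ n i)
      (fun t => (∑ j : Fin 2, Complex.I * (wave a n j.castSucc : ℂ)
          * coeff a (fun x => u t x i * u t x j) n
        + Complex.I * (wave a n i.castSucc : ℂ) * pressure a (u t) n)
        + (ν : ℂ) * (len (wave a n) ^ 2 : ℝ) * vcoeff a (u t) n i)) :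
    IsStratifiedNS a ν u₀ u where
  isL2Loc := hu
  divFree := by
    filter_upwards [hdiv, ae_all_iff.2 fun j => (hu.comp j).locL1.slice] with t ht hs
    exact (isHDivFree_iff ha hs).2 ht
  equation := by
    refine ⟨fun t => pressure a (u t), isPressure_pressure ha hu, fun φ hφ => ?_⟩
    have hp := isPressure_pressure ha hu
    have hL : ∀ i, LocL1 a (fun t x => u t x i) := fun i => (hu.comp i).locL1
    have hM : ∀ i j, LocL1 a (fun t x => u t x i * u t x j) := fun i j => (hu.comp i).mul (hu.comp j)
    have s1 : ∀ i j : Fin 2, IsSource a (fun t n => Complex.I * (wave a n j.castSucc : ℂ)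
        * coeff a (fun x => u t x i * u t x j) n) := fun i j =>
      (hM i j).isSource_symbol ha fun n => norm_I_wave_le n _
    have s2 : ∀ i : Fin 2, IsSource a (fun t n => Complex.I * (wave a n i.castSucc : ℂ)
        * pressure a (u t) n) := fun i => hp.isSource_symbol fun n => norm_I_wave_le n _
    have s3 : ∀ i : Fin 2, IsSource a (fun t n => (ν : ℂ) * (len (wave a n) ^ 2 : ℝ)
        * vcoeff a (u t) n i) := fun i => (hL i).isSource_symbol ha fun n => norm_len_sq_le n ν
    -- One component of the equation, with every symbol moved onto the test function: `iξ` becomes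
    -- `-∂` and `|ξ|²` becomes `-Δ`.
    have scalar : ∀ i : Fin 2,
        (((∫ t in Set.Ioi (0 : ℝ), ∫ x in torus a, u t x i * dt (fun t x => φ t x i) t x)
          + ∫ x in torus a, u₀ x i * φ 0 x i : ℝ) : ℂ)
        = -(∑ j : Fin 2, ((∫ t in Set.Ioi (0 : ℝ), ∫ x in torus a,
              (u t x i * u t x j) * pd j.castSucc (fun x => φ t x i) x : ℝ) : ℂ))
          - (∫ t in Set.Ioi (0 : ℝ), pairing a (pressure a (u t))
              (pd i.castSucc (fun x => φ t x i)))
          - ν * ((∫ t in Set.Ioi (0 : ℝ), ∫ x in torus a,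
              u t x i * lap (fun x => φ t x i) x : ℝ) : ℂ) := by
      intro i
      have hφi := hφ.comp i
      have e := equation_of_modeEq ha (hL i) (hu₀.integrableOn i)
        (((IsSource.sum Finset.univ fun j _ => s1 i j).add (s2 i)).add (s3 i)) (h · i) hφi
      rw [e, ((IsSource.sum Finset.univ fun j _ => s1 i j).add (s2 i)).integral_pairing_add ha (s3 i)
        hφi, (IsSource.sum Finset.univ fun j _ => s1 i j).integral_pairing_add ha (s2 i) hφi,
        IsSource.integral_pairing_sum ha Finset.univ (fun j _ => s1 i j) hφi]
      have hc : ∀ t, ContDiff ℝ ∞ (fun x => φ t x i) := fun t => hφi.contDiff_slice t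
      have hper : ∀ t, IsPeriodic a (fun x => φ t x i) := fun t => hφi.periodic t
      simp only [pairing_I_wave_mul ha _ _ (hc _) (hper _), pairing_len_sq_mul ha _ _ (hc _) (hper _)]
      simp only [integral_neg, integral_const_mul, Finset.sum_neg_distrib]
      have f1 : ∀ j : Fin 2, ∫ t in Set.Ioi (0 : ℝ),
          pairing a (fun n => coeff a (fun x => u t x i * u t x j) n)
            (pd j.castSucc (fun x => φ t x i))
          = ((∫ t in Set.Ioi (0 : ℝ), ∫ x in torus a,
              (u t x i * u t x j) * pd j.castSucc (fun x => φ t x i) x : ℝ) : ℂ) := fun j =>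
        (hM i j).integral_pairing ha (hφi.pd j.castSucc)
      have f2 : ∫ t in Set.Ioi (0 : ℝ), pairing a (fun n => vcoeff a (u t) n i)
            (lap (fun x => φ t x i))
          = ((∫ t in Set.Ioi (0 : ℝ), ∫ x in torus a,
              u t x i * lap (fun x => φ t x i) x : ℝ) : ℂ) :=
        (hL i).integral_pairing ha hφi.lap
      simp only [f1, f2]
      ring
    -- The weak formulation integrates sums over components and terms; integrability of each summand
    -- is recorded so that the integral can be split and the identities `scalar` added.
    have g1 := iterIntegrable_sum Finset.univ fun (i : Fin 2) _ =>
      (hL i).iterIntegrable (hφ.comp i).dt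
    have g2 := iterIntegrable_sum Finset.univ fun (i : Fin 2) _ =>
      (iterIntegrable_sum Finset.univ fun (j : Fin 2) _ =>
        (hM i j).iterIntegrable ((hφ.comp i).pd j.castSucc)).1
    have g2' : ∀ i : Fin 2, _ := fun i => (iterIntegrable_sum Finset.univ fun (j : Fin 2) _ =>
        (hM i j).iterIntegrable ((hφ.comp i).pd j.castSucc)).2
    have g3 := iterIntegrable_sum Finset.univ fun (i : Fin 2) _ =>
      (hL i).iterIntegrable (hφ.comp i).lap
    have g3' := g3.1.const_mul ν
    have g12 := g1.1.add g2.1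
    have g := g12.1.add g3'.1
    have hd : ∀ t, Differentiable ℝ (φ t) := fun t => (hφ.contDiff_slice t).differentiable (by simp)
    simp only [dt_apply hφ, pd_apply (hd _), lap_apply (hφ.contDiff_slice _)]
    rw [g.2, g12.2, g3'.2, g3.2, g2.2, g1.2,
      integral_sum_mul_eq (fun i => hu₀.integrableOn i)
        (fun i => (hφ.comp i).contDiff_slice 0),
      (hp.isSource (a := a)).integral_pairing_test_sum ha Finset.univ
        (fun i : Fin 2 => (hφ.comp i).pd i.castSucc)]
    simp only [g2']
    simp only [Fin.sum_univ_two]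
    have k0 := scalar 0
    have k1 := scalar 1
    simp only [Fin.sum_univ_two] at k0 k1
    push_cast at k0 k1 ⊢
    linear_combination k0 + k1

/-! ### The linear system for the oscillating part -/

/-- Fields whose modes solve the mode equations of the linear system. -/
theorem isLinearSolution_of_modeEq (ha : ∀ i, 0 < a i) {κ : ℝ}
    {B : ℝ → (Fin 3 → ℤ) → (Fin 4 → ℂ)} {W₀ : (Fin 3 → ℝ) → (Fin 4 → ℝ)}
    {W : ℝ → (Fin 3 → ℝ) → (Fin 4 → ℝ)} (hB : IsL2Coeff B) (hW₀ : IsL2 a W₀) (hW : IsL2Loc a W)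
    (hdiv : ∀ᵐ t ∂(volume.restrict (Set.Ioi (0 : ℝ))), ∀ n,
      ∑ i : Fin 3, (wave a n i : ℂ) * vcoeff a (W t) n i.castSucc = 0)
    (h : ∀ n j, ModeEq (fun t => vcoeff a (W t) n j) (vcoeff a W₀ n j)
      (fun t => ((2 : ℂ) • limitQ a (B t) (vcoeff a (W t)) n) j
        + (κ : ℂ) * (len (wave a n) ^ 2 : ℝ) * vcoeff a (W t) n j)) :
    IsLinearSolution a κ B W₀ W where
  isL2Loc := hW
  divFree := by
    filter_upwards [hdiv, ae_all_iff.2 fun j => (hW.comp j).locL1.slice] with t ht hs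
    exact (isDivFree_iff ha hs).2 ht
  equation φ hφ := by
    have hL : ∀ i, LocL1 a (fun t x => W t x i) := fun i => (hW.comp i).locL1
    have s1 : ∀ j, IsSource a (fun t n => ((2 : ℂ) • limitQ a (B t) (vcoeff a (W t)) n) j) :=
      fun j => (isSource_limitQ ha hB (hW.isL2Coeff ha) j).const_mul (c := fun _ => 2) (C := 2)
        (by simp)
    have s3 : ∀ j, IsSource a (fun t n => (κ : ℂ) * (len (wave a n) ^ 2 : ℝ)
        * vcoeff a (W t) n j) := fun j => (hL j).isSource_symbol ha fun n => norm_len_sq_le n κ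
    have scalar : ∀ j : Fin 4,
        (((∫ t in Set.Ioi (0 : ℝ), ∫ x in torus a, W t x j * dt (fun t x => φ t x j) t x)
          + ∫ x in torus a, W₀ x j * φ 0 x j : ℝ) : ℂ)
        = (∫ t in Set.Ioi (0 : ℝ), pairing a
              (fun n => ((2 : ℂ) • limitQ a (B t) (vcoeff a (W t)) n) j) (fun x => φ t x j))
          - κ * ((∫ t in Set.Ioi (0 : ℝ), ∫ x in torus a,
              W t x j * lap (fun x => φ t x j) x : ℝ) : ℂ) := by
      intro j
      have hφj := hφ.comp j
      have e := equation_of_modeEq ha (hL j) (hW₀.integrableOn j) ((s1 j).add (s3 j)) (h · j) hφj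
      have hc : ∀ t, ContDiff ℝ ∞ (fun x => φ t x j) := fun t => hφj.contDiff_slice t
      have hper : ∀ t, IsPeriodic a (fun x => φ t x j) := fun t => hφj.periodic t
      rw [e, (s1 j).integral_pairing_add ha (s3 j) hφj]
      simp only [pairing_len_sq_mul ha _ _ (hc _) (hper _)]
      rw [integral_neg, integral_const_mul]
      have f2 : ∫ t in Set.Ioi (0 : ℝ), pairing a (fun n => vcoeff a (W t) n j)
            (lap (fun x => φ t x j))
          = ((∫ t in Set.Ioi (0 : ℝ), ∫ x in torus a,
              W t x j * lap (fun x => φ t x j) x : ℝ) : ℂ) :=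
        (hL j).integral_pairing ha hφj.lap
      rw [f2, sub_eq_add_neg]
    have g1 := iterIntegrable_sum Finset.univ fun (i : Fin 4) _ =>
      (hL i).iterIntegrable (hφ.comp i).dt
    have g3 := iterIntegrable_sum Finset.univ fun (i : Fin 4) _ =>
      (hL i).iterIntegrable (hφ.comp i).lap
    have g3' := g3.1.const_mul κ
    have g := g1.1.add g3'.1
    simp only [dt_apply hφ, lap_apply (hφ.contDiff_slice _)]
    rw [g.2, g3'.2, g3.2, g1.2, integral_sum_mul_eq (fun i => hW₀.integrableOn i)
        (fun i => (hφ.comp i).contDiff_slice 0)]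
    simp only [vpairing]
    rw [integral_finsetSum _ fun j _ => ((s1 j).hasSum_integral ha (hφ.comp j)).1]
    have k := Finset.sum_congr (rfl : (Finset.univ : Finset (Fin 4)) = Finset.univ)
      fun j _ => scalar j
    push_cast at k ⊢
    rw [Finset.sum_add_distrib, Finset.sum_sub_distrib, ← Finset.mul_sum] at k
    linear_combination k

/-! ### Both systems for a solution of the limit system -/

variable {ν ν' : ℝ} {V₀ : (Fin 3 → ℝ) → (Fin 4 → ℝ)} {U : ℝ → (Fin 3 → ℝ) → (Fin 4 → ℝ)}
  {u₀ : (Fin 3 → ℝ) → (Fin 2 → ℝ)} {u : ℝ → (Fin 3 → ℝ) → (Fin 2 → ℝ)}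

lemma vcoeff_lift_castSucc (u : (Fin 3 → ℝ) → (Fin 2 → ℝ)) (n : Fin 3 → ℤ) (i : Fin 2) :
    vcoeff a (lift u) n i.castSucc.castSucc = vcoeff a u n i := by
  fin_cases i <;> rfl

/-- `modeEq_ker` with its transport term rewritten as horizontal transport plus pressure gradient;
horizontal incompressibility is the orthogonality of kernel modes to `ň`, the third component being
zero. -/
theorem IsLimitSolution.isStratifiedNS (ha : ∀ i, 0 < a i) (hV : IsInitialDatum a V₀)
    (hU : IsLimitSolution a ν ν' V₀ U) (hu₀ : IsL2 a u₀)
    (h₀ : vcoeff a (lift u₀) = kerPart a (vcoeff a V₀)) (hu : IsL2Loc a u)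
    (h : ∀ᵐ t ∂(volume.restrict (Set.Ioi (0 : ℝ))),
      vcoeff a (lift (u t)) = kerPart a (vcoeff a (U t))) : IsStratifiedNS a ν u₀ u := by
  refine isStratifiedNS_of_modeEq ha hu₀ hu ?_ fun n i => ?_
  · filter_upwards [h] with t ht n
    have := modeProj_divFree ha n 0 (vcoeff a (U t) n)
    change ∑ j : Fin 3, kerPart a (vcoeff a (U t)) n j.castSucc * (wave a n j : ℂ) = 0 at this
    rw [← ht, vcoeff_lift, Fin.sum_univ_three] at this
    rw [Fin.sum_univ_two]
    change vcoeff a (u t) n 0 * (wave a n 0 : ℂ) + vcoeff a (u t) n 1 * (wave a n 1 : ℂ)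
      + 0 * (wave a n 2 : ℂ) = 0 at this
    change (wave a n 0 : ℂ) * vcoeff a (u t) n 0 + (wave a n 1 : ℂ) * vcoeff a (u t) n 1 = 0
    linear_combination this
  · refine (hU.modeEq_ker ha hV n i.castSucc.castSucc).congr ?_ ?_ ?_
    · filter_upwards [h] with t ht
      rw [← ht, vcoeff_lift_castSucc]
    · rw [← h₀, vcoeff_lift_castSucc]
    · filter_upwards [h, ae_all_iff.2 fun i => (hu.comp i).slice] with t ht hs
      rw [kerTransport_eq_add_pressure ha hs ht, ← ht, vcoeff_lift_castSucc]

lemma isL2_lift (hu : IsL2 a u₀) : IsL2 a (lift u₀) := by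
  have h := memLp_pi_iff.1 hu
  refine memLp_pi_iff.2 fun j => ?_
  fin_cases j
  exacts [h 0, h 1, MemLp.zero', MemLp.zero']

lemma isL2Loc_lift (hu : IsL2Loc a u) : IsL2Loc a (fun t => lift (u t)) := by
  refine isL2Loc_of_comp fun j => ?_
  fin_cases j
  exacts [hu.comp 0, hu.comp 1, fun T => MemLp.zero', fun T => MemLp.zero']

lemma vcoeff_sub {d : ℕ} {f g : (Fin 3 → ℝ) → (Fin d → ℝ)}
    (hf : ∀ j, IntegrableOn (fun x => f x j) (torus a))
    (hg : ∀ j, IntegrableOn (fun x => g x j) (torus a)) (n : Fin 3 → ℤ) :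
    vcoeff a (fun x => f x - g x) n = vcoeff a f n - vcoeff a g n := by
  funext j
  exact coeff_sub (hf j) (hg j) n

lemma IsLimitSolution.ae_vcoeff_sub (ha : ∀ i, 0 < a i) (hU : IsLimitSolution a ν ν' V₀ U)
    (hu : IsL2Loc a u) (h : ∀ᵐ t ∂(volume.restrict (Set.Ioi (0 : ℝ))),
      vcoeff a (lift (u t)) = kerPart a (vcoeff a (U t))) :
    ∀ᵐ t ∂(volume.restrict (Set.Ioi (0 : ℝ))),
      vcoeff a (fun x => U t x - lift (u t) x) = oscPart a (vcoeff a (U t)) := by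
  filter_upwards [h, hU.ae_slice, ae_all_iff.2 fun j => ((isL2Loc_lift hu).comp j).locL1.slice,
    hU.ae_oscPart ha] with t ht h1 h2 h3
  funext n
  rw [vcoeff_sub h1 h2, ht, h3]

/-- `modeEq_osc` with the kernel part realised by `lift u` and the oscillating part by the
difference `U - lift u`. Nonresonance enters only through `modeEq_osc`. -/
theorem IsLimitSolution.isLinearSolution (ha : ∀ i, 0 < a i) (hnr : Nonresonant a)
    (hV : IsInitialDatum a V₀)
    (hU : IsLimitSolution a ν ν' V₀ U) (hu₀ : IsL2 a u₀)
    (h₀ : vcoeff a (lift u₀) = kerPart a (vcoeff a V₀)) (hu : IsL2Loc a u)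
    (h : ∀ᵐ t ∂(volume.restrict (Set.Ioi (0 : ℝ))),
      vcoeff a (lift (u t)) = kerPart a (vcoeff a (U t))) :
    IsLinearSolution a ((ν + ν') / 2) (fun t => vcoeff a (lift (u t)))
      (fun x => V₀ x - lift u₀ x) (fun t x => U t x - lift (u t) x) := by
  have hw := hU.ae_vcoeff_sub ha hu h
  refine isLinearSolution_of_modeEq ha ((isL2Loc_lift hu).isL2Coeff ha) (hV.isL2.sub (isL2_lift hu₀))
    (fun T => (hU.isL2Loc T).sub (isL2Loc_lift hu T)) ?_ fun n j => ?_
  · filter_upwards [hw] with t ht n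
    rw [ht]
    have h1 := modeProj_divFree ha n 1 (vcoeff a (U t) n)
    have h2 := modeProj_divFree ha n (-1) (vcoeff a (U t) n)
    refine Eq.trans ?_ ((congrArg₂ (· + ·) h1 h2).trans (add_zero 0))
    rw [← Finset.sum_add_distrib]
    refine Finset.sum_congr rfl fun i _ => ?_
    rw [oscPart, Pi.add_apply]
    ring
  · refine (hU.modeEq_osc ha hnr hV n j).congr ?_ ?_ ?_
    · filter_upwards [hw] with t ht
      rw [ht]
    · rw [vcoeff_sub (fun j => hV.isL2.integrableOn j) (fun j => (isL2_lift hu₀).integrableOn j),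
        h₀]
      rfl
    · filter_upwards [hw, h] with t ht ht'
      rw [ht, ht']

end StratifiedLimit

end

/-! ### The theorem -/

theorem mainTheorem3 :
    (∀ a : Fin 3 → ℝ, (∀ i, 0 < a i) → ∀ ν ν' : ℝ, 0 < ν → 0 < ν' →
      ∀ V₀ : (Fin 3 → ℝ) → (Fin 4 → ℝ), StratifiedLimit.IsInitialDatum a V₀ →
      ∀ U : ℝ → (Fin 3 → ℝ) → (Fin 4 → ℝ), StratifiedLimit.IsLimitSolution a ν ν' V₀ U →
      ∃ (u₀ : (Fin 3 → ℝ) → (Fin 2 → ℝ)) (u : ℝ → (Fin 3 → ℝ) → (Fin 2 → ℝ)),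
        StratifiedLimit.IsHorizontalPart a V₀ u₀ ∧
        (∀ᵐ t ∂(MeasureTheory.volume.restrict (Set.Ioi (0 : ℝ))),
          StratifiedLimit.vcoeff a (StratifiedLimit.lift (u t))
            = StratifiedLimit.kerPart a (StratifiedLimit.vcoeff a (U t))) ∧
        StratifiedLimit.IsStratifiedNS a ν u₀ u) ∧
    (∀ᵐ a : Fin 3 → ℝ, (∀ i, 0 < a i) → ∀ ν ν' : ℝ, 0 < ν → 0 < ν' →
      ∀ V₀ : (Fin 3 → ℝ) → (Fin 4 → ℝ), StratifiedLimit.IsInitialDatum a V₀ →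
      ∀ U : ℝ → (Fin 3 → ℝ) → (Fin 4 → ℝ), StratifiedLimit.IsLimitSolution a ν ν' V₀ U →
      ∃ (u₀ : (Fin 3 → ℝ) → (Fin 2 → ℝ)) (u : ℝ → (Fin 3 → ℝ) → (Fin 2 → ℝ))
        (W : ℝ → (Fin 3 → ℝ) → (Fin 4 → ℝ)),
        StratifiedLimit.IsHorizontalPart a V₀ u₀ ∧
        (∀ᵐ t ∂(MeasureTheory.volume.restrict (Set.Ioi (0 : ℝ))),
          StratifiedLimit.vcoeff a (StratifiedLimit.lift (u t))
            = StratifiedLimit.kerPart a (StratifiedLimit.vcoeff a (U t))) ∧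
        (∀ᵐ t ∂(MeasureTheory.volume.restrict (Set.Ioi (0 : ℝ))),
          StratifiedLimit.vcoeff a (W t)
            = StratifiedLimit.oscPart a (StratifiedLimit.vcoeff a (U t))) ∧
        (∀ᵐ t ∂(MeasureTheory.volume.restrict (Set.Ioi (0 : ℝ))),
          ∀ᵐ x ∂(MeasureTheory.volume.restrict (StratifiedLimit.torus a)),
            U t x = StratifiedLimit.lift (u t) x + W t x) ∧
        StratifiedLimit.IsLinearSolution a ((ν + ν') / 2)
          (fun t => StratifiedLimit.vcoeff a (StratifiedLimit.lift (u t)))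
          (fun x => V₀ x - StratifiedLimit.lift u₀ x) W) := by
  refine ⟨fun a ha ν ν' hν hν' V₀ hV U hU => ?_, ?_⟩
  · obtain ⟨u₀, hu₀, h₀⟩ := StratifiedLimit.exists_kerPart_initial ha hV
    obtain ⟨u, hu, h⟩ := hU.exists_kerPart ha hV
    exact ⟨u₀, u, StratifiedLimit.isHorizontalPart_of_kerPart ha hV hu₀ h₀, h,
      hU.isStratifiedNS ha hV hu₀ h₀ hu h⟩
  · filter_upwards [StratifiedLimit.ae_nonresonant] with a hnr ha ν ν' hν hν' V₀ hV U hU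
    obtain ⟨u₀, hu₀, h₀⟩ := StratifiedLimit.exists_kerPart_initial ha hV
    obtain ⟨u, hu, h⟩ := hU.exists_kerPart ha hV
    -- Taking the oscillating field to be the difference makes the decomposition hold everywhere,
    -- and its coefficients are identified by `ae_vcoeff_sub`.
    exact ⟨u₀, u, fun t x => U t x - StratifiedLimit.lift (u t) x,
      StratifiedLimit.isHorizontalPart_of_kerPart ha hV hu₀ h₀, h, hU.ae_vcoeff_sub ha hu h,
      Filter.Eventually.of_forall fun t => Filter.Eventually.of_forall fun x =>
        (add_sub_cancel _ _).symm,
      hU.isLinearSolution ha (hnr ha) hV hu₀ h₀ hu h⟩
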